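/- Setting. A periodic photonic structure is a pair of positive, piecewise continuous functions $\varepsilon,\mu:\mathbf R\to\mathbf R$ of period one, with operator $\mathcal L\psi=-\frac1\varepsilon\big(\frac1\mu\psi'\big)'$; solutions $\psi$ and their fluxes $\frac1\mu\psi'$ are required to be continuous. It is inversion symmetric if $\varepsilon(x)=\varepsilon(1-x)$ and $\mu(x)=\mu(1-x)$. Let $E_1(k)\le E_2(k)\le\cdots$ be the eigenvalues, with multiplicity, of $\mathcal L\psi=E\psi$, $\psi(x+1)=e^{ik}\psi(x)$, and let $E_j^-$ and $E_j^+$ be the minimum and the maximum of $E_j$ over $[-\pi,\pi]$. A Dirac point is a point $(k^*,E^*)$ with $E^*=E_j(k^*)=E_{j+1}(k^*)$ for some $j\ge1$ whose Bloch modes have multiplicity two and near which $E_j(k)=E^*-\alpha|k-k^*|+O((k-k^*)^2)$, $E_{j+1}(k)=E^*+\alpha|k-k^*|+O((k-k^*)^2)$ for some $\alpha>0$. Zak phase and bulk index. Let $\psi_{E,1},\psi_{E,2}$ solve $\mathcal L\psi=E\psi$ with $(\psi,\frac1\mu\psi')(0)=(1,0)$ and $(0,1)$, and let $(u,v)_X=\int_0^1\varepsilon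 u\bar v\,dx$, with norm $\|\cdot\|_X$. For $0\le k\le\pi$ and $E=E_j(k)$ let $\varphi_{j,k}$ be the $X$-normalization of $\psi_{E,2}(1)\psi_{E,1}+(e^{ik}-\psi_{E,1}(1))\psi_{E,2}$, or $i\psi_{E,2}/\|\psi_{E,2}\|_X$ if that function vanishes identically; let $\varphi_{j,k}(x)=\varphi_{j,-k}(-x)$ for $-\pi<k<0$, and $u_{j,k}(x)=e^{-ikx}\varphi_{j,k}(x)$. The Zak phase of band $j$ is, modulo $2\pi$, $$\theta_j=i\int_{-\pi}^0(\partial_ku_{j,k},u_{j,k})_X\,dk+i\int_0^\pi(\partial_ku_{j,k},u_{j,k})_X\,dk-\operatorname{Im}\ln(\varphi_{j,0},\varphi_{j,0^-})_X-\operatorname{Im}\ln(\varphi_{j,(-\pi)^+},\varphi_{j,\pi})_X,$$ where $\varphi_{j,0^-}$ and $\varphi_{j,(-\pi)^+}$ are one-sided limits in $k$, and where the term $\operatorname{Im}\ln$ belonging to $k=0$ (to $k=\pi$) is left out if band $j$ has a Dirac point at that $k$. If $E_j^+<E_{j+1}^-$, the bulk index of the gap $(E_j^+,E_{j+1}^-)$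 is $$\gamma_j=(-1)^{j+\ell-1}e^{i\sum_{m=1}^j\theta_m},$$ where $\ell$ is the number of Dirac points with $k^*\in[0,\pi]$ at which two of the bands $1,\dots,j$ cross. Theorem. Let $(\varepsilon_1,\mu_1)$ and $(\varepsilon_2,\mu_2)$ be inversion symmetric periodic photonic structures with operators $\mathcal L_1,\mathcal L_2$ that have the same band gap $$I:=\big(E_{m_1}^{(1),+},E_{m_1+1}^{(1),-}\big)=\big(E_{m_2}^{(2),+},E_{m_2+1}^{(2),-}\big)\neq\emptyset$$ for some $m_1,m_2\ge1$ and different bulk indices $\gamma^{(1)}_{m_1}\ne\gamma^{(2)}_{m_2}$. Let $d_1<0<d_2$, let $\varepsilon_d,\mu_d$ be positive on $(d_1,d_2)$ and piecewise continuous (with finite one-sided limits), and put $$\varepsilon(x)=\begin{cases}\varepsilon_1(x-d_1),&x<d_1,\\ \varepsilon_d(x),&d_1<x<d_2,\\ \varepsilon_2(x-d_2),&x>d_2,\end{cases}\qquad \mu(x)=\begin{cases}\mu_1(x-d_1),&x<d_1,\\ \mu_d(x),&d_1<x<d_2,\\ \mu_2(x-d_2),&x>d_2.\end{cases}$$ If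 $$\max\big\{\|\mu_d\|_{L^\infty(d_1,d_2)},\ E\,\|\varepsilon_d\|_{L^\infty(d_1,d_2)}\big\}\,(d_2-d_1)<\frac{\pi}{2}\qquad\text{for all }E\in I,$$ then the perturbed operator $\mathcal A_d\psi=-\frac1\varepsilon\big(\frac1\mu\psi'\big)'$ has an interface mode with energy level in $I$: there are $E\in I$ and a nonzero $\psi\in L^2(\mathbf R)$ with $(\mathcal A_d-E)\psi=0$, $\psi$ and $\frac1\mu\psi'$ being continuous. -/

import Mathlib

open Filter Topology Asymptotics MeasureTheory
open scoped Real ENNReal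

namespace Photonic

/-- `f` is piecewise continuous on `[a, b]`: off finitely many points it is continuous inside the
interval, and all its one-sided limits (taken from within the interval) exist and are finite. -/
def PiecewiseContinuousOn (f : ℝ → ℝ) (a b : ℝ) : Prop :=
  (∃ S : Finset ℝ, ∀ x ∈ Set.Ioo a b, x ∉ S → ContinuousAt f x) ∧
  (∀ x ∈ Set.Ico a b, ∃ l : ℝ, Tendsto f (𝓝[>] x) (𝓝 l)) ∧
  (∀ x ∈ Set.Ioc a b, ∃ l : ℝ, Tendsto f (𝓝[<] x) (𝓝 l))

/-- A periodic photonic structure: permittivity `ε` and permeability `μ` are positive, piecewise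
continuous and periodic with period one. -/
structure IsPeriodicStructure (ε μ : ℝ → ℝ) : Prop where
  ε_pos : ∀ x, 0 < ε x
  μ_pos : ∀ x, 0 < μ x
  ε_periodic : Function.Periodic ε 1
  μ_periodic : Function.Periodic μ 1
  ε_piecewise : PiecewiseContinuousOn ε 0 1
  μ_piecewise : PiecewiseContinuousOn μ 0 1

/-- Inversion symmetry of a structure. -/
structure IsInversionSymmetric (ε μ : ℝ → ℝ) : Prop where
  ε_symm : ∀ x, ε x = ε (1 - x)
  μ_symm : ∀ x, μ x = μ (1 - x)

/-- `ψ` solves `-(1/ε) ((1/μ) ψ')' = E ψ` on the whole line, with flux `p = (1/μ) ψ'`.  Both `ψ` and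
the flux are continuous, and the equations `ψ' = μ p` and `p' = -E ε ψ` are written in integrated
form, so that `ψ` and `p` are locally absolutely continuous and the equations hold at every point of
continuity of `ε` and `μ`. -/
structure IsSolution (ε μ : ℝ → ℝ) (E : ℝ) (ψ p : ℝ → ℂ) : Prop where
  continuous_ψ : Continuous ψ
  continuous_p : Continuous p
  eq_ψ : ∀ x, ψ x = ψ 0 + ∫ t in (0 : ℝ)..x, (μ t : ℂ) * p t
  eq_p : ∀ x, p x = p 0 - (E : ℂ) * ∫ t in (0 : ℝ)..x, (ε t : ℂ) * ψ t

/-- `ψ` is a (possibly zero) Bloch mode with wavenumber `k` and energy `E`. -/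
def IsBlochMode (ε μ : ℝ → ℝ) (k E : ℝ) (ψ : ℝ → ℂ) : Prop :=
  (∃ p, IsSolution ε μ E ψ p) ∧
    ∀ x, ψ (x + 1) = Complex.exp (Complex.I * (k : ℂ)) * ψ x

/-- The dispersion relation `E_j(k)`, `j ≥ 1`: the `j`-th eigenvalue, in increasing order and counted
with multiplicity, of the Bloch eigenvalue problem with wavenumber `k`.  It is the least `lam` such
that the Bloch modes of energy at most `lam` span a space of dimension at least `j`. -/
noncomputable def bandEnergy (ε μ : ℝ → ℝ) (j : ℕ) (k : ℝ) : ℝ :=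
  sInf {lam : ℝ | (j : Cardinal) ≤
    Module.rank ℂ (Submodule.span ℂ {ψ : ℝ → ℂ | ∃ E ≤ lam, IsBlochMode ε μ k E ψ})}

/-- Lower edge `E_j^-` of the `j`-th band: minimum of `E_j` over the Brillouin zone `[-π, π]`. -/
noncomputable def bandLower (ε μ : ℝ → ℝ) (j : ℕ) : ℝ :=
  sInf (bandEnergy ε μ j '' Set.Icc (-π) π)

/-- Upper edge `E_j^+` of the `j`-th band: maximum of `E_j` over the Brillouin zone `[-π, π]`. -/
noncomputable def bandUpper (ε μ : ℝ → ℝ) (j : ℕ) : ℝ :=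
  sSup (bandEnergy ε μ j '' Set.Icc (-π) π)

/-- `(k₀, E₀)` is a Dirac point at which the bands `j` and `j + 1` cross: the two dispersion curves
meet there in a cone, and the Bloch modes at `(k₀, E₀)` have multiplicity two. -/
def IsDiracPoint (ε μ : ℝ → ℝ) (j : ℕ) (k₀ E₀ : ℝ) : Prop :=
  1 ≤ j ∧ bandEnergy ε μ j k₀ = E₀ ∧ bandEnergy ε μ (j + 1) k₀ = E₀ ∧
  (∃ α : ℝ, 0 < α ∧
    (fun k => bandEnergy ε μ j k - (E₀ - α * |k - k₀|)) =O[𝓝 k₀] (fun k => (k - k₀) ^ 2) ∧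
    (fun k => bandEnergy ε μ (j + 1) k - (E₀ + α * |k - k₀|))
      =O[𝓝 k₀] (fun k => (k - k₀) ^ 2)) ∧
  Module.finrank ℂ (Submodule.span ℂ {ψ : ℝ → ℂ | IsBlochMode ε μ k₀ E₀ ψ}) = 2

/-- The band `j` meets one of its neighbours in a Dirac point with wavenumber `k₀`. -/
def HasDiracPointAt (ε μ : ℝ → ℝ) (j : ℕ) (k₀ : ℝ) : Prop :=
  ∃ E₀, IsDiracPoint ε μ j k₀ E₀ ∨ IsDiracPoint ε μ (j - 1) k₀ E₀

/-- The number of Dirac points below the band `j`, that is, of Dirac points in the reduced Brillouin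
zone `[0, π]` at which two of the bands `1, …, j` cross. -/
noncomputable def numDiracPointsBelow (ε μ : ℝ → ℝ) (j : ℕ) : ℕ :=
  {q : ℝ × ℝ | q.1 ∈ Set.Icc 0 π ∧ ∃ m, m < j ∧ IsDiracPoint ε μ m q.1 q.2}.ncard

/-- The solution `ψ` of the equation at energy `E` with `ψ(0) = a` and flux `b` at `0`. -/
noncomputable def initialSolution (ε μ : ℝ → ℝ) (E : ℝ) (a b : ℂ) : ℝ → ℂ :=
  Classical.epsilon fun ψ => ∃ p, IsSolution ε μ E ψ p ∧ ψ 0 = a ∧ p 0 = b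

/-- The fundamental solution `ψ_{E,1}`. -/
noncomputable def fund₁ (ε μ : ℝ → ℝ) (E : ℝ) : ℝ → ℂ := initialSolution ε μ E 1 0

/-- The fundamental solution `ψ_{E,2}`. -/
noncomputable def fund₂ (ε μ : ℝ → ℝ) (E : ℝ) : ℝ → ℂ := initialSolution ε μ E 0 1

/-- The inner product of `X = L²([0, 1], ε dx)`. -/
noncomputable def innerX (ε : ℝ → ℝ) (u v : ℝ → ℂ) : ℂ :=
  ∫ x in (0 : ℝ)..1, (ε x : ℂ) * u x * (starRingEnd ℂ) (v x)

/-- The norm of `X = L²([0, 1], ε dx)`. -/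
noncomputable def normX (ε : ℝ → ℝ) (u : ℝ → ℂ) : ℝ :=
  Real.sqrt (∫ x in (0 : ℝ)..1, ε x * ‖u x‖ ^ 2)

/-- The Bloch mode `ψ_{E,2}(1) ψ_{E,1} + (e^{ik} - ψ_{E,1}(1)) ψ_{E,2}`, `E = E_j(k)`, before
normalization. -/
noncomputable def rawBloch (ε μ : ℝ → ℝ) (j : ℕ) (k : ℝ) : ℝ → ℂ := fun x =>
  let E := bandEnergy ε μ j k
  fund₂ ε μ E 1 * fund₁ ε μ E x +
    (Complex.exp (Complex.I * (k : ℂ)) - fund₁ ε μ E 1) * fund₂ ε μ E x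

open Classical in
/-- The normalized Bloch mode of the band `j` for `k ∈ [0, π]`.  The second case only occurs for
`k = 0` or `k = π`. -/
noncomputable def blochModeHalf (ε μ : ℝ → ℝ) (j : ℕ) (k : ℝ) : ℝ → ℂ := fun x =>
  if rawBloch ε μ j k ≠ 0 then
    rawBloch ε μ j k x / (normX ε (rawBloch ε μ j k) : ℂ)
  else
    Complex.I * fund₂ ε μ (bandEnergy ε μ j k) x /
      (normX ε (fund₂ ε μ (bandEnergy ε μ j k)) : ℂ)

/-- The normalized Bloch modes `φ_{j,k}`, extended by `φ_{j,k}(x) = φ_{j,-k}(-x)` for `k < 0`. -/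
noncomputable def blochMode (ε μ : ℝ → ℝ) (j : ℕ) (k : ℝ) : ℝ → ℂ := fun x =>
  if 0 ≤ k then blochModeHalf ε μ j k x else blochModeHalf ε μ j (-k) (-x)

/-- The periodic part `u_{j,k}(x) = e^{-ikx} φ_{j,k}(x)` of the Bloch mode. -/
noncomputable def blochPeriodic (ε μ : ℝ → ℝ) (j : ℕ) (k : ℝ) : ℝ → ℂ := fun x =>
  Complex.exp (-(Complex.I * (k : ℂ) * (x : ℂ))) * blochMode ε μ j k x

/-- The Berry connection `(∂u_{j,k}/∂k, u_{j,k})_X`. -/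
noncomputable def berryConnection (ε μ : ℝ → ℝ) (j : ℕ) (k : ℝ) : ℂ :=
  innerX ε (fun x => deriv (fun k' => blochPeriodic ε μ j k' x) k) (blochPeriodic ε μ j k)

/-- The limit `φ_{j,0^-}` of `φ_{j,k}` for `k → 0` from the left. -/
noncomputable def blochModeZeroLeft (ε μ : ℝ → ℝ) (j : ℕ) : ℝ → ℂ := fun x =>
  limUnder (𝓝[<] (0 : ℝ)) (fun k => blochMode ε μ j k x)

/-- The limit `φ_{j,(-π)^+}` of `φ_{j,k}` for `k → -π` from the right. -/
noncomputable def blochModeNegPiRight (ε μ : ℝ → ℝ) (j : ℕ) : ℝ → ℂ := fun x =>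
  limUnder (𝓝[>] (-π)) (fun k => blochMode ε μ j k x)

open Classical in
/-- The phase jump `-Im ln (φ_{j,0}, φ_{j,0^-})_X` at `k = 0`.  If the band has a Dirac point there,
the one-sided limits are orthogonal and the jump has no value of its own; the formal contributions of
the two crossing bands cancel, and they are left out. -/
noncomputable def phaseJumpZero (ε μ : ℝ → ℝ) (j : ℕ) : ℝ :=
  if HasDiracPointAt ε μ j 0 then 0
  else -(innerX ε (blochMode ε μ j 0) (blochModeZeroLeft ε μ j)).arg

open Classical in
/-- The phase jump `-Im ln (φ_{j,(-π)^+}, φ_{j,π})_X` at `k = ±π`, with the same convention at a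
Dirac point. -/
noncomputable def phaseJumpPi (ε μ : ℝ → ℝ) (j : ℕ) : ℝ :=
  if HasDiracPointAt ε μ j π then 0
  else -(innerX ε (blochModeNegPiRight ε μ j) (blochMode ε μ j π)).arg

/-- The Zak phase `θ_j` of the band `j` (meaningful modulo `2π`). -/
noncomputable def zakPhase (ε μ : ℝ → ℝ) (j : ℕ) : ℂ :=
  Complex.I * (∫ k in (-π)..0, berryConnection ε μ j k) +
    Complex.I * (∫ k in (0 : ℝ)..π, berryConnection ε μ j k) +
    (phaseJumpZero ε μ j : ℂ) + (phaseJumpPi ε μ j : ℂ)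

/-- The bulk topological index `γ_j = (-1)^{j+ℓ-1} exp(i ∑_{m=1}^j θ_m)`, `j ≥ 1`, where `ℓ` is the
number of Dirac points below the band `j`. -/
noncomputable def bulkIndex (ε μ : ℝ → ℝ) (j : ℕ) : ℂ :=
  (-1) ^ (j + numDiracPointsBelow ε μ j - 1) *
    Complex.exp (Complex.I * ∑ m ∈ Finset.Icc 1 j, zakPhase ε μ m)

/-- The coefficient `f₁(x - d₁)` for `x < d₁`, `f_d(x)` on the defect, `f₂(x - d₂)` for `x > d₂`. -/
noncomputable def withDefect (f₁ fd f₂ : ℝ → ℝ) (d₁ d₂ : ℝ) : ℝ → ℝ := fun x =>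
  if x < d₁ then f₁ (x - d₁) else if x ≤ d₂ then fd x else f₂ (x - d₂)

/-- `ψ` is an interface mode with energy level `E`: a nonzero square integrable solution. -/
def IsInterfaceMode (ε μ : ℝ → ℝ) (E : ℝ) (ψ : ℝ → ℂ) : Prop :=
  ψ ≠ 0 ∧ MemLp ψ 2 volume ∧ ∃ p, IsSolution ε μ E ψ p

/-- The norm of `L^∞(a, b)`. -/
noncomputable def supNorm (f : ℝ → ℝ) (a b : ℝ) : ℝ :=
  (eLpNorm f ∞ (volume.restrict (Set.Ioo a b))).toReal

end Photonic

/-! Write the equation as `u' = μ p`, `p' = -E ε u`. Inversion symmetry makes the two diagonal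
entries of the monodromy matrix over one period equal (`hill_p₂`), so the matrix has rows (A, B) and
(C, A) with A² - BC = 1, and everything is read off from A, B, C as functions of E. Bloch modes
exist exactly where |A| ≤ 1, and A = cos k is the dispersion relation. The Prüfer angle of ψ_{E,2}
over a period increases strictly with E (`strictMono_hillTheta`), which orders the zeros of B, the
Dirichlet eigenvalues. Between consecutive ones ±A runs from 1 to -1 and decreases wherever |A| ≤ 1
(`band_spec`), so there is one band in each interval. The sign of C at a Dirichlet eigenvalue tells
whether it is the lower or the upper edge of an open gap; C = 0 means that the neighbouring bands
touch, in a Dirac point.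

The Berry connection is odd in k, so a Zak phase reduces to its two phase jumps. Away from Dirac
points a jump contributes the sign of ∫ ε φ² at a band edge: 1 if the edge mode is the even solution
ψ_{E,1}, -1 if it is i times the odd solution ψ_{E,2}. The two edges of an open gap contribute -1
together; a closed gap contributes 1, and its Dirac point supplies the missing sign. The product
telescopes (`bulkIndex_eq`), so the index of an open gap is -1 exactly when its lower edge is the
Dirichlet eigenvalue.

Inside a gap the monodromy matrix has the eigenvectors (√|B|, ±√|C|), one growing and one decaying;
which is which depends on the sign of AB, and this sign is determined by the index (`gap_spec`). If
the indices differ, the vector decaying to the left for the first structure and the one decaying to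
the right for the second lie in the same closed quadrant, on different axes at the lower edge, and
have exchanged these axes at the upper edge. Up to a positive factor the defect rotates the first
vector by an angle between 0 and π/2. The Wronskian of the rotated vector with the second one is
still negative at the lower edge and positive near the upper edge. At a zero in between the two
decaying solutions match (`exists_bound_state`). -/

namespace Photonic

/-! ### Coefficients and solutions of the first order system -/

/-- A bounded function that is continuous off a countable set. -/
structure Coef (f : ℝ → ℝ) : Prop where
  bdd : ∃ C, ∀ x, |f x| ≤ C
  cont : ∃ S : Set ℝ, S.Countable ∧ ∀ x ∉ S, ContinuousAt f x

namespace Coef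

variable {f : ℝ → ℝ}

/-- The continuity points form a Gδ set, hence a measurable one, and its complement is countable and
so null. -/
theorem aestronglyMeasurable (hf : Coef f) : AEStronglyMeasurable f volume := by
  obtain ⟨S, hS, hc⟩ := hf.cont
  have hm : MeasurableSet {x | ContinuousAt f x} :=
    (IsGδ.setOfPred_continuousAt f).measurableSet
  have h1 : AEStronglyMeasurable f (volume.restrict {x | ContinuousAt f x}) :=
    ContinuousOn.aestronglyMeasurable (fun x hx => ContinuousAt.continuousWithinAt hx) hm
  have h2 : volume.restrict {x | ContinuousAt f x} = volume := by
    apply Measure.restrict_eq_self_of_ae_mem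
    have : S ∈ {s : Set ℝ | sᶜ ∈ ae volume} := by
      simpa [mem_ae_iff] using hS.measure_zero volume
    filter_upwards [this] with x hx using hc x hx
  rwa [h2] at h1

theorem const_mul (hf : Coef f) (c : ℝ) : Coef (fun x => c * f x) := by
  obtain ⟨C, hC⟩ := hf.bdd
  obtain ⟨S, hS, hc⟩ := hf.cont
  refine ⟨⟨|c| * C, fun x => ?_⟩, S, hS, fun x hx => continuousAt_const.mul (hc x hx)⟩
  rw [abs_mul]
  exact mul_le_mul_of_nonneg_left (hC x) (abs_nonneg c)

theorem comp_add (hf : Coef f) (d : ℝ) : Coef (fun x => f (x + d)) := by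
  obtain ⟨C, hC⟩ := hf.bdd
  obtain ⟨S, hS, hc⟩ := hf.cont
  refine ⟨⟨C, fun x => hC _⟩, (fun x => x - d) '' S, hS.image _, fun x hx => ?_⟩
  have h1 : x + d ∉ S := fun h => hx ⟨x + d, h, by ring⟩
  exact ContinuousAt.comp (f := fun x => x + d) (hc _ h1) (by fun_prop)

theorem comp_neg (hf : Coef f) : Coef (fun x => f (-x)) := by
  obtain ⟨C, hC⟩ := hf.bdd
  obtain ⟨S, hS, hc⟩ := hf.cont
  refine ⟨⟨C, fun x => hC _⟩, (fun x => -x) '' S, hS.image _, fun x hx => ?_⟩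
  have h1 : -x ∉ S := fun h => hx ⟨-x, h, by ring⟩
  exact ContinuousAt.comp (f := fun x => -x) (hc _ h1) (by fun_prop)

theorem intervalIntegrable_smul {F : Type*} [NormedAddCommGroup F] [NormedSpace ℝ F]
    (hf : Coef f) {g : ℝ → F} (hg : Continuous g) (a b : ℝ) :
    IntervalIntegrable (fun t => f t • g t) volume a b := by
  obtain ⟨C, hC⟩ := hf.bdd
  have h := (hg.intervalIntegrable (μ := volume) a b)
  rw [intervalIntegrable_iff] at h ⊢
  exact h.bdd_smul C hf.aestronglyMeasurable.restrict (ae_of_all _ fun x => hC x)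

theorem intervalIntegrable_mul (hf : Coef f) {g : ℝ → ℝ} (hg : Continuous g) (a b : ℝ) :
    IntervalIntegrable (fun t => f t * g t) volume a b :=
  hf.intervalIntegrable_smul hg a b

theorem intervalIntegrable (hf : Coef f) (a b : ℝ) : IntervalIntegrable f volume a b := by
  simpa using hf.intervalIntegrable_mul (continuous_const (y := (1 : ℝ))) a b

end Coef

section Sol

variable {F : Type*} [NormedCommRing F] [NormedAlgebra ℝ F]

/-- `u' = m p`, `p' = -e u` in integrated form. -/
structure Sol (m e : ℝ → ℝ) (u p : ℝ → F) : Prop where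
  continuous_u : Continuous u
  continuous_p : Continuous p
  eq_u : ∀ x y, u y - u x = ∫ t in x..y, m t • p t
  eq_p : ∀ x y, p y - p x = -∫ t in x..y, e t • u t

namespace Sol

variable {m e m' e' : ℝ → ℝ} {u p u' p' : ℝ → F}

theorem add (hm : Coef m) (he : Coef e) (h : Sol m e u p) (h' : Sol m e u' p') :
    Sol m e (fun x => u x + u' x) (fun x => p x + p' x) := by
  refine ⟨h.continuous_u.add h'.continuous_u, h.continuous_p.add h'.continuous_p,
    fun x y => ?_, fun x y => ?_⟩
  · simp only [smul_add]
    rw [intervalIntegral.integral_add (hm.intervalIntegrable_smul h.continuous_p x y)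
      (hm.intervalIntegrable_smul h'.continuous_p x y), ← h.eq_u, ← h'.eq_u]
    abel
  · simp only [smul_add]
    rw [intervalIntegral.integral_add (he.intervalIntegrable_smul h.continuous_u x y)
      (he.intervalIntegrable_smul h'.continuous_u x y), neg_add, ← h.eq_p, ← h'.eq_p]
    abel

theorem comp_add (h : Sol m e u p) (d : ℝ) :
    Sol (fun x => m (x + d)) (fun x => e (x + d)) (fun x => u (x + d)) (fun x => p (x + d)) := by
  refine ⟨h.continuous_u.comp (by fun_prop), h.continuous_p.comp (by fun_prop),
    fun x y => ?_, fun x y => ?_⟩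
  · rw [h.eq_u, intervalIntegral.integral_comp_add_right (fun t => m t • p t)]
  · rw [h.eq_p, intervalIntegral.integral_comp_add_right (fun t => e t • u t)]

/-- Reflection reverses derivatives; changing the sign of the flux restores the form of the system.
-/
theorem comp_neg (h : Sol m e u p) :
    Sol (fun x => m (-x)) (fun x => e (-x)) (fun x => u (-x)) (fun x => -p (-x)) := by
  refine ⟨h.continuous_u.comp (by fun_prop), (h.continuous_p.comp (by fun_prop)).neg,
    fun x y => ?_, fun x y => ?_⟩
  · rw [h.eq_u]
    simp only [smul_neg]
    rw [intervalIntegral.integral_neg, intervalIntegral.integral_comp_neg (fun t => m t • p t),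
      ← intervalIntegral.integral_symm]
  · rw [intervalIntegral.integral_comp_neg (fun t => e t • u t), neg_sub_neg, h.eq_p]

variable [CompleteSpace F]

theorem hasDerivAt_u (h : Sol m e u p) (hm : Coef m) {x : ℝ} (hx : ContinuousAt m x) :
    HasDerivAt u (m x • p x) x := by
  have h1 : u = fun y => u 0 + ∫ t in (0 : ℝ)..y, m t • p t := by
    funext y; rw [← h.eq_u]; abel
  rw [h1]
  refine HasDerivAt.const_add _ ?_
  exact intervalIntegral.integral_hasDerivAt_right (hm.intervalIntegrable_smul h.continuous_p _ _)
    (AEStronglyMeasurable.stronglyMeasurableAtFilter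
      (hm.aestronglyMeasurable.smul h.continuous_p.aestronglyMeasurable))
    (hx.smul h.continuous_p.continuousAt)

theorem hasDerivAt_p (h : Sol m e u p) (he : Coef e) {x : ℝ} (hx : ContinuousAt e x) :
    HasDerivAt p (-(e x • u x)) x := by
  have h1 : p = fun y => p 0 + -∫ t in (0 : ℝ)..y, e t • u t := by
    funext y; rw [← h.eq_p]; abel
  rw [h1]
  refine HasDerivAt.const_add _ (HasDerivAt.neg ?_)
  exact intervalIntegral.integral_hasDerivAt_right (he.intervalIntegrable_smul h.continuous_u _ _)
    (AEStronglyMeasurable.stronglyMeasurableAtFilter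
      (he.aestronglyMeasurable.smul h.continuous_u.aestronglyMeasurable))
    (hx.smul h.continuous_u.continuousAt)

/-- Lagrange's identity. -/
theorem lagrange (h : Sol m e u p) (h' : Sol m' e' u' p') (hm : Coef m) (he : Coef e)
    (hm' : Coef m') (he' : Coef e') {x y : ℝ}
    (hmm : ∀ t ∈ Set.Ioo (min x y) (max x y), m t = m' t) :
    (u y * p' y - p y * u' y) - (u x * p' x - p x * u' x) =
      ∫ t in x..y, (e t - e' t) • (u t * u' t) := by
  obtain ⟨S1, hS1, h1⟩ := hm.cont
  obtain ⟨S2, hS2, h2⟩ := he.cont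
  obtain ⟨S3, hS3, h3⟩ := hm'.cont
  obtain ⟨S4, hS4, h4⟩ := he'.cont
  symm
  refine integral_eq_of_hasDerivAt_off_countable (fun t => u t * p' t - p t * u' t) _
    (((hS1.union hS2).union hS3).union hS4) ?_ ?_ ?_
  · exact ((h.continuous_u.mul h'.continuous_p).sub
      (h.continuous_p.mul h'.continuous_u)).continuousOn
  · rintro t ⟨ht, hs⟩
    simp only [Set.mem_union, not_or] at hs
    have d1 := h.hasDerivAt_u hm (h1 t hs.1.1.1)
    have d2 := h.hasDerivAt_p he (h2 t hs.1.1.2)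
    have d3 := h'.hasDerivAt_u hm' (h3 t hs.1.2)
    have d4 := h'.hasDerivAt_p he' (h4 t hs.2)
    refine ((d1.mul d4).sub (d2.mul d3)).congr_deriv ?_
    rw [hmm t ht]
    simp only [sub_smul, smul_mul_assoc, mul_smul_comm, mul_neg, neg_mul]
    abel
  · simp only [sub_smul]
    exact (he.intervalIntegrable_smul (h.continuous_u.mul h'.continuous_u) _ _).sub
      (he'.intervalIntegrable_smul (h.continuous_u.mul h'.continuous_u) _ _)

/-- The right side of Lagrange's identity vanishes. Agreement of the coefficients is needed only
between the two points, so that solutions of the defect problem can be compared with those of a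
periodic structure. -/
theorem wronskian_const (h : Sol m e u p) (h' : Sol m' e' u' p') (hm : Coef m) (he : Coef e)
    (hm' : Coef m') (he' : Coef e') {x y : ℝ}
    (hmm : ∀ t ∈ Set.Ioo (min x y) (max x y), m t = m' t)
    (hee : ∀ t ∈ Set.Ioo (min x y) (max x y), e t = e' t) :
    u y * p' y - p y * u' y = u x * p' x - p x * u' x := by
  have h1 := h.lagrange h' hm he hm' he' hmm
  have h2 : ∫ t in x..y, (e t - e' t) • (u t * u' t) = 0 := by
    rw [intervalIntegral.intervalIntegral_eq_integral_uIoc]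
    rw [Set.uIoc, integral_Ioc_eq_integral_Ioo, setIntegral_eq_zero_of_forall_eq_zero, smul_zero]
    intro t ht
    rw [hee t ht, sub_self, zero_smul]
  rw [h2] at h1
  exact sub_eq_zero.1 h1

/-- Continuous linear maps commute with the integrals. This carries real solutions to complex ones
and covers conjugation and scaling. -/
theorem map {G : Type*} [NormedCommRing G] [NormedAlgebra ℝ G] [CompleteSpace G]
    (h : Sol m e u p) (hm : Coef m) (he : Coef e) (L : F →L[ℝ] G) :
    Sol m e (fun x => L (u x)) (fun x => L (p x)) := by
  refine ⟨L.continuous.comp h.continuous_u, L.continuous.comp h.continuous_p,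
    fun x y => ?_, fun x y => ?_⟩
  · rw [← map_sub, h.eq_u,
      ← L.intervalIntegral_comp_comm (hm.intervalIntegrable_smul h.continuous_p _ _)]
    simp only [map_smul]
  · rw [← map_sub, h.eq_p, map_neg,
      ← L.intervalIntegral_comp_comm (he.intervalIntegrable_smul h.continuous_u _ _)]
    simp only [map_smul]

theorem const_mul (h : Sol m e u p) (hm : Coef m) (he : Coef e) (c : F) :
    Sol m e (fun x => c * u x) (fun x => c * p x) :=
  h.map hm he (ContinuousLinearMap.mul ℝ F c)

end Sol

end Sol

/-! ### Existence -/

/-- Picard iteration as a series: the `n`-th term is at most `M (C|x|)^n / n!`, so the sum converges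
locally uniformly and inherits an exponential bound. The bound sees the coefficients only through
`C`, which makes it uniform for bounded energies. -/
theorem exists_sol {m e : ℝ → ℝ} (hm : Coef m) (he : Coef e) {C : ℝ} (hmC : ∀ x, |m x| ≤ C)
    (heC : ∀ x, |e x| ≤ C) (a b : ℝ) : ∃ u p : ℝ → ℝ, Sol m e u p ∧ u 0 = a ∧ p 0 = b ∧
      ∀ x, |u x| ≤ max |a| |b| * Real.exp (C * |x|) ∧
        |p x| ≤ max |a| |b| * Real.exp (C * |x|) := by
  have hC : 0 ≤ C := (abs_nonneg _).trans (hmC 0)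
  set M := max |a| |b| with hM
  have hM0 : 0 ≤ M := (abs_nonneg a).trans (le_max_left _ _)
  let s : ℕ → (ℝ → ℝ) × (ℝ → ℝ) := fun n => Nat.rec (fun _ => a, fun _ => b)
    (fun _ q => (fun x => ∫ t in (0 : ℝ)..x, m t * q.2 t,
      fun x => ∫ t in (0 : ℝ)..x, -e t * q.1 t)) n
  have hs1 : ∀ n x, (s (n + 1)).1 x = ∫ t in (0 : ℝ)..x, m t * (s n).2 t := fun n x => rfl
  have hs2 : ∀ n x, (s (n + 1)).2 x = ∫ t in (0 : ℝ)..x, -e t * (s n).1 t := fun n x => rfl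
  have hneg : Coef (fun t => -e t) := by simpa using he.const_mul (-1)
  have hnC : ∀ x, |-e x| ≤ C := fun x => by rw [abs_neg]; exact heC x
  have step : ∀ (c : ℝ → ℝ) (g : ℝ → ℝ) (n : ℕ), Coef c → (∀ x, |c x| ≤ C) → Continuous g →
      (∀ x, |g x| ≤ M * ((C * |x|) ^ n / n.factorial)) →
      Continuous (fun x => ∫ t in (0 : ℝ)..x, c t * g t) ∧
      ∀ x, |∫ t in (0 : ℝ)..x, c t * g t| ≤
        M * ((C * |x|) ^ (n + 1) / (n + 1).factorial) := by
    intro c g n hc hcC hg hgb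
    have hint := hc.intervalIntegrable_mul hg
    refine ⟨intervalIntegral.continuous_primitive hint 0, fun x => ?_⟩
    -- Stated for arbitrary coefficients and nonnegative endpoints, so that the reflected integrand
    -- settles negative endpoints.
    have hpos : ∀ y, 0 ≤ y → ∀ c' g' : ℝ → ℝ, (∀ x, |c' x| ≤ C) →
        (∀ x, |g' x| ≤ M * ((C * |x|) ^ n / n.factorial)) →
        |∫ t in (0 : ℝ)..y, c' t * g' t| ≤ M * ((C * |y|) ^ (n + 1) / (n + 1).factorial) := by
      intro y hy c' g' hc' hg'
      have h1 : |∫ t in (0 : ℝ)..y, c' t * g' t| ≤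
          ∫ t in (0 : ℝ)..y, C ^ (n + 1) * M / n.factorial * t ^ n := by
        have hi : IntervalIntegrable (fun t : ℝ => C ^ (n + 1) * M / n.factorial * t ^ n)
            volume 0 y := (continuous_const.mul (continuous_pow n)).intervalIntegrable _ _
        rw [← Real.norm_eq_abs]
        refine intervalIntegral.norm_integral_le_of_norm_le hy (ae_of_all _ fun t ht => ?_) hi
        rw [Real.norm_eq_abs, abs_mul]
        have := mul_le_mul (hc' t) (hg' t) (abs_nonneg _) hC
        rw [abs_of_pos ht.1] at this
        refine this.trans (le_of_eq ?_)
        rw [mul_pow]; ring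
      refine h1.trans (le_of_eq ?_)
      rw [intervalIntegral.integral_const_mul, integral_pow, abs_of_nonneg hy, Nat.factorial_succ]
      have : (n.factorial : ℝ) ≠ 0 := by positivity
      push_cast
      field_simp
      simp only [mul_pow]
      ring
    rcases le_total 0 x with hx | hx
    · exact hpos x hx c g hcC hgb
    · have h2 := hpos (-x) (by linarith) (fun t => c (-t)) (fun t => g (-t))
        (fun t => hcC _) (fun t => by simpa using hgb (-t))
      rw [intervalIntegral.integral_comp_neg (fun t => c t * g t), abs_neg, neg_neg, neg_zero,
        intervalIntegral.integral_symm, abs_neg] at h2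
      exact h2
  have key : ∀ n, (Continuous (s n).1 ∧ ∀ x, |(s n).1 x| ≤ M * ((C * |x|) ^ n / n.factorial)) ∧
      (Continuous (s n).2 ∧ ∀ x, |(s n).2 x| ≤ M * ((C * |x|) ^ n / n.factorial)) := by
    intro n
    induction n with
    | zero =>
      refine ⟨⟨continuous_const, fun x => ?_⟩, ⟨continuous_const, fun x => ?_⟩⟩
      · simp [s, hM]
      · simp [s, hM]
    | succ n ih =>
      exact ⟨step m _ n hm hmC ih.2.1 ih.2.2, step _ _ n hneg hnC ih.1.1 ih.1.2⟩
  have expsum : ∀ r : ℝ, HasSum (fun n : ℕ => M * (r ^ n / n.factorial)) (M * Real.exp r) :=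
    fun r => by
      have := NormedSpace.expSeries_div_hasSum_exp (𝔸 := ℝ) r
      rw [← Real.exp_eq_exp_ℝ] at this
      exact this.mul_left M
  have sumlem : ∀ g : ℕ → ℝ → ℝ, (∀ n, Continuous (g n)) →
      (∀ n x, |g n x| ≤ M * ((C * |x|) ^ n / n.factorial)) →
      Continuous (fun x => ∑' n, g n x) ∧ (∀ x, Summable fun n => g n x) ∧
      (∀ x, |∑' n, g n x| ≤ M * Real.exp (C * |x|)) ∧
      ∀ (c : ℝ → ℝ), Coef c → (∀ x, |c x| ≤ C) → ∀ x,
        HasSum (fun n => ∫ t in (0 : ℝ)..x, c t * g n t)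
          (∫ t in (0 : ℝ)..x, c t * ∑' n, g n t) := by
    intro g hg hgb
    have hmono : ∀ n x R, |x| ≤ R → |g n x| ≤ M * ((C * R) ^ n / n.factorial) := by
      intro n x R hx
      refine (hgb n x).trans ?_
      gcongr
    have hsum : ∀ x, Summable fun n => g n x := fun x =>
      Summable.of_norm_bounded (expsum (C * |x|)).summable (fun n => hgb n x)
    refine ⟨?_, hsum, fun x => ?_, ?_⟩
    · rw [continuous_iff_continuousAt]
      intro x
      have h1 : ContinuousOn (fun x => ∑' n, g n x) (Metric.ball 0 (|x| + 1)) :=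
        continuousOn_tsum (fun n => (hg n).continuousOn) (expsum (C * (|x| + 1))).summable
          (fun n y hy => hmono n y _ (by
            rw [mem_ball_zero_iff, Real.norm_eq_abs] at hy; exact hy.le))
      exact h1.continuousAt (Metric.isOpen_ball.mem_nhds (by simp))
    · rw [← Real.norm_eq_abs]
      exact tsum_of_norm_bounded (expsum (C * |x|)) (fun n => hgb n x)
    · intro c hc hcC x
      refine intervalIntegral.hasSum_integral_of_dominated_convergence
        (fun n _ => C * (M * ((C * |x|) ^ n / n.factorial))) (fun n => ?_) (fun n => ?_) ?_ ?_ ?_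
      · exact (hc.aestronglyMeasurable.mul (hg n).aestronglyMeasurable).restrict
      · refine ae_of_all _ fun t ht => ?_
        rw [Real.norm_eq_abs, abs_mul]
        refine mul_le_mul (hcC t) (hmono n t _ ?_) (abs_nonneg _) hC
        have := Set.uIoc_subset_uIcc ht
        rcases Set.mem_uIcc.1 this with h | h
        · rw [abs_of_nonneg h.1, abs_of_nonneg (h.1.trans h.2)]; exact h.2
        · rw [abs_of_nonpos h.2, abs_of_nonpos (h.1.trans h.2)]; linarith [h.1]
      · exact ae_of_all _ fun t _ => ((expsum (C * |x|)).mul_left C).summable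
      · exact intervalIntegrable_const
      · exact ae_of_all _ fun t _ => (hsum t).hasSum.mul_left _
  obtain ⟨c1, s1, b1, i1⟩ := sumlem (fun n => (s n).1) (fun n => (key n).1.1) (fun n => (key n).1.2)
  obtain ⟨c2, s2, b2, i2⟩ := sumlem (fun n => (s n).2) (fun n => (key n).2.1) (fun n => (key n).2.2)
  -- Each term is the integral of the preceding term of the other component, so splitting off the
  -- zeroth term turns the series into the integral equation.
  have e1 : ∀ x, ∑' n, (s n).1 x = a + ∫ t in (0 : ℝ)..x, m t * ∑' n, (s n).2 t := fun x => by
    rw [(s1 x).tsum_eq_zero_add]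
    congr 1
    exact (i2 m hm hmC x).tsum_eq
  have e2 : ∀ x, ∑' n, (s n).2 x = b + ∫ t in (0 : ℝ)..x, -e t * ∑' n, (s n).1 t := fun x => by
    rw [(s2 x).tsum_eq_zero_add]
    congr 1
    exact (i1 _ hneg hnC x).tsum_eq
  refine ⟨_, _, ⟨c1, c2, fun x y => ?_, fun x y => ?_⟩, ?_, ?_, fun x => ⟨b1 x, b2 x⟩⟩
  · rw [e1 y, e1 x, add_sub_add_left_eq_sub]
    exact intervalIntegral.integral_interval_sub_left (hm.intervalIntegrable_mul c2 _ _)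
      (hm.intervalIntegrable_mul c2 _ _)
  · rw [e2 y, e2 x, add_sub_add_left_eq_sub, ← intervalIntegral.integral_neg]
    simp only [← neg_smul]
    exact intervalIntegral.integral_interval_sub_left (hneg.intervalIntegrable_mul c1 _ _)
      (hneg.intervalIntegrable_mul c1 _ _)
  · simp [e1 0]
  · simp [e2 0]

end Photonic


namespace Photonic

/-! ### The fundamental system and its dependence on the energy -/

open Classical in
/-- The solution of `u' = μ p`, `p' = -E ε u` with `u 0 = a`, `p 0 = b`. -/
noncomputable def solPair (ε μ : ℝ → ℝ) (a b E : ℝ) : (ℝ → ℝ) × (ℝ → ℝ) :=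
  Classical.epsilon fun q => Sol μ (fun t => E * ε t) q.1 q.2 ∧ q.1 0 = a ∧ q.2 0 = b ∧
    ∀ C, (∀ x, |μ x| ≤ C) → (∀ x, |E * ε x| ≤ C) → ∀ x,
      |q.1 x| ≤ max |a| |b| * Real.exp (C * |x|) ∧ |q.2 x| ≤ max |a| |b| * Real.exp (C * |x|)

noncomputable def solU (ε μ : ℝ → ℝ) (a b E x : ℝ) : ℝ := (solPair ε μ a b E).1 x

noncomputable def solP (ε μ : ℝ → ℝ) (a b E x : ℝ) : ℝ := (solPair ε μ a b E).2 x

section Repr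

variable {F : Type*} [NormedCommRing F] [NormedAlgebra ℝ F] [CompleteSpace F]

/-- A solution is determined by its value and flux at a point, on every interval on which the
coefficients agree. -/
theorem Sol.repr_aux {m e m' e' : ℝ → ℝ} (hm : Coef m) (he : Coef e) (hm' : Coef m')
    (he' : Coef e') {u p : ℝ → F} (h : Sol m' e' u p) {u₁ p₁ u₂ p₂ : ℝ → ℝ}
    (h₁ : Sol m e u₁ p₁) (h₂ : Sol m e u₂ p₂) (hu₁ : u₁ 0 = 1) (hp₁ : p₁ 0 = 0)
    (hu₂ : u₂ 0 = 0) (hp₂ : p₂ 0 = 1) {x : ℝ}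
    (hmm : ∀ t ∈ Set.Ioo (min 0 x) (max 0 x), m' t = m t)
    (hee : ∀ t ∈ Set.Ioo (min 0 x) (max 0 x), e' t = e t) :
    u x = u₁ x • u 0 + u₂ x • p 0 ∧ p x = p₁ x • u 0 + p₂ x • p 0 := by
  have c1 := h₁.map (G := F) hm he (algebraMapCLM ℝ F)
  have c2 := h₂.map (G := F) hm he (algebraMapCLM ℝ F)
  have w1 := h.wronskian_const c1 hm' he' hm he hmm hee
  have w2 := h.wronskian_const c2 hm' he' hm he hmm hee
  have w3 := c1.wronskian_const c2 hm he hm he (x := 0) (y := x)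
    (fun _ _ => rfl) (fun _ _ => rfl)
  simp only [algebraMapCLM_apply, hu₁, hp₁, hu₂, hp₂, map_one, map_zero, mul_one, mul_zero,
    sub_zero, zero_sub] at w1 w2 w3
  simp only [Algebra.smul_def]
  constructor
  · linear_combination (-u x) * w3 + algebraMap ℝ F (u₁ x) * w2 - algebraMap ℝ F (u₂ x) * w1
  · linear_combination (-p x) * w3 + algebraMap ℝ F (p₁ x) * w2 - algebraMap ℝ F (p₂ x) * w1

end Repr

section Fund

variable {ε μ : ℝ → ℝ}

/-- The bound must hold for all admissible `C` at once, whereas `exists_sol` yields a solution after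
`C` is fixed. By uniqueness all these solutions coincide. -/
theorem solPair_spec (hε : Coef ε) (hμ : Coef μ) (a b E : ℝ) :
    Sol μ (fun t => E * ε t) (solU ε μ a b E) (solP ε μ a b E) ∧ solU ε μ a b E 0 = a ∧
    solP ε μ a b E 0 = b ∧ ∀ C, (∀ x, |μ x| ≤ C) → (∀ x, |E * ε x| ≤ C) → ∀ x,
      |solU ε μ a b E x| ≤ max |a| |b| * Real.exp (C * |x|) ∧
      |solP ε μ a b E x| ≤ max |a| |b| * Real.exp (C * |x|) := by
  refine Classical.epsilon_spec (p := fun q : (ℝ → ℝ) × (ℝ → ℝ) =>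
    Sol μ (fun t => E * ε t) q.1 q.2 ∧ q.1 0 = a ∧ q.2 0 = b ∧
    ∀ C, (∀ x, |μ x| ≤ C) → (∀ x, |E * ε x| ≤ C) → ∀ x,
      |q.1 x| ≤ max |a| |b| * Real.exp (C * |x|) ∧ |q.2 x| ≤ max |a| |b| * Real.exp (C * |x|)) ?_
  have he := hε.const_mul E
  obtain ⟨C1, h1⟩ := hμ.bdd
  obtain ⟨C2, h2⟩ := he.bdd
  have hCC : ∀ C, (∀ x, |μ x| ≤ C) → (∀ x, |E * ε x| ≤ C) → ∃ u p : ℝ → ℝ,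
      Sol μ (fun t => E * ε t) u p ∧ u 0 = a ∧ p 0 = b ∧ ∀ x,
        |u x| ≤ max |a| |b| * Real.exp (C * |x|) ∧ |p x| ≤ max |a| |b| * Real.exp (C * |x|) :=
    fun C h1 h2 => exists_sol hμ he h1 h2 a b
  obtain ⟨u, p, h, hu, hp, -⟩ := hCC (max C1 C2) (fun x => (h1 x).trans (le_max_left _ _))
    (fun x => (h2 x).trans (le_max_right _ _))
  obtain ⟨u1, p1, hs1, hu1, hp1, -⟩ := exists_sol hμ he
    (fun x => (h1 x).trans (le_max_left C1 C2)) (fun x => (h2 x).trans (le_max_right C1 C2)) 1 0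
  obtain ⟨u2, p2, hs2, hu2, hp2, -⟩ := exists_sol hμ he
    (fun x => (h1 x).trans (le_max_left C1 C2)) (fun x => (h2 x).trans (le_max_right C1 C2)) 0 1
  refine ⟨(u, p), h, hu, hp, fun C hC1 hC2 x => ?_⟩
  obtain ⟨v, q, h', hv, hq, hb⟩ := hCC C hC1 hC2
  have r1 := h.repr_aux hμ he hμ he hs1 hs2 hu1 hp1 hu2 hp2 (x := x)
    (fun _ _ => rfl) (fun _ _ => rfl)
  have r2 := h'.repr_aux hμ he hμ he hs1 hs2 hu1 hp1 hu2 hp2 (x := x)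
    (fun _ _ => rfl) (fun _ _ => rfl)
  simp only
  rw [r1.1, r1.2, hu, hp, ← hv, ← hq, ← r2.1, ← r2.2, hv, hq]
  exact hb x

theorem sol_solU (hε : Coef ε) (hμ : Coef μ) (a b E : ℝ) :
    Sol μ (fun t => E * ε t) (solU ε μ a b E) (solP ε μ a b E) := (solPair_spec hε hμ a b E).1

theorem solU_zero (hε : Coef ε) (hμ : Coef μ) (a b E : ℝ) : solU ε μ a b E 0 = a :=
  (solPair_spec hε hμ a b E).2.1

theorem solP_zero (hε : Coef ε) (hμ : Coef μ) (a b E : ℝ) : solP ε μ a b E 0 = b :=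
  (solPair_spec hε hμ a b E).2.2.1

theorem sol_det (hε : Coef ε) (hμ : Coef μ) (E x : ℝ) :
    solU ε μ 1 0 E x * solP ε μ 0 1 E x - solP ε μ 1 0 E x * solU ε μ 0 1 E x = 1 := by
  have h := (sol_solU hε hμ 1 0 E).wronskian_const (sol_solU hε hμ 0 1 E) hμ (hε.const_mul E) hμ
    (hε.const_mul E) (x := 0) (y := x) (fun _ _ => rfl) (fun _ _ => rfl)
  simpa [solU_zero hε hμ, solP_zero hε hμ] using h

/-- A solution whose coefficients agree with `μ`, `E ε` between `0` and `x` is the combination of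
the fundamental solutions with the same initial values. -/
theorem Sol.repr {F : Type*} [NormedCommRing F] [NormedAlgebra ℝ F] [CompleteSpace F]
    (hε : Coef ε) (hμ : Coef μ) {E : ℝ} {m' e' : ℝ → ℝ} (hm' : Coef m') (he' : Coef e')
    {u p : ℝ → F} (h : Sol m' e' u p) {x : ℝ}
    (hmm : ∀ t ∈ Set.Ioo (min 0 x) (max 0 x), m' t = μ t)
    (hee : ∀ t ∈ Set.Ioo (min 0 x) (max 0 x), e' t = E * ε t) :
    u x = solU ε μ 1 0 E x • u 0 + solU ε μ 0 1 E x • p 0 ∧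
      p x = solP ε μ 1 0 E x • u 0 + solP ε μ 0 1 E x • p 0 :=
  h.repr_aux hμ (hε.const_mul E) hm' he' (sol_solU hε hμ 1 0 E) (sol_solU hε hμ 0 1 E)
    (solU_zero hε hμ _ _ _) (solP_zero hε hμ _ _ _) (solU_zero hε hμ _ _ _)
    (solP_zero hε hμ _ _ _) hmm hee

theorem Sol.repr_self {F : Type*} [NormedCommRing F] [NormedAlgebra ℝ F] [CompleteSpace F]
    (hε : Coef ε) (hμ : Coef μ) {E : ℝ} {u p : ℝ → F} (h : Sol μ (fun t => E * ε t) u p) (x : ℝ) :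
    u x = solU ε μ 1 0 E x • u 0 + solU ε μ 0 1 E x • p 0 ∧
      p x = solP ε μ 1 0 E x • u 0 + solP ε μ 0 1 E x • p 0 :=
  h.repr hε hμ hμ (hε.const_mul E) (fun _ _ => rfl) (fun _ _ => rfl)

theorem sol_bound (hε : Coef ε) (hμ : Coef μ) (a b R X : ℝ) : ∃ K, 0 ≤ K ∧ ∀ E, |E| ≤ R →
    ∀ x, |x| ≤ X → |solU ε μ a b E x| ≤ K ∧ |solP ε μ a b E x| ≤ K := by
  obtain ⟨C1, h1⟩ := hμ.bdd
  obtain ⟨C2, h2⟩ := hε.bdd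
  have p1 := (abs_nonneg _).trans (h1 0)
  refine ⟨max |a| |b| * Real.exp (max C1 (R * C2) * X), by positivity, fun E hE x hx => ?_⟩
  have h := (solPair_spec hε hμ a b E).2.2.2 (max C1 (R * C2))
    (fun x => (h1 x).trans (le_max_left _ _)) (fun x => by
      rw [abs_mul]
      exact (mul_le_mul hE (h2 x) (abs_nonneg _) ((abs_nonneg _).trans hE)).trans
        (le_max_right _ _)) x
  have hle : max |a| |b| * Real.exp (max C1 (R * C2) * |x|) ≤
      max |a| |b| * Real.exp (max C1 (R * C2) * X) := by
    have : 0 ≤ max C1 (R * C2) := p1.trans (le_max_left _ _)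
    gcongr
  exact ⟨h.1.trans hle, h.2.trans hle⟩

/-- The weighted inner product on `[0, x]` of two solutions, at the energies `E` and `E'`. -/
noncomputable def solJ (ε μ : ℝ → ℝ) (a b a' b' E E' x : ℝ) : ℝ :=
  ∫ t in (0 : ℝ)..x, ε t * (solU ε μ a b E t * solU ε μ a' b' E' t)

theorem sol_lagrange (hε : Coef ε) (hμ : Coef μ) (a b a' b' E E' x : ℝ) :
    solU ε μ a b E x * solP ε μ a' b' E' x - solP ε μ a b E x * solU ε μ a' b' E' x =
      a * b' - b * a' + (E - E') * solJ ε μ a b a' b' E E' x := by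
  have h := (sol_solU hε hμ a b E).lagrange (sol_solU hε hμ a' b' E') hμ (hε.const_mul E) hμ
    (hε.const_mul E') (x := 0) (y := x) (fun _ _ => rfl)
  rw [solU_zero hε hμ, solP_zero hε hμ, solU_zero hε hμ, solP_zero hε hμ] at h
  have h2 : ∫ t in (0 : ℝ)..x, (E * ε t - E' * ε t) • (solU ε μ a b E t * solU ε μ a' b' E' t) =
      (E - E') * solJ ε μ a b a' b' E E' x := by
    rw [solJ, ← intervalIntegral.integral_const_mul]
    congr 1; funext t; simp only [smul_eq_mul]; ring
  rw [h2] at h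
  linarith

/-- Variation of constants in exact form: Lagrange's identity against both fundamental solutions
gives two linear equations for the solution at `E'`, solved by means of the unit determinant. The
factor `E' - E` yields Lipschitz continuity as well as the derivative in the energy. -/
theorem sol_sub (hε : Coef ε) (hμ : Coef μ) (a b E E' x : ℝ) :
    solU ε μ a b E' x - solU ε μ a b E x = (E' - E) * (solU ε μ 1 0 E x * solJ ε μ 0 1 a b E E' x
      - solU ε μ 0 1 E x * solJ ε μ 1 0 a b E E' x) ∧
    solP ε μ a b E' x - solP ε μ a b E x = (E' - E) * (solP ε μ 1 0 E x * solJ ε μ 0 1 a b E E' x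
      - solP ε μ 0 1 E x * solJ ε μ 1 0 a b E E' x) := by
  have r := (sol_solU hε hμ a b E).repr_self hε hμ x
  rw [solU_zero hε hμ, solP_zero hε hμ] at r
  simp only [smul_eq_mul] at r
  have l1 := sol_lagrange hε hμ 1 0 a b E E' x
  have l2 := sol_lagrange hε hμ 0 1 a b E E' x
  have d := sol_det hε hμ E x
  rw [r.1, r.2]
  constructor
  · linear_combination (-solU ε μ a b E' x) * d - solU ε μ 1 0 E x * l2 + solU ε μ 0 1 E x * l1
  · linear_combination (-solP ε μ a b E' x) * d - solP ε μ 1 0 E x * l2 + solP ε μ 0 1 E x * l1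

theorem solJ_bound (hε : Coef ε) (hμ : Coef μ) (a b a' b' R X : ℝ) : ∃ K, 0 ≤ K ∧
    ∀ E E', |E| ≤ R → |E'| ≤ R → ∀ x, |x| ≤ X → |solJ ε μ a b a' b' E E' x| ≤ K := by
  obtain ⟨C, hC⟩ := hε.bdd
  obtain ⟨K1, hK1, h1⟩ := sol_bound hε hμ a b R X
  obtain ⟨K2, hK2, h2⟩ := sol_bound hε hμ a' b' R X
  have hC0 := (abs_nonneg _).trans (hC 0)
  refine ⟨C * (K1 * K2) * |X|, by positivity, fun E E' hE hE' x hx => ?_⟩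
  have : |solJ ε μ a b a' b' E E' x| ≤ C * (K1 * K2) * |x - 0| := by
    rw [solJ, ← Real.norm_eq_abs]
    refine intervalIntegral.norm_integral_le_of_norm_le_const fun t ht => ?_
    have htx : |t| ≤ X := by
      have := Set.uIoc_subset_uIcc ht
      refine le_trans ?_ hx
      rcases Set.mem_uIcc.1 this with h | h
      · rw [abs_of_nonneg h.1, abs_of_nonneg (h.1.trans h.2)]; exact h.2
      · rw [abs_of_nonpos h.2, abs_of_nonpos (h.1.trans h.2)]; linarith [h.1]
    rw [Real.norm_eq_abs, abs_mul, abs_mul]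
    have i1 := (h1 E hE t htx).1
    have i2 := (h2 E' hE' t htx).1
    have := hC t
    gcongr
  refine this.trans ?_
  rw [sub_zero]
  exact mul_le_mul_of_nonneg_left (hx.trans (le_abs_self X)) (by positivity)

theorem sol_lipschitz (hε : Coef ε) (hμ : Coef μ) (a b R X : ℝ) : ∃ K, 0 ≤ K ∧
    ∀ E E', |E| ≤ R → |E'| ≤ R → ∀ x, |x| ≤ X →
      |solU ε μ a b E' x - solU ε μ a b E x| ≤ K * |E' - E| ∧
      |solP ε μ a b E' x - solP ε μ a b E x| ≤ K * |E' - E| := by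
  obtain ⟨K1, hK1, h1⟩ := sol_bound hε hμ 1 0 R X
  obtain ⟨K2, hK2, h2⟩ := sol_bound hε hμ 0 1 R X
  obtain ⟨J1, hJ1, j1⟩ := solJ_bound hε hμ 1 0 a b R X
  obtain ⟨J2, hJ2, j2⟩ := solJ_bound hε hμ 0 1 a b R X
  have gen : ∀ p q r s d : ℝ, |p| ≤ K1 → |q| ≤ J2 → |r| ≤ K2 → |s| ≤ J1 →
      |d * (p * q - r * s)| ≤ (K1 * J2 + K2 * J1) * |d| := by
    intro p q r s d hp hq hr hs
    rw [abs_mul, mul_comm]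
    have : |p * q - r * s| ≤ K1 * J2 + K2 * J1 := by
      refine (abs_sub _ _).trans ?_
      rw [abs_mul, abs_mul]
      gcongr
    gcongr
  refine ⟨K1 * J2 + K2 * J1, by positivity, fun E E' hE hE' x hx => ?_⟩
  rw [(sol_sub hε hμ a b E E' x).1, (sol_sub hε hμ a b E E' x).2]
  exact ⟨gen _ _ _ _ _ (h1 E hE x hx).1 (j2 E E' hE hE' x hx) (h2 E hE x hx).1
    (j1 E E' hE hE' x hx), gen _ _ _ _ _ (h1 E hE x hx).2 (j2 E E' hE hE' x hx) (h2 E hE x hx).2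
    (j1 E E' hE hE' x hx)⟩

theorem continuous_of_locally_lipschitz {f : ℝ → ℝ}
    (h : ∀ R, ∃ K, ∀ E E', |E| ≤ R → |E'| ≤ R → |f E' - f E| ≤ K * |E' - E|) : Continuous f := by
  rw [continuous_iff_continuousAt]
  intro E
  obtain ⟨K, hK⟩ := h (|E| + 1)
  rw [ContinuousAt, tendsto_iff_norm_sub_tendsto_zero]
  have h1 : Tendsto (fun E' => K * |E' - E|) (𝓝 E) (𝓝 0) := by
    have : Continuous fun E' => K * |E' - E| := by fun_prop
    simpa using this.tendsto E
  refine squeeze_zero' (Eventually.of_forall fun _ => norm_nonneg _) ?_ h1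
  have : ∀ᶠ E' in 𝓝 E, |E'| < |E| + 1 :=
    continuous_abs.continuousAt.eventually_lt continuousAt_const (by simp)
  filter_upwards [this] with E' hE'
  exact hK E E' (by simp) hE'.le

theorem continuous_solU_energy (hε : Coef ε) (hμ : Coef μ) (a b x : ℝ) :
    Continuous fun E => solU ε μ a b E x :=
  continuous_of_locally_lipschitz fun R => by
    obtain ⟨K, -, h⟩ := sol_lipschitz hε hμ a b R |x|
    exact ⟨K, fun E E' hE hE' => (h E E' hE hE' x le_rfl).1⟩

theorem continuous_solP_energy (hε : Coef ε) (hμ : Coef μ) (a b x : ℝ) :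
    Continuous fun E => solP ε μ a b E x :=
  continuous_of_locally_lipschitz fun R => by
    obtain ⟨K, -, h⟩ := sol_lipschitz hε hμ a b R |x|
    exact ⟨K, fun E E' hE hE' => (h E E' hE hE' x le_rfl).2⟩

theorem solJ_lipschitz (hε : Coef ε) (hμ : Coef μ) (a b a' b' R X : ℝ) : ∃ K, 0 ≤ K ∧
    ∀ E₁ E₁' E₂ E₂', |E₁| ≤ R → |E₁'| ≤ R → |E₂| ≤ R → |E₂'| ≤ R → ∀ x, |x| ≤ X →
      |solJ ε μ a b a' b' E₂ E₂' x - solJ ε μ a b a' b' E₁ E₁' x| ≤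
        K * (|E₂ - E₁| + |E₂' - E₁'|) := by
  obtain ⟨C, hC⟩ := hε.bdd
  obtain ⟨K1, hK1, h1⟩ := sol_bound hε hμ a b R X
  obtain ⟨K2, hK2, h2⟩ := sol_bound hε hμ a' b' R X
  obtain ⟨L1, hL1, l1⟩ := sol_lipschitz hε hμ a b R X
  obtain ⟨L2, hL2, l2⟩ := sol_lipschitz hε hμ a' b' R X
  have hC0 := (abs_nonneg _).trans (hC 0)
  refine ⟨C * (L1 * K2 + K1 * L2) * |X|, by positivity,
    fun E₁ E₁' E₂ E₂' g1 g1' g2 g2' x hx => ?_⟩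
  have hi : ∀ E E', IntervalIntegrable
      (fun t => ε t * (solU ε μ a b E t * solU ε μ a' b' E' t)) volume 0 x := fun E E' =>
    hε.intervalIntegrable_mul ((sol_solU hε hμ a b E).continuous_u.mul
      (sol_solU hε hμ a' b' E').continuous_u) 0 x
  rw [solJ, solJ, ← intervalIntegral.integral_sub (hi _ _) (hi _ _)]
  set D := |E₂ - E₁| + |E₂' - E₁'| with hD
  have d1 : |E₂ - E₁| ≤ D := by rw [hD]; linarith [abs_nonneg (E₂' - E₁')]
  have d2 : |E₂' - E₁'| ≤ D := by rw [hD]; linarith [abs_nonneg (E₂ - E₁)]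
  have hD0 : 0 ≤ D := by positivity
  have : ‖∫ t in (0 : ℝ)..x, (ε t * (solU ε μ a b E₂ t * solU ε μ a' b' E₂' t) -
      ε t * (solU ε μ a b E₁ t * solU ε μ a' b' E₁' t))‖ ≤
      C * ((L1 * D) * K2 + K1 * (L2 * D)) * |x - 0| := by
    refine intervalIntegral.norm_integral_le_of_norm_le_const fun t ht => ?_
    have htx : |t| ≤ X := by
      have := Set.uIoc_subset_uIcc ht
      refine le_trans ?_ hx
      rcases Set.mem_uIcc.1 this with h | h
      · rw [abs_of_nonneg h.1, abs_of_nonneg (h.1.trans h.2)]; exact h.2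
      · rw [abs_of_nonpos h.2, abs_of_nonpos (h.1.trans h.2)]; linarith [h.1]
    have hid : ε t * (solU ε μ a b E₂ t * solU ε μ a' b' E₂' t) -
        ε t * (solU ε μ a b E₁ t * solU ε μ a' b' E₁' t) =
        ε t * ((solU ε μ a b E₂ t - solU ε μ a b E₁ t) * solU ε μ a' b' E₂' t +
          solU ε μ a b E₁ t * (solU ε μ a' b' E₂' t - solU ε μ a' b' E₁' t)) := by ring
    rw [hid, Real.norm_eq_abs, abs_mul]
    have i0 := hC t
    have i1 := (l1 E₁ E₂ g1 g2 t htx).1.trans (mul_le_mul_of_nonneg_left d1 hL1)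
    have i2 := (l2 E₁' E₂' g1' g2' t htx).1.trans (mul_le_mul_of_nonneg_left d2 hL2)
    have i3 := (h2 E₂' g2' t htx).1
    have i4 := (h1 E₁ g1 t htx).1
    refine mul_le_mul i0 ((abs_add_le _ _).trans ?_) (abs_nonneg _) hC0
    rw [abs_mul, abs_mul]
    gcongr
  refine this.trans ?_
  rw [sub_zero]
  have hxX : |x| ≤ |X| := hx.trans (le_abs_self X)
  calc C * ((L1 * D) * K2 + K1 * (L2 * D)) * |x|
      ≤ C * ((L1 * D) * K2 + K1 * (L2 * D)) * |X| := by gcongr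
    _ = _ := by ring

theorem continuous_solJ_diag (hε : Coef ε) (hμ : Coef μ) (a b a' b' x : ℝ) :
    Continuous fun E => solJ ε μ a b a' b' E E x :=
  continuous_of_locally_lipschitz fun R => by
    obtain ⟨K, -, h⟩ := solJ_lipschitz hε hμ a b a' b' R |x|
    exact ⟨K * 2, fun E E' hE hE' => (h E E E' E' hE hE hE' hE' x le_rfl).trans
      (le_of_eq (by ring))⟩

theorem continuous_solJ_right (hε : Coef ε) (hμ : Coef μ) (a b a' b' E x : ℝ) :
    ContinuousAt (fun E' => solJ ε μ a b a' b' E E' x) E := by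
  have : Continuous (fun E' => solJ ε μ a b a' b' E E' x) :=
    continuous_of_locally_lipschitz fun R => by
      obtain ⟨K, -, h⟩ := solJ_lipschitz hε hμ a b a' b' (max |E| R) |x|
      refine ⟨K, fun E₁ E₂ h1 h2 => ?_⟩
      have := h E E₁ E E₂ (le_max_left _ _) (h1.trans (le_max_right _ _)) (le_max_left _ _)
        (h2.trans (le_max_right _ _)) x le_rfl
      simpa using this
  exact this.continuousAt

/-- The difference quotient given by `sol_sub` is continuous in `E'`; the derivative is its value at
`E' = E`. -/
theorem hasDerivAt_sol_energy (hε : Coef ε) (hμ : Coef μ) (a b E x : ℝ) :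
    HasDerivAt (fun E => solU ε μ a b E x) (solU ε μ 1 0 E x * solJ ε μ 0 1 a b E E x
      - solU ε μ 0 1 E x * solJ ε μ 1 0 a b E E x) E ∧
    HasDerivAt (fun E => solP ε μ a b E x) (solP ε μ 1 0 E x * solJ ε μ 0 1 a b E E x
      - solP ε μ 0 1 E x * solJ ε μ 1 0 a b E E x) E := by
  have key : ∀ (f g : ℝ → ℝ), (∀ E', f E' - f E = (E' - E) * g E') → ContinuousAt g E →
      HasDerivAt f (g E) E := by
    intro f g h hg
    rw [hasDerivAt_iff_tendsto_slope]
    refine (hg.tendsto.mono_left nhdsWithin_le_nhds).congr' ?_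
    filter_upwards [self_mem_nhdsWithin] with E' hE'
    have : E' - E ≠ 0 := sub_ne_zero.2 hE'
    rw [slope_def_field, h]
    field_simp
  have c1 := continuous_solJ_right hε hμ 0 1 a b E x
  have c2 := continuous_solJ_right hε hμ 1 0 a b E x
  exact ⟨key _ _ (fun E' => (sol_sub hε hμ a b E E' x).1)
      ((continuousAt_const.mul c1).sub (continuousAt_const.mul c2)),
    key _ _ (fun E' => (sol_sub hε hμ a b E E' x).2)
      ((continuousAt_const.mul c1).sub (continuousAt_const.mul c2))⟩

end Fund

end Photonic


namespace Photonic

/-! ### The monodromy matrix of an inversion symmetric structure -/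

/-- One-sided limits give a bound near each point, and compactness makes it global. -/
theorem PiecewiseContinuousOn.bounded {f : ℝ → ℝ} {a b : ℝ} (hf : PiecewiseContinuousOn f a b) :
    ∃ C, ∀ x ∈ Set.Icc a b, |f x| ≤ C := by
  refine (isCompact_Icc (a := a) (b := b)).induction_on
    (p := fun s => ∃ C, ∀ x ∈ s, |f x| ≤ C) ⟨0, by simp⟩ ?_ ?_ ?_
  · rintro s t hst ⟨C, hC⟩
    exact ⟨C, fun x hx => hC x (hst hx)⟩
  · rintro s t ⟨C, hC⟩ ⟨D, hD⟩
    refine ⟨max C D, fun x hx => ?_⟩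
    rcases hx with hx | hx
    · exact (hC x hx).trans (le_max_left _ _)
    · exact (hD x hx).trans (le_max_right _ _)
  · intro x hx
    have hlim : ∀ l : Filter ℝ, (∃ y : ℝ, Tendsto f l (𝓝 y)) → ∃ C, ∀ᶠ t in l, |f t| ≤ C := by
      rintro l ⟨y, hy⟩
      have := hy.abs.eventually_lt_const (show |y| < |y| + 1 by linarith)
      exact ⟨|y| + 1, this.mono fun t ht => ht.le⟩
    have hr : ∃ C, ∀ᶠ t in 𝓝[>] x, t ∈ Set.Icc a b → |f t| ≤ C := by
      rcases eq_or_lt_of_le hx.2 with h | h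
      · refine ⟨0, ?_⟩
        filter_upwards [self_mem_nhdsWithin] with t ht htI
        exact absurd (h ▸ htI.2) (not_le.2 ht)
      · obtain ⟨C, hC⟩ := hlim _ (hf.2.1 x ⟨hx.1, h⟩)
        exact ⟨C, hC.mono fun t ht _ => ht⟩
    have hl : ∃ C, ∀ᶠ t in 𝓝[<] x, t ∈ Set.Icc a b → |f t| ≤ C := by
      rcases eq_or_lt_of_le hx.1 with h | h
      · refine ⟨0, ?_⟩
        filter_upwards [self_mem_nhdsWithin] with t ht htI
        exact absurd (h ▸ htI.1) (not_le.2 ht)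
      · obtain ⟨C, hC⟩ := hlim _ (hf.2.2 x ⟨h, hx.2⟩)
        exact ⟨C, hC.mono fun t ht _ => ht⟩
    obtain ⟨C, hC⟩ := hr
    obtain ⟨D, hD⟩ := hl
    have h3 : ∀ᶠ t in 𝓝 x, t ∈ Set.Icc a b → |f t| ≤ max (max C D) |f x| := by
      rw [← nhdsNE_sup_pure, ← nhdsLT_sup_nhdsGT, eventually_sup, eventually_sup]
      refine ⟨⟨hD.mono fun t ht h => (ht h).trans ?_, hC.mono fun t ht h => (ht h).trans ?_⟩, ?_⟩
      · exact (le_max_right _ _).trans (le_max_left _ _)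
      · exact (le_max_left _ _).trans (le_max_left _ _)
      · simp
    exact ⟨_, inter_mem_nhdsWithin _ h3, _, fun t ht => ht.2 ht.1⟩

/-- The exceptional set consists of the integer translates of the given one and of `0`, because
continuity is assumed only inside the period cell. -/
theorem coef_of_periodic {f : ℝ → ℝ} (hp : Function.Periodic f 1)
    (hf : PiecewiseContinuousOn f 0 1) : Coef f := by
  obtain ⟨C, hC⟩ := hf.bounded
  obtain ⟨S, hS⟩ := hf.1
  refine ⟨⟨C, fun x => ?_⟩, ⋃ n : ℤ, (fun y => y + n) '' ((S : Set ℝ) ∪ {0}), ?_, fun x hx => ?_⟩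
  · obtain ⟨y, hy, h⟩ := hp.exists_mem_Ico₀ one_pos x
    rw [h]
    exact hC y ⟨hy.1, hy.2.le⟩
  · refine Set.countable_iUnion fun n => Set.Countable.image ?_ _
    exact (S.countable_toSet).union (Set.countable_singleton 0)
  · simp only [Set.mem_iUnion, not_exists] at hx
    have h1 : Int.fract x ∉ (S : Set ℝ) ∪ {0} := fun h =>
      hx ⌊x⌋ ⟨Int.fract x, h, Int.fract_add_floor x⟩
    simp only [Set.mem_union, not_or, Set.mem_singleton_iff] at h1
    have h2 : ContinuousAt f (Int.fract x) := hS _ ⟨lt_of_le_of_ne (Int.fract_nonneg x)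
      (Ne.symm h1.2), Int.fract_lt_one x⟩ h1.1
    have h3 : f = fun y => f (y - ⌊x⌋) := by
      funext y
      have := hp.sub_int_mul_eq (x := y) ⌊x⌋
      rw [mul_one] at this
      exact this.symm
    rw [h3]
    exact ContinuousAt.comp (f := fun y : ℝ => y - ⌊x⌋) (g := f) h2 (by fun_prop)

namespace IsPeriodicStructure

variable {ε μ : ℝ → ℝ}

theorem coef_ε (h : IsPeriodicStructure ε μ) : Coef ε := coef_of_periodic h.ε_periodic h.ε_piecewise

theorem coef_μ (h : IsPeriodicStructure ε μ) : Coef μ := coef_of_periodic h.μ_periodic h.μ_piecewise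

end IsPeriodicStructure

theorem even_of_symm {f : ℝ → ℝ} (hp : Function.Periodic f 1) (hs : ∀ x, f x = f (1 - x)) (x : ℝ) :
    f (-x) = f x := by
  rw [hs x, ← hp (-x)]
  congr 1; ring

theorem integral_mul_pos {w g : ℝ → ℝ} (hw : Coef w) (hg : Continuous g) {a b : ℝ}
    (hpos : ∀ x ∈ Set.Ioo a b, 0 < w x) (hg0 : ∀ x, 0 ≤ g x) {x₀ : ℝ} (hx₀ : x₀ ∈ Set.Ioo a b)
    (hgx : 0 < g x₀) : 0 < ∫ t in a..b, w t * g t := by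
  have hab : a < b := hx₀.1.trans hx₀.2
  rw [intervalIntegral.integral_pos_iff_support_of_nonneg_ae' ?_ (hw.intervalIntegrable_mul hg a b)]
  · refine ⟨hab, ?_⟩
    have ho : IsOpen (Set.Ioo a b ∩ {x | 0 < g x}) :=
      isOpen_Ioo.inter (isOpen_lt continuous_const hg)
    refine (ho.measure_pos volume ⟨x₀, hx₀, hgx⟩).trans_le (measure_mono ?_)
    rintro x ⟨hx, hgx⟩
    exact ⟨(mul_pos (hpos x hx) hgx).ne', hx.1, hx.2.le⟩
  · rw [Set.uIoc_of_le hab.le, EventuallyLE, ← restrict_Ioo_eq_restrict_Ioc,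
      ae_restrict_iff' measurableSet_Ioo]
    exact ae_of_all _ fun x hx => mul_nonneg (hpos x hx).le (hg0 x)

/-- The energy identity. -/
theorem Sol.integral_energy {m e u p : ℝ → ℝ} (h : Sol m e u p) (hm : Coef m) (he : Coef e)
    (x y : ℝ) : u y * p y - u x * p x =
      (∫ t in x..y, m t * p t ^ 2) - ∫ t in x..y, e t * u t ^ 2 := by
  obtain ⟨S1, hS1, h1⟩ := hm.cont
  obtain ⟨S2, hS2, h2⟩ := he.cont
  have i1 := hm.intervalIntegrable_mul (h.continuous_p.pow 2) x y
  have i2 := he.intervalIntegrable_mul (h.continuous_u.pow 2) x y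
  refine Eq.trans ?_ (intervalIntegral.integral_sub i1 i2)
  symm
  refine integral_eq_of_hasDerivAt_off_countable (fun t => u t * p t) _
    (hS1.union hS2) ?_ ?_ (i1.sub i2)
  · exact (h.continuous_u.mul h.continuous_p).continuousOn
  · rintro t ⟨ht, hs⟩
    simp only [Set.mem_union, not_or] at hs
    refine ((h.hasDerivAt_u hm (h1 t hs.1)).mul (h.hasDerivAt_p he (h2 t hs.2))).congr_deriv ?_
    simp only [smul_eq_mul]
    ring

/-- Half of the trace of the monodromy matrix, which is `!![hillA, hillB; hillC, hillA]`. -/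
noncomputable def hillA (ε μ : ℝ → ℝ) (E : ℝ) : ℝ := solU ε μ 1 0 E 1

noncomputable def hillB (ε μ : ℝ → ℝ) (E : ℝ) : ℝ := solU ε μ 0 1 E 1

noncomputable def hillC (ε μ : ℝ → ℝ) (E : ℝ) : ℝ := solP ε μ 1 0 E 1

section Hill

variable {ε μ : ℝ → ℝ} (h : IsPeriodicStructure ε μ) (hs : IsInversionSymmetric ε μ)
include h

/-- Otherwise the solution vanishes on `[0, x]`; then its flux is constant, and `μ > 0` forces this
constant to be zero, against the initial data. -/
theorem solJ_pos {a b : ℝ} (hab : a ≠ 0 ∨ b ≠ 0) (E : ℝ) {x : ℝ} (hx : 0 < x) :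
    0 < solJ ε μ a b a b E E x := by
  have hS := sol_solU h.coef_ε h.coef_μ a b E
  by_cases hz : ∃ t ∈ Set.Ioo 0 x, solU ε μ a b E t ≠ 0
  · obtain ⟨t, ht, hne⟩ := hz
    exact integral_mul_pos h.coef_ε (hS.continuous_u.mul hS.continuous_u)
      (fun x _ => h.ε_pos x) (fun x => mul_self_nonneg _) ht (mul_self_pos.2 hne)
  · exfalso
    push Not at hz
    have hcl : Set.EqOn (solU ε μ a b E) (fun _ => 0) (Set.Icc 0 x) := by
      have := Set.EqOn.closure (f := solU ε μ a b E) (g := fun _ => 0) (s := Set.Ioo 0 x) hz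
        hS.continuous_u continuous_const
      rwa [closure_Ioo hx.ne] at this
    have ha : a = 0 := by
      rw [← solU_zero h.coef_ε h.coef_μ a b E]; exact hcl ⟨le_rfl, hx.le⟩
    have hp : ∀ t ∈ Set.Icc 0 x, solP ε μ a b E t = b := by
      intro t ht
      have h1 := hS.eq_p 0 t
      rw [solP_zero h.coef_ε h.coef_μ] at h1
      have h2 : ∫ r in (0 : ℝ)..t, (E * ε r) • solU ε μ a b E r = 0 := by
        rw [intervalIntegral.integral_congr (g := fun _ => (0 : ℝ))]
        · simp
        · intro r hr
          rw [Set.uIcc_of_le ht.1] at hr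
          simp [hcl ⟨hr.1, hr.2.trans ht.2⟩]
      rw [h2] at h1
      linarith
    have h3 := hS.eq_u 0 x
    rw [hcl ⟨le_rfl, hx.le⟩, hcl ⟨hx.le, le_rfl⟩] at h3
    have h4 : ∫ r in (0 : ℝ)..x, μ r • solP ε μ a b E r = (∫ r in (0 : ℝ)..x, μ r * 1) * b := by
      rw [← intervalIntegral.integral_mul_const]
      refine intervalIntegral.integral_congr fun r hr => ?_
      rw [Set.uIcc_of_le hx.le] at hr
      simp [hp r hr]
    have h5 := integral_mul_pos h.coef_μ (g := fun _ => 1) continuous_const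
      (fun x _ => h.μ_pos x) (fun _ => zero_le_one) (x₀ := x / 2) (a := 0) (b := x)
      ⟨by linarith, by linarith⟩ one_pos
    rw [h4, sub_zero] at h3
    have hb : b = 0 := (mul_eq_zero.1 h3.symm).resolve_left h5.ne'
    exact hab.elim (fun h => h ha) (fun h => h hb)

include hs

/-- The reflection `x ↦ 1 - x` maps solutions to solutions. Expanding the reflected fundamental
solutions gives A² - BC = 1 and D² - BC = 1 for the diagonal entries A and D; with AD - BC = 1 this
yields (D - A)² = 0. -/
theorem hill_p₂ (E : ℝ) : solP ε μ 0 1 E 1 = hillA ε μ E := by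
  have hε := h.coef_ε
  have hμ := h.coef_μ
  have refl : ∀ a b, Sol μ (fun t => E * ε t) (fun x => solU ε μ a b E (1 - x))
      (fun x => -solP ε μ a b E (1 - x)) := by
    intro a b
    have := ((sol_solU hε hμ a b E).comp_neg).comp_add (-1)
    have e1 : ∀ x : ℝ, -(x + -1) = 1 - x := fun x => by ring
    simp only [e1, ← hs.ε_symm, ← hs.μ_symm] at this
    exact this
  have r1 := ((refl 1 0).repr_self hε hμ 1).1
  have r2 := ((refl 0 1).repr_self hε hμ 1).2
  have d := sol_det hε hμ E 1
  simp only [sub_self, sub_zero, solU_zero hε hμ, solP_zero hε hμ, smul_eq_mul] at r1 r2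
  have : (solP ε μ 0 1 E 1 - hillA ε μ E) ^ 2 = 0 := by
    rw [hillA]
    linear_combination -r1 + r2 - 2 * d
  have := pow_eq_zero_iff (two_ne_zero) |>.1 this
  linarith

theorem hill_det (E : ℝ) : hillA ε μ E ^ 2 - hillB ε μ E * hillC ε μ E = 1 := by
  have d := sol_det h.coef_ε h.coef_μ E 1
  rw [hill_p₂ h hs] at d
  rw [hillB, hillC]
  change hillA ε μ E * hillA ε μ E - _ = 1 at d
  linarith

theorem sol_parity (E x : ℝ) : solU ε μ 1 0 E (-x) = solU ε μ 1 0 E x ∧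
    solU ε μ 0 1 E (-x) = -solU ε μ 0 1 E x := by
  have hε := h.coef_ε
  have hμ := h.coef_μ
  have refl : ∀ a b, Sol μ (fun t => E * ε t) (fun x => solU ε μ a b E (-x))
      (fun x => -solP ε μ a b E (-x)) := by
    intro a b
    have := ((sol_solU hε hμ a b E).comp_neg)
    simp only [even_of_symm h.ε_periodic hs.ε_symm, even_of_symm h.μ_periodic hs.μ_symm] at this
    exact this
  have r1 := ((refl 1 0).repr_self hε hμ x).1
  have r2 := ((refl 0 1).repr_self hε hμ x).1
  simp only [neg_zero, solU_zero hε hμ, solP_zero hε hμ, smul_eq_mul] at r1 r2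
  constructor
  · rw [r1]; ring
  · rw [r2]; ring

omit hs in
theorem hill_zero : hillA ε μ 0 = 1 ∧ hillC ε μ 0 = 0 := by
  have hε := h.coef_ε
  have hμ := h.coef_μ
  have hS : Sol μ (fun t => 0 * ε t) (fun _ => (1 : ℝ)) (fun _ => (0 : ℝ)) :=
    ⟨continuous_const, continuous_const, fun x y => by simp, fun x y => by simp⟩
  have := hS.repr_self hε hμ 1
  simp only [smul_eq_mul, mul_one, mul_zero, add_zero] at this
  exact ⟨this.1.symm, this.2.symm⟩

/-- The energy identity on `[0, 1]`: for both fundamental solutions the boundary term at `0`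
vanishes, and for `E ≤ 0` neither integral contributes negatively. -/
theorem hill_mul_pos {E : ℝ} (hE : E ≤ 0) : 0 < hillB ε μ E * hillA ε μ E ∧
    0 ≤ hillA ε μ E * hillC ε μ E ∧ (E < 0 → 0 < hillA ε μ E * hillC ε μ E) := by
  have hε := h.coef_ε
  have hμ := h.coef_μ
  have key : ∀ a b, a * b = 0 → solU ε μ a b E 1 * solP ε μ a b E 1 =
      (∫ t in (0 : ℝ)..1, μ t * solP ε μ a b E t ^ 2) - E * solJ ε μ a b a b E E 1 := by
    intro a b hab
    have := (sol_solU hε hμ a b E).integral_energy hμ (hε.const_mul E) 0 1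
    rw [solU_zero hε hμ, solP_zero hε hμ, hab, sub_zero] at this
    rw [this, solJ, ← intervalIntegral.integral_const_mul]
    congr 2; funext t; ring
  have k1 := key 1 0 (by simp)
  have k2 := key 0 1 (by simp)
  rw [hill_p₂ h hs] at k2
  have j1 := solJ_pos h (a := 1) (b := 0) (by simp) E one_pos
  have j2 := solJ_pos h (a := 0) (b := 1) (by simp) E one_pos
  have n1 : 0 ≤ ∫ t in (0 : ℝ)..1, μ t * solP ε μ 1 0 E t ^ 2 :=
    intervalIntegral.integral_nonneg zero_le_one fun t _ =>
      mul_nonneg (h.μ_pos t).le (sq_nonneg _)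
  have n2 : 0 < ∫ t in (0 : ℝ)..1, μ t * solP ε μ 0 1 E t ^ 2 := by
    have hc := (sol_solU hε hμ 0 1 E).continuous_p
    have h1 : ∀ᶠ t in 𝓝[>] (0 : ℝ), 0 < solP ε μ 0 1 E t := by
      refine (hc.tendsto 0).eventually_const_lt ?_ |>.filter_mono nhdsWithin_le_nhds
      rw [solP_zero hε hμ]; exact one_pos
    obtain ⟨t, ht, hI⟩ := (h1.and (Ioo_mem_nhdsGT one_pos)).exists
    exact integral_mul_pos hμ (hc.pow 2) (fun x _ => h.μ_pos x) (fun x => sq_nonneg _) hI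
      (pow_pos ht 2)
  refine ⟨?_, ?_, fun hE' => ?_⟩
  · change 0 < solU ε μ 0 1 E 1 * _
    rw [k2]; nlinarith
  · change 0 ≤ solU ε μ 1 0 E 1 * solP ε μ 1 0 E 1
    rw [k1]; nlinarith
  · change 0 < solU ε μ 1 0 E 1 * solP ε μ 1 0 E 1
    rw [k1]; nlinarith

omit hs in
theorem continuous_hillA : Continuous (hillA ε μ) := continuous_solU_energy h.coef_ε h.coef_μ _ _ _

omit hs in
theorem continuous_hillB : Continuous (hillB ε μ) := continuous_solU_energy h.coef_ε h.coef_μ _ _ _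

omit hs in
theorem continuous_hillC : Continuous (hillC ε μ) := continuous_solP_energy h.coef_ε h.coef_μ _ _ _

/-- The value at `0` is `1`, and a zero at some `E ≤ 0` would make the product with `hillB` vanish.
-/
theorem hillA_pos {E : ℝ} (hE : E ≤ 0) : 0 < hillA ε μ E := by
  by_contra! hc
  have := intermediate_value_Icc hE (continuous_hillA h).continuousOn
  obtain ⟨x, hx, h0⟩ := this ⟨hc, by rw [(hill_zero h).1]; exact zero_le_one⟩
  have := (hill_mul_pos h hs hx.2).1
  rw [h0, mul_zero] at this
  exact lt_irrefl _ this

theorem hillB_pos {E : ℝ} (hE : E ≤ 0) : 0 < hillB ε μ E :=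
  (mul_pos_iff_of_pos_right (hillA_pos h hs hE)).1 (hill_mul_pos h hs hE).1

/-- All entries are positive, so A² = 1 + BC > 1. There is no spectrum below zero. -/
theorem one_lt_hillA {E : ℝ} (hE : E < 0) : 1 < hillA ε μ E := by
  have ha := hillA_pos h hs hE.le
  have hb := hillB_pos h hs hE.le
  have hc : 0 < hillC ε μ E :=
    (mul_pos_iff_of_pos_left ha).1 ((hill_mul_pos h hs hE.le).2.2 hE)
  have := hill_det h hs E
  nlinarith [mul_pos hb hc]

/-- The derivative of `hillA`. -/
theorem hasDerivAt_hillA (E : ℝ) : HasDerivAt (hillA ε μ)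
    ((hillC ε μ E * solJ ε μ 0 1 0 1 E E 1 - hillB ε μ E * solJ ε μ 1 0 1 0 E E 1) / 2) E := by
  have d1 := (hasDerivAt_sol_energy h.coef_ε h.coef_μ 1 0 E 1).1
  have d2 := (hasDerivAt_sol_energy h.coef_ε h.coef_μ 0 1 E 1).2
  -- Both diagonal entries equal `hillA`, so its derivative comes in two forms; their mean is free
  -- of the mixed integral of the two fundamental solutions.
  have e : (fun E => solP ε μ 0 1 E 1) = hillA ε μ := funext fun E => hill_p₂ h hs E
  rw [e, hill_p₂ h hs] at d2
  change HasDerivAt (hillA ε μ) (hillA ε μ E * _ - hillB ε μ E * _) E at d1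
  change HasDerivAt (hillA ε μ) (hillC ε μ E * _ - _) E at d2
  have hsym : solJ ε μ 0 1 1 0 E E 1 = solJ ε μ 1 0 0 1 E E 1 := by
    simp only [solJ, mul_comm (solU ε μ 0 1 E _)]
  have := d1.unique d2
  rw [hsym] at this d1
  convert d1 using 1
  linarith

theorem hill_lagrange_B (E E' : ℝ) : hillA ε μ E * hillB ε μ E' - hillB ε μ E * hillA ε μ E' =
    (E' - E) * solJ ε μ 0 1 0 1 E E' 1 := by
  have := sol_lagrange h.coef_ε h.coef_μ 0 1 0 1 E E' 1
  rw [hill_p₂ h hs, hill_p₂ h hs] at this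
  rw [hillB, hillB]
  linarith

omit hs in
theorem hill_lagrange_C (E E' : ℝ) : hillA ε μ E * hillC ε μ E' - hillC ε μ E * hillA ε μ E' =
    -(E' - E) * solJ ε μ 1 0 1 0 E E' 1 := by
  have := sol_lagrange h.coef_ε h.coef_μ 1 0 1 0 E E' 1
  rw [hillC, hillC, hillA, hillA]
  linarith

end Hill

end Photonic


namespace Photonic

/-! ### The Prüfer angle -/

/-- The increment of the Prüfer angle of a solution. -/
noncomputable def pruferAngle (m e u p : ℝ → ℝ) (x₀ x : ℝ) : ℝ :=
  ∫ t in x₀..x, (m t * (p t ^ 2 / (u t ^ 2 + p t ^ 2)) + e t * (u t ^ 2 / (u t ^ 2 + p t ^ 2)))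

theorem const_of_hasDerivAt_off_countable {f : ℝ → ℝ} (hf : Continuous f) {S : Set ℝ}
    (hS : S.Countable) (hd : ∀ x ∉ S, HasDerivAt f 0 x) (x y : ℝ) : f x = f y := by
  have := integral_eq_of_hasDerivAt_off_countable f (fun _ => (0 : ℝ)) (a := y) (b := x) hS
    hf.continuousOn (fun t ht => hd t ht.2) intervalIntegrable_const
  simp only [intervalIntegral.integral_zero] at this
  linarith

namespace Sol

variable {m e u p : ℝ → ℝ}

theorem intervalIntegrable_prufer (h : Sol m e u p) (hm : Coef m) (he : Coef e)
    (hne : ∀ x, 0 < u x ^ 2 + p x ^ 2) (x y : ℝ) :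
    IntervalIntegrable (fun t => m t * (p t ^ 2 / (u t ^ 2 + p t ^ 2)) +
      e t * (u t ^ 2 / (u t ^ 2 + p t ^ 2))) volume x y := by
  have c1 := h.continuous_u
  have c2 := h.continuous_p
  exact (hm.intervalIntegrable_mul ((c2.pow 2).div ((c1.pow 2).add (c2.pow 2))
      (fun x => (hne x).ne')) x y).add
    (he.intervalIntegrable_mul ((c1.pow 2).div ((c1.pow 2).add (c2.pow 2))
      (fun x => (hne x).ne')) x y)

theorem continuous_prufer (h : Sol m e u p) (hm : Coef m) (he : Coef e)
    (hne : ∀ x, 0 < u x ^ 2 + p x ^ 2) (x₀ : ℝ) : Continuous (pruferAngle m e u p x₀) :=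
  intervalIntegral.continuous_primitive (h.intervalIntegrable_prufer hm he hne) x₀

/-- Rotating `(u, p)` back by the angle and dividing by the growth factor `exp ρ` leaves a vector
with zero derivative off a countable set. As the angle is defined by an integral, no branch of the
arctangent has to be followed. -/
theorem prufer_aux (h : Sol m e u p) (hm : Coef m) (he : Coef e)
    (hne : ∀ x, 0 < u x ^ 2 + p x ^ 2) (x₀ x : ℝ) : ∃ r : ℝ, 0 < r ∧
      u x * Real.cos (pruferAngle m e u p x₀ x) - p x * Real.sin (pruferAngle m e u p x₀ x) =
        r * u x₀ ∧
      u x * Real.sin (pruferAngle m e u p x₀ x) + p x * Real.cos (pruferAngle m e u p x₀ x) =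
        r * p x₀ := by
  obtain ⟨S1, hS1, h1⟩ := hm.cont
  obtain ⟨S2, hS2, h2⟩ := he.cont
  have c1 := h.continuous_u
  have c2 := h.continuous_p
  set θ := pruferAngle m e u p x₀ with hθ
  -- The logarithmic derivative of the radius of `(u, p)`.
  let w : ℝ → ℝ := fun t => m t * (u t * p t / (u t ^ 2 + p t ^ 2)) -
    e t * (u t * p t / (u t ^ 2 + p t ^ 2))
  have cw : Continuous fun t => u t * p t / (u t ^ 2 + p t ^ 2) :=
    (c1.mul c2).div ((c1.pow 2).add (c2.pow 2)) (fun x => (hne x).ne')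
  have iw : ∀ x y, IntervalIntegrable w volume x y := fun x y =>
    (hm.intervalIntegrable_mul cw x y).sub (he.intervalIntegrable_mul cw x y)
  have cp : Continuous fun t => p t ^ 2 / (u t ^ 2 + p t ^ 2) :=
    (c2.pow 2).div ((c1.pow 2).add (c2.pow 2)) (fun x => (hne x).ne')
  have cu : Continuous fun t => u t ^ 2 / (u t ^ 2 + p t ^ 2) :=
    (c1.pow 2).div ((c1.pow 2).add (c2.pow 2)) (fun x => (hne x).ne')
  set ρ : ℝ → ℝ := fun x => ∫ t in x₀..x, w t with hρ
  have cρ : Continuous ρ := intervalIntegral.continuous_primitive iw x₀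
  have cθ : Continuous θ := h.continuous_prufer hm he hne x₀
  have dρ : ∀ x ∉ S1 ∪ S2, HasDerivAt ρ (w x) x := fun x hx => by
    simp only [Set.mem_union, not_or] at hx
    refine intervalIntegral.integral_hasDerivAt_right (iw _ _)
      (AEStronglyMeasurable.stronglyMeasurableAtFilter ?_) ?_
    · exact (hm.aestronglyMeasurable.mul cw.aestronglyMeasurable).sub
        (he.aestronglyMeasurable.mul cw.aestronglyMeasurable)
    · exact ((h1 x hx.1).mul cw.continuousAt).sub ((h2 x hx.2).mul cw.continuousAt)
  have dθ : ∀ x ∉ S1 ∪ S2, HasDerivAt θ (m x * (p x ^ 2 / (u x ^ 2 + p x ^ 2)) +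
      e x * (u x ^ 2 / (u x ^ 2 + p x ^ 2))) x := fun x hx => by
    simp only [Set.mem_union, not_or] at hx
    refine intervalIntegral.integral_hasDerivAt_right (h.intervalIntegrable_prufer hm he hne _ _)
      (AEStronglyMeasurable.stronglyMeasurableAtFilter ?_) ?_
    · exact (hm.aestronglyMeasurable.mul cp.aestronglyMeasurable).add
        (he.aestronglyMeasurable.mul cu.aestronglyMeasurable)
    · exact ((h1 x hx.1).mul cp.continuousAt).add ((h2 x hx.2).mul cu.continuousAt)
  have du : ∀ x ∉ S1 ∪ S2, HasDerivAt u (m x * p x) x := fun x hx => by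
    simp only [Set.mem_union, not_or] at hx
    exact h.hasDerivAt_u hm (h1 x hx.1)
  have dp : ∀ x ∉ S1 ∪ S2, HasDerivAt p (-(e x * u x)) x := fun x hx => by
    simp only [Set.mem_union, not_or] at hx
    exact h.hasDerivAt_p he (h2 x hx.2)
  have k1 := const_of_hasDerivAt_off_countable
    (f := fun x => Real.exp (-ρ x) * (u x * Real.cos (θ x) - p x * Real.sin (θ x)))
    (by fun_prop) (hS1.union hS2) (fun x hx => by
      have hn := (hne x).ne'
      refine ((dρ x hx).neg.exp.mul (((du x hx).mul (dθ x hx).cos).sub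
        ((dp x hx).mul (dθ x hx).sin))).congr_deriv ?_
      simp only [Pi.mul_apply, Pi.sub_apply, w]
      field_simp
      ring) x x₀
  have k2 := const_of_hasDerivAt_off_countable
    (f := fun x => Real.exp (-ρ x) * (u x * Real.sin (θ x) + p x * Real.cos (θ x)))
    (by fun_prop) (hS1.union hS2) (fun x hx => by
      have hn := (hne x).ne'
      refine ((dρ x hx).neg.exp.mul (((du x hx).mul (dθ x hx).sin).add
        ((dp x hx).mul (dθ x hx).cos))).congr_deriv ?_
      simp only [Pi.mul_apply, Pi.add_apply, w]
      field_simp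
      ring) x x₀
  have ρ0 : ρ x₀ = 0 := by simp [hρ]
  have θ0 : θ x₀ = 0 := by simp [hθ, pruferAngle]
  simp only [ρ0, θ0, neg_zero, Real.exp_zero, Real.cos_zero, Real.sin_zero, mul_one, mul_zero,
    one_mul, sub_zero, zero_add] at k1 k2
  refine ⟨Real.exp (ρ x), Real.exp_pos _, ?_, ?_⟩
  · rw [← k1, ← mul_assoc, ← Real.exp_add]; simp
  · rw [← k2, ← mul_assoc, ← Real.exp_add]; simp

/-- Polar representation of a solution. -/
theorem prufer (h : Sol m e u p) (hm : Coef m) (he : Coef e)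
    (hne : ∀ x, 0 < u x ^ 2 + p x ^ 2) {x₀ α r₀ : ℝ} (hr₀ : 0 < r₀) (hu : u x₀ = r₀ * Real.sin α)
    (hp : p x₀ = r₀ * Real.cos α) (x : ℝ) : ∃ r : ℝ, 0 < r ∧
      u x = r * Real.sin (α + pruferAngle m e u p x₀ x) ∧
      p x = r * Real.cos (α + pruferAngle m e u p x₀ x) := by
  obtain ⟨r, hr, e1, e2⟩ := h.prufer_aux hm he hne x₀ x
  have hsc := Real.sin_sq_add_cos_sq (pruferAngle m e u p x₀ x)
  rw [hu] at e1
  rw [hp] at e2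
  refine ⟨r * r₀, mul_pos hr hr₀, ?_, ?_⟩
  · rw [Real.sin_add]
    linear_combination Real.cos (pruferAngle m e u p x₀ x) * e1 +
      Real.sin (pruferAngle m e u p x₀ x) * e2 - u x * hsc
  · rw [Real.cos_add]
    linear_combination -Real.sin (pruferAngle m e u p x₀ x) * e1 +
      Real.cos (pruferAngle m e u p x₀ x) * e2 - p x * hsc

theorem prufer_sub (h : Sol m e u p) (hm : Coef m) (he : Coef e)
    (hne : ∀ x, 0 < u x ^ 2 + p x ^ 2) (x₀ x y : ℝ) :
    pruferAngle m e u p x₀ y - pruferAngle m e u p x₀ x = pruferAngle m e u p x y :=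
  intervalIntegral.integral_interval_sub_left (h.intervalIntegrable_prufer hm he hne _ _)
    (h.intervalIntegrable_prufer hm he hne _ _)

theorem prufer_pos (h : Sol m e u p) (hm : Coef m) (he : Coef e)
    (hne : ∀ x, 0 < u x ^ 2 + p x ^ 2) {x y : ℝ} (hxy : x < y)
    (hmp : ∀ t ∈ Set.Ioo x y, 0 < m t) (hep : ∀ t ∈ Set.Ioo x y, 0 < e t) :
    0 < pruferAngle m e u p x y := by
  refine intervalIntegral.intervalIntegral_pos_of_pos_on
    (h.intervalIntegrable_prufer hm he hne x y) (fun t ht => ?_) hxy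
  have h1 := hmp t ht
  have h2 := hep t ht
  have h3 := hne t
  rcases eq_or_ne (u t) 0 with h0 | h0
  · rw [h0] at h3 ⊢
    have : p t ^ 2 ≠ 0 := by intro hc; rw [hc] at h3; simp at h3
    have h4 : (0 : ℝ) ^ 2 + p t ^ 2 = p t ^ 2 := by ring
    rw [h4, div_self this]
    simpa using h1
  · have : 0 < u t ^ 2 := by positivity
    positivity

/-- A solution that stays nonnegative cannot live on a long interval. -/
theorem oscillation (h : Sol m e u p) (hm : Coef m) (he : Coef e) {c k x₀ g : ℝ} (hg : 0 < g)
    (hc : 0 < c) (hk : 0 < k)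
    (hmc : ∀ t ∈ Set.Icc x₀ (x₀ + 2 * g), c ≤ m t) (hek : ∀ t ∈ Set.Icc x₀ (x₀ + 2 * g), k ≤ e t)
    (hu : ∀ t ∈ Set.Icc x₀ (x₀ + 2 * g), 0 ≤ u t) (hug : 0 < u (x₀ + g))
    (hp : 0 ≤ p (x₀ + 2 * g)) : k * c * g ^ 2 ≤ 1 := by
  -- Since `u ≥ 0`, the flux decreases; hence it is nonnegative up to the right end and `u`
  -- increases. Integrating each equation over one half of the interval bounds `u` and `p` at the
  -- midpoint by each other.
  have pa : ∀ x ∈ Set.Icc x₀ (x₀ + 2 * g), ∀ y ∈ Set.Icc x₀ (x₀ + 2 * g), x ≤ y → p y ≤ p x := by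
    intro x hx y hy hxy
    have h1 := h.eq_p x y
    have : 0 ≤ ∫ t in x..y, e t • u t := intervalIntegral.integral_nonneg hxy fun t ht =>
      mul_nonneg (hk.le.trans (hek t ⟨hx.1.trans ht.1, ht.2.trans hy.2⟩))
        (hu t ⟨hx.1.trans ht.1, ht.2.trans hy.2⟩)
    linarith
  have end_mem : x₀ + 2 * g ∈ Set.Icc x₀ (x₀ + 2 * g) := ⟨by linarith, le_rfl⟩
  have mid_mem : x₀ + g ∈ Set.Icc x₀ (x₀ + 2 * g) := ⟨by linarith, by linarith⟩
  have st_mem : x₀ ∈ Set.Icc x₀ (x₀ + 2 * g) := ⟨le_rfl, by linarith⟩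
  have p0 : ∀ x ∈ Set.Icc x₀ (x₀ + 2 * g), 0 ≤ p x := fun x hx =>
    hp.trans (pa x hx _ end_mem hx.2)
  have ua : ∀ x ∈ Set.Icc x₀ (x₀ + 2 * g), ∀ y ∈ Set.Icc x₀ (x₀ + 2 * g), x ≤ y → u x ≤ u y := by
    intro x hx y hy hxy
    have h1 := h.eq_u x y
    have : 0 ≤ ∫ t in x..y, m t • p t := intervalIntegral.integral_nonneg hxy fun t ht =>
      mul_nonneg (hc.le.trans (hmc t ⟨hx.1.trans ht.1, ht.2.trans hy.2⟩))
        (p0 t ⟨hx.1.trans ht.1, ht.2.trans hy.2⟩)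
    linarith
  have i1 : k * u (x₀ + g) * g ≤ p (x₀ + g) := by
    have h1 := h.eq_p (x₀ + g) (x₀ + 2 * g)
    have h2 : ∫ t in (x₀ + g)..(x₀ + 2 * g), k * u (x₀ + g) ≤
        ∫ t in (x₀ + g)..(x₀ + 2 * g), e t • u t := by
      refine intervalIntegral.integral_mono_on (by linarith) intervalIntegrable_const
        (he.intervalIntegrable_smul h.continuous_u _ _) fun t ht => ?_
      have htm : t ∈ Set.Icc x₀ (x₀ + 2 * g) := ⟨by linarith [ht.1], ht.2⟩
      exact mul_le_mul (hek t htm) (ua _ mid_mem t htm ht.1) hug.le (hk.le.trans (hek t htm))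
    rw [intervalIntegral.integral_const, smul_eq_mul] at h2
    linarith
  have i2 : c * p (x₀ + g) * g ≤ u (x₀ + g) := by
    have h1 := h.eq_u x₀ (x₀ + g)
    have h2 : ∫ t in x₀..(x₀ + g), c * p (x₀ + g) ≤ ∫ t in x₀..(x₀ + g), m t • p t := by
      refine intervalIntegral.integral_mono_on (by linarith) intervalIntegrable_const
        (hm.intervalIntegrable_smul h.continuous_p _ _) fun t ht => ?_
      have htm : t ∈ Set.Icc x₀ (x₀ + 2 * g) := ⟨ht.1, by linarith [ht.2]⟩
      exact mul_le_mul (hmc t htm) (pa t htm _ mid_mem ht.2) (p0 _ mid_mem)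
        (hc.le.trans (hmc t htm))
    rw [intervalIntegral.integral_const, smul_eq_mul] at h2
    have := hu x₀ st_mem
    linarith
  have i3 : c * (k * u (x₀ + g) * g) * g ≤ u (x₀ + g) :=
    le_trans (by gcongr) i2
  have i4 : (k * c * g ^ 2) * u (x₀ + g) ≤ 1 * u (x₀ + g) := by linarith
  exact le_of_mul_le_mul_right i4 hug

/-- Without a zero the solution may be taken positive. If its flux at the midpoint is nonnegative,
`oscillation` excludes the left half; otherwise it excludes the reflected right half. -/
theorem exists_zero (h : Sol m e u p) (hm : Coef m) (he : Coef e) {c k x₀ g : ℝ} (hg : 0 < g)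
    (hc : 0 < c) (hk : 0 < k)
    (hmc : ∀ t ∈ Set.Icc x₀ (x₀ + 4 * g), c ≤ m t) (hek : ∀ t ∈ Set.Icc x₀ (x₀ + 4 * g), k ≤ e t)
    (hlarge : 1 < k * c * g ^ 2) : ∃ z ∈ Set.Ioo x₀ (x₀ + 4 * g), u z = 0 := by
  have main : ∀ v q : ℝ → ℝ, Sol m e v q → (∀ x ∈ Set.Ioo x₀ (x₀ + 4 * g), 0 < v x) → False := by
    intro v q hv hpos
    have hnn : ∀ x ∈ Set.Icc x₀ (x₀ + 4 * g), 0 ≤ v x := by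
      intro x hx
      have hcl : Set.Icc x₀ (x₀ + 4 * g) ⊆ {x | 0 ≤ v x} := by
        rw [← closure_Ioo (by linarith : x₀ ≠ x₀ + 4 * g)]
        exact closure_minimal (fun y hy => (hpos y hy).le)
          (isClosed_le continuous_const hv.continuous_u)
      exact hcl hx
    rcases le_total 0 (q (x₀ + 2 * g)) with hq | hq
    · refine absurd (hv.oscillation hm he hg hc hk ?_ ?_ ?_ ?_ hq) (not_le.2 hlarge)
      · exact fun t ht => hmc t ⟨ht.1, by linarith [ht.2]⟩
      · exact fun t ht => hek t ⟨ht.1, by linarith [ht.2]⟩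
      · exact fun t ht => hnn t ⟨ht.1, by linarith [ht.2]⟩
      · exact hpos _ ⟨by linarith, by linarith⟩
    · refine absurd (hv.comp_neg.oscillation (x₀ := -(x₀ + 4 * g)) hm.comp_neg he.comp_neg hg hc hk
        ?_ ?_ ?_ ?_ ?_) (not_le.2 hlarge)
      · exact fun t ht => hmc _ ⟨by linarith [ht.2], by linarith [ht.1]⟩
      · exact fun t ht => hek _ ⟨by linarith [ht.2], by linarith [ht.1]⟩
      · exact fun t ht => hnn _ ⟨by linarith [ht.2], by linarith [ht.1]⟩
      · exact hpos _ ⟨by linarith, by linarith⟩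
      · have : -(-(x₀ + 4 * g) + 2 * g) = x₀ + 2 * g := by ring
        rw [this]
        linarith
  by_contra! hne
  have hpre : IsPreconnected (Set.Ioo x₀ (x₀ + 4 * g)) := isPreconnected_Ioo
  have hmid : x₀ + g ∈ Set.Ioo x₀ (x₀ + 4 * g) := ⟨by linarith, by linarith⟩
  rcases lt_or_gt_of_ne (hne _ hmid) with hlt | hgt
  · refine main _ _ (h.const_mul hm he (-1)) fun x hx => ?_
    by_contra! hcon
    obtain ⟨z, hz, h0⟩ := hpre.intermediate_value hmid hx h.continuous_u.continuousOn
      ⟨hlt.le, by linarith⟩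
    exact hne z hz h0
  · refine main _ _ h fun x hx => ?_
    by_contra! hcon
    obtain ⟨z, hz, h0⟩ := hpre.intermediate_value hx hmid h.continuous_u.continuousOn
      ⟨hcon, hgt.le⟩
    exact hne z hz h0

end Sol

/-- If value and flux vanished at `x`, the constant Wronskians with the fundamental solutions would
vanish, and these are the initial data up to sign. -/
theorem sol_sq_pos {ε μ : ℝ → ℝ} (hε : Coef ε) (hμ : Coef μ) {a b : ℝ} (hab : a ≠ 0 ∨ b ≠ 0)
    (E x : ℝ) : 0 < solU ε μ a b E x ^ 2 + solP ε μ a b E x ^ 2 := by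
  by_contra! hc
  have hu : solU ε μ a b E x = 0 := by nlinarith [sq_nonneg (solP ε μ a b E x)]
  have hp : solP ε μ a b E x = 0 := by nlinarith [sq_nonneg (solU ε μ a b E x)]
  have l1 := sol_lagrange hε hμ 1 0 a b E E x
  have l2 := sol_lagrange hε hμ 0 1 a b E E x
  rw [hu, hp] at l1 l2
  rcases hab with h | h
  · exact h (by linarith)
  · exact h (by linarith)

/-! ### The angle over one period as a function of the energy -/

section HillAngle

variable {ε μ : ℝ → ℝ}

/-- The Prüfer angle at `1` of the solution with zero initial value. -/
noncomputable def hillTheta (ε μ : ℝ → ℝ) (E : ℝ) : ℝ :=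
  pruferAngle μ (fun t => E * ε t) (solU ε μ 0 1 E) (solP ε μ 0 1 E) 0 1

/-- Dominated convergence: both quotients in the integrand lie between 0 and 1. -/
theorem continuous_hillTheta (hε : Coef ε) (hμ : Coef μ) : Continuous (hillTheta ε μ) := by
  rw [continuous_iff_continuousAt]
  intro E₀
  obtain ⟨C1, h1⟩ := hμ.bdd
  obtain ⟨C2, h2⟩ := hε.bdd
  refine intervalIntegral.continuousAt_of_dominated_interval
    (bound := fun _ => C1 + (|E₀| + 1) * C2) ?_ ?_ intervalIntegrable_const ?_
  · refine Eventually.of_forall fun E => ?_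
    have := (sol_solU hε hμ 0 1 E).intervalIntegrable_prufer hμ (hε.const_mul E)
      (sol_sq_pos hε hμ (by simp) E) 0 1
    rw [intervalIntegrable_iff] at this
    exact this.aestronglyMeasurable
  · have : ∀ᶠ E' in 𝓝 E₀, |E'| < |E₀| + 1 :=
      continuous_abs.continuousAt.eventually_lt continuousAt_const (by simp)
    filter_upwards [this] with E hE
    refine ae_of_all _ fun t _ => ?_
    have hp := sol_sq_pos hε hμ (a := 0) (b := 1) (by simp) E t
    have i1 : |solP ε μ 0 1 E t ^ 2 / (solU ε μ 0 1 E t ^ 2 + solP ε μ 0 1 E t ^ 2)| ≤ 1 := by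
      rw [abs_of_nonneg (by positivity), div_le_one hp]
      linarith [sq_nonneg (solU ε μ 0 1 E t)]
    have i2 : |solU ε μ 0 1 E t ^ 2 / (solU ε μ 0 1 E t ^ 2 + solP ε μ 0 1 E t ^ 2)| ≤ 1 := by
      rw [abs_of_nonneg (by positivity), div_le_one hp]
      linarith [sq_nonneg (solP ε μ 0 1 E t)]
    have p1 := (abs_nonneg _).trans (h1 0)
    have p2 := (abs_nonneg _).trans (h2 0)
    refine (abs_add_le _ _).trans (add_le_add ?_ ?_)
    · rw [abs_mul]
      calc _ ≤ C1 * 1 := mul_le_mul (h1 t) i1 (abs_nonneg _) p1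
        _ = C1 := mul_one _
    · rw [abs_mul, abs_mul]
      calc _ ≤ ((|E₀| + 1) * C2) * 1 := mul_le_mul (mul_le_mul hE.le (h2 t) (abs_nonneg _)
            (by positivity)) i2 (abs_nonneg _) (by positivity)
        _ = _ := mul_one _
  · refine ae_of_all _ fun t _ => ?_
    have cu := (continuous_solU_energy hε hμ 0 1 t)
    have cp := (continuous_solP_energy hε hμ 0 1 t)
    have hp := (sol_sq_pos hε hμ (a := 0) (b := 1) (by simp) E₀ t).ne'
    have hd : ContinuousAt (fun E => solU ε μ 0 1 E t ^ 2 + solP ε μ 0 1 E t ^ 2) E₀ :=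
      ((cu.pow 2).add (cp.pow 2)).continuousAt
    exact (continuousAt_const.mul ((cp.pow 2).continuousAt.div hd hp)).add
      ((continuousAt_id.mul continuousAt_const).mul ((cu.pow 2).continuousAt.div hd hp))

theorem sol_polar (hε : Coef ε) (hμ : Coef μ) (E x : ℝ) : ∃ r : ℝ, 0 < r ∧
    solU ε μ 0 1 E x = r * Real.sin
      (pruferAngle μ (fun t => E * ε t) (solU ε μ 0 1 E) (solP ε μ 0 1 E) 0 x) ∧
    solP ε μ 0 1 E x = r * Real.cos
      (pruferAngle μ (fun t => E * ε t) (solU ε μ 0 1 E) (solP ε μ 0 1 E) 0 x) := by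
  have := (sol_solU hε hμ 0 1 E).prufer hμ (hε.const_mul E)
    (sol_sq_pos hε hμ (by simp) E) (x₀ := 0) (α := 0) one_pos
    (by simp [solU_zero hε hμ]) (by simp [solP_zero hε hμ]) x
  simpa using this

variable (h : IsPeriodicStructure ε μ)
include h

/-- By `hill_p₂` the end vector of ψ_{E,2} is (B, A), so B vanishes where the angle is a multiple of
π. -/
theorem hill_polar (hs : IsInversionSymmetric ε μ) (E : ℝ) : ∃ r : ℝ, 0 < r ∧
    hillB ε μ E = r * Real.sin (hillTheta ε μ E) ∧
    hillA ε μ E = r * Real.cos (hillTheta ε μ E) := by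
  have := sol_polar h.coef_ε h.coef_μ E 1
  rwa [hill_p₂ h hs] at this

/-- Lagrange's identity at the energies `E` and `E'` reads r r' sin(θ(E') - θ(E)) = (E' - E) J with
J > 0 for `E'` near `E`. So θ exceeds its value at each point just to the right of it, and
continuity propagates this along the line. -/
theorem strictMono_hillTheta (hs : IsInversionSymmetric ε μ) : StrictMono (hillTheta ε μ) := by
  have hc := continuous_hillTheta h.coef_ε h.coef_μ
  have loc : ∀ E, ∀ᶠ E' in 𝓝[>] E, hillTheta ε μ E < hillTheta ε μ E' := by
    intro E
    have e1 : ∀ᶠ E' in 𝓝 E, 0 < solJ ε μ 0 1 0 1 E E' 1 :=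
      (continuous_solJ_right h.coef_ε h.coef_μ 0 1 0 1 E 1).eventually_const_lt
        (solJ_pos h (by simp) E one_pos)
    have e2 : ∀ᶠ E' in 𝓝 E, |hillTheta ε μ E' - hillTheta ε μ E| < π := by
      have : Continuous fun E' => |hillTheta ε μ E' - hillTheta ε μ E| := by fun_prop
      exact this.continuousAt.eventually_lt continuousAt_const (by simpa using Real.pi_pos)
    filter_upwards [e1.filter_mono nhdsWithin_le_nhds, e2.filter_mono nhdsWithin_le_nhds,
      self_mem_nhdsWithin] with E' h1 h2 h3
    obtain ⟨r, hr, hb, ha⟩ := hill_polar h hs E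
    obtain ⟨r', hr', hb', ha'⟩ := hill_polar h hs E'
    have l := hill_lagrange_B h hs E E'
    rw [hb, ha, hb', ha'] at l
    have hsin : r * r' * Real.sin (hillTheta ε μ E' - hillTheta ε μ E) =
        (E' - E) * solJ ε μ 0 1 0 1 E E' 1 := by
      rw [Real.sin_sub, ← l]; ring
    have hpos : 0 < Real.sin (hillTheta ε μ E' - hillTheta ε μ E) := by
      have : 0 < r * r' * Real.sin (hillTheta ε μ E' - hillTheta ε μ E) := by
        rw [hsin]; exact mul_pos (sub_pos.2 h3) h1
      exact (mul_pos_iff_of_pos_left (mul_pos hr hr')).1 this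
    by_contra! hcon
    have := Real.sin_nonpos_of_nonpos_of_neg_pi_le (sub_nonpos.2 hcon) (abs_lt.1 h2).1.le
    linarith
  have mono : Monotone (hillTheta ε μ) := by
    intro E E' hE
    have hcl : IsClosed ({x | hillTheta ε μ E ≤ hillTheta ε μ x} ∩ Set.Icc E E') :=
      (isClosed_le continuous_const hc).inter isClosed_Icc
    have := hcl.Icc_subset_of_forall_exists_gt (by simp) (fun x hx y hy => by
      obtain ⟨z, h1, h2⟩ := ((loc x).and (Ioc_mem_nhdsGT hy)).exists
      exact ⟨z, hx.1.trans h1.le, h2⟩)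
    exact this ⟨hE, le_rfl⟩
  intro E E' hE
  obtain ⟨z, h1, h2⟩ := ((loc E).and (Ioc_mem_nhdsGT hE)).exists
  exact h1.trans_le (mono h2.2)

/-- At energy zero the flux of ψ_{0,2} is constantly 1, so the solution stays positive to the right
of `0` and its angle never reaches π. -/
theorem hillTheta_zero (hs : IsInversionSymmetric ε μ) :
    0 < hillTheta ε μ 0 ∧ hillTheta ε μ 0 < π := by
  have hε := h.coef_ε
  have hμ := h.coef_μ
  have hS := sol_solU hε hμ 0 1 0
  have hne := sol_sq_pos hε hμ (a := 0) (b := 1) (by simp) 0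
  have hup : ∀ x, 0 < x → 0 < solU ε μ 0 1 0 x := by
    intro x hx
    have hp : ∀ t, solP ε μ 0 1 0 t = 1 := fun t => by
      have := hS.eq_p 0 t
      simp only [zero_mul, zero_smul, intervalIntegral.integral_zero, neg_zero,
        solP_zero hε hμ] at this
      linarith
    have h1 := hS.eq_u 0 x
    simp only [hp, solU_zero hε hμ, sub_zero, smul_eq_mul] at h1
    rw [h1]
    exact integral_mul_pos hμ (g := fun _ => 1) continuous_const (fun x _ => h.μ_pos x)
      (fun _ => zero_le_one) (x₀ := x / 2) (a := 0) (b := x) ⟨by linarith, by linarith⟩ one_pos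
  constructor
  · have h0 : 0 ≤ hillTheta ε μ 0 := by
      refine intervalIntegral.integral_nonneg zero_le_one fun t _ => ?_
      have := h.μ_pos t
      simp only [zero_mul, add_zero]
      positivity
    refine lt_of_le_of_ne h0 fun hc => ?_
    obtain ⟨r, hr, hb, -⟩ := hill_polar h hs 0
    rw [← hc, Real.sin_zero, mul_zero] at hb
    exact (hillB_pos h hs le_rfl).ne' hb
  · by_contra! hc
    have hcont := hS.continuous_prufer hμ (hε.const_mul 0) hne 0
    obtain ⟨x, hx, hxπ⟩ := intermediate_value_Icc zero_le_one hcont.continuousOn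
      ⟨by simpa [pruferAngle] using Real.pi_pos.le, hc⟩
    obtain ⟨r, hr, hb, -⟩ := sol_polar hε hμ 0 x
    rw [hxπ, Real.sin_pi, mul_zero] at hb
    rcases eq_or_lt_of_le hx.1 with h0 | h0
    · rw [← h0] at hxπ
      simp only [pruferAngle, intervalIntegral.integral_same] at hxπ
      exact Real.pi_pos.ne hxπ
    · exact (hup x h0).ne' hb

/-- Positivity alone gives no uniform lower bound, but near a common continuity point the
coefficients exceed half of their values there. -/
theorem exists_lower_bound : ∃ s t c : ℝ, 0 ≤ s ∧ s < t ∧ t ≤ 1 ∧ 0 < c ∧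
    ∀ x ∈ Set.Icc s t, c ≤ ε x ∧ c ≤ μ x := by
  obtain ⟨S1, h1⟩ := h.ε_piecewise.1
  obtain ⟨S2, h2⟩ := h.μ_piecewise.1
  have hinf : (Set.Ioo (0 : ℝ) 1 \ (S1 ∪ S2 : Finset ℝ)).Nonempty :=
    ((Set.Ioo_infinite one_pos).sdiff (Finset.finite_toSet _)).nonempty
  obtain ⟨x, hx, hxS⟩ := hinf
  simp only [Finset.coe_union, Set.mem_union, Finset.mem_coe, not_or] at hxS
  have e1 := (h1 x hx hxS.1).eventually_const_lt (half_lt_self (h.ε_pos x))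
  have e2 := (h2 x hx hxS.2).eventually_const_lt (half_lt_self (h.μ_pos x))
  have e3 := e1.and (e2.and (Ioo_mem_nhds hx.1 hx.2))
  obtain ⟨l, u, hlu, hsub⟩ := mem_nhds_iff_exists_Ioo_subset.1 e3
  refine ⟨x, (x + u) / 2, min (ε x / 2) (μ x / 2), hx.1.le, by linarith [hlu.2], ?_, ?_, ?_⟩
  · have : (x + u) / 2 ∈ Set.Ioo l u := ⟨by linarith [hlu.1, hlu.2], by linarith [hlu.2]⟩
    exact (hsub this).2.2.2.le
  · have := h.ε_pos x
    have := h.μ_pos x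
    positivity
  · intro y hy
    have hyI : y ∈ Set.Ioo l u := ⟨hlu.1.trans_le hy.1, by linarith [hy.2, hlu.2]⟩
    have := hsub hyI
    exact ⟨(min_le_left _ _).trans this.1.le, (min_le_right _ _).trans this.2.1.le⟩

/-- The interval with positive lower bounds is cut into `n` pieces. A large energy forces a zero of
the solution in each piece, and each zero takes the increasing angle to a further multiple of π. -/
theorem exists_hillTheta_ge (n : ℕ) : ∃ E, 0 < E ∧ n * π ≤ hillTheta ε μ E := by
  rcases Nat.eq_zero_or_pos n with hn | hn
  · refine ⟨1, one_pos, ?_⟩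
    rw [hn, Nat.cast_zero, zero_mul]
    exact ((sol_solU h.coef_ε h.coef_μ 0 1 1).prufer_pos h.coef_μ (h.coef_ε.const_mul 1)
      (sol_sq_pos h.coef_ε h.coef_μ (by simp) 1) one_pos (fun t _ => h.μ_pos t)
      (fun t _ => mul_pos one_pos (h.ε_pos t))).le
  obtain ⟨s, t, c, hs0, hst, ht1, hc, hlow⟩ := exists_lower_bound h
  have hε := h.coef_ε
  have hμ := h.coef_μ
  set g := (t - s) / (4 * n) with hg
  have hn' : (0 : ℝ) < n := by exact_mod_cast hn
  have hgpos : 0 < g := div_pos (sub_pos.2 hst) (by positivity)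
  obtain ⟨E, hE⟩ := exists_gt (1 / (c * c * g ^ 2))
  have hE0 : 0 < E := lt_trans (by positivity) hE
  have hlarge : 1 < (E * c) * c * g ^ 2 := by
    rw [div_lt_iff₀ (by positivity)] at hE
    linarith
  refine ⟨E, hE0, ?_⟩
  have hS := sol_solU hε hμ 0 1 E
  have he := hε.const_mul E
  have hne := sol_sq_pos hε hμ (a := 0) (b := 1) (by simp) E
  set θ := pruferAngle μ (fun t => E * ε t) (solU ε μ 0 1 E) (solP ε μ 0 1 E) 0 with hθ
  have hmono : StrictMono θ := by
    intro x y hxy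
    have h1 := hS.prufer_sub hμ he hne 0 x y
    have h2 := hS.prufer_pos hμ he hne hxy (fun t _ => h.μ_pos t)
      (fun t _ => mul_pos hE0 (h.ε_pos t))
    rw [← hθ] at h1
    linarith
  have θ0 : θ 0 = 0 := by simp [hθ, pruferAngle]
  have hend : s + n * (4 * g) = t := by
    rw [hg]; field_simp; ring
  have ind : ∀ i : ℕ, i ≤ n → i * π ≤ θ (s + i * (4 * g)) := by
    intro i
    induction i with
    | zero =>
      intro _
      simp only [Nat.cast_zero, zero_mul, add_zero]
      rw [← θ0]
      exact hmono.monotone hs0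
    | succ i ih =>
      intro hi
      have hi' : ((i + 1 : ℕ) : ℝ) ≤ n := by exact_mod_cast hi
      have hsub : ∀ x ∈ Set.Icc (s + i * (4 * g)) (s + i * (4 * g) + 4 * g), x ∈ Set.Icc s t := by
        intro x hx
        refine ⟨le_trans (by simpa using by positivity) hx.1, hx.2.trans ?_⟩
        rw [← hend]
        push_cast at hi'
        nlinarith
      obtain ⟨z, hz, hz0⟩ := hS.exists_zero hμ he (c := c) (k := E * c)
        (x₀ := s + i * (4 * g)) hgpos hc (by positivity)
        (fun x hx => (hlow x (hsub x hx)).2)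
        (fun x hx => mul_le_mul_of_nonneg_left (hlow x (hsub x hx)).1 hE0.le) hlarge
      obtain ⟨r, hr, hb, -⟩ := sol_polar hε hμ E z
      rw [hz0, ← hθ] at hb
      have hsin := (mul_eq_zero.1 hb.symm).resolve_left hr.ne'
      obtain ⟨k, hk⟩ := Real.sin_eq_zero_iff.1 hsin
      have h1 : i * π < k * π := by
        rw [hk]
        exact (ih (by omega)).trans_lt (hmono hz.1)
      have h2 : ((i : ℤ) : ℝ) < k := by
        simpa using lt_of_mul_lt_mul_right h1 Real.pi_pos.le
      have h3 : (i : ℤ) + 1 ≤ k := Int.cast_lt.1 h2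
      have h4 : (((i : ℤ) + 1 : ℤ) : ℝ) ≤ k := Int.cast_le.2 h3
      push_cast at h4 ⊢
      have h5 : s + (i + 1) * (4 * g) = s + i * (4 * g) + 4 * g := by ring
      rw [h5]
      calc ((i : ℝ) + 1) * π ≤ k * π := mul_le_mul_of_nonneg_right h4 Real.pi_pos.le
        _ = θ z := hk
        _ ≤ _ := (hmono hz.2).le
  have := ind n le_rfl
  rw [hend] at this
  exact this.trans (hmono.monotone ht1)

end HillAngle

end Photonic


namespace Photonic

/-! ### The band structure -/

/-- A negative derivative at one point suffices: the slopes towards nearby points are negative. -/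
theorem eventually_of_hasDerivAt_neg {f : ℝ → ℝ} {f' x : ℝ} (h : HasDerivAt f f' x) (hf : f' < 0) :
    (∀ᶠ y in 𝓝[>] x, f y < f x) ∧ ∀ᶠ y in 𝓝[<] x, f x < f y := by
  have h1 := (hasDerivAt_iff_tendsto_slope.1 h).eventually_lt_const hf
  have hR : 𝓝[>] x ≤ 𝓝[≠] x := nhdsWithin_mono _ fun y hy => ne_of_gt hy
  have hL : 𝓝[<] x ≤ 𝓝[≠] x := nhdsWithin_mono _ fun y hy => ne_of_lt hy
  constructor
  · filter_upwards [h1.filter_mono hR, self_mem_nhdsWithin] with y hy hxy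
    rw [slope_def_field, div_neg_iff] at hy
    rcases hy with hy | hy
    · exact absurd hy.2 (not_lt.2 (sub_nonneg.2 (le_of_lt hxy)))
    · linarith [hy.1]
  · filter_upwards [h1.filter_mono hL, self_mem_nhdsWithin] with y hy hxy
    rw [slope_def_field, div_neg_iff] at hy
    rcases hy with hy | hy
    · linarith [hy.1]
    · exact absurd hy.2 (not_lt.2 (sub_nonpos.2 (le_of_lt hxy)))

/-! ### Functions that decrease wherever their modulus is at most one -/

section Crossing

variable {f : ℝ → ℝ} {l r : ℝ}

/-- Start from a point strictly below the level `t`. At the first return to `t` the level would be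
reached from below, although the derivative there is negative. -/
theorem lt_of_decreasing_crossing (hf : Continuous f)
    (hd : ∀ x ∈ Set.Ioo l r, |f x| ≤ 1 → ∃ f' < 0, HasDerivAt f f' x) {x y t : ℝ} (hl : l < x)
    (hxy : x < y) (hy : y < r) (ht : |t| ≤ 1) (hx : f x ≤ t) : f y < t := by
  by_contra! hc
  obtain ⟨x', hx', hfx'⟩ : ∃ x' ∈ Set.Ico x y, f x' < t := by
    rcases hx.lt_or_eq with h | h
    · exact ⟨x, ⟨le_rfl, hxy⟩, h⟩
    · obtain ⟨f', hf', hder⟩ := hd x ⟨hl, hxy.trans hy⟩ (h ▸ ht)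
      obtain ⟨z, h1, h2⟩ := ((eventually_of_hasDerivAt_neg hder hf').1.and
        (Ioo_mem_nhdsGT hxy)).exists
      exact ⟨z, ⟨h2.1.le, h2.2⟩, h ▸ h1⟩
  have hcl : IsClosed (Set.Icc x' y ∩ {w | t ≤ f w}) :=
    isClosed_Icc.inter (isClosed_le continuous_const hf)
  have hne : (Set.Icc x' y ∩ {w | t ≤ f w}).Nonempty := ⟨y, ⟨hx'.2.le, le_rfl⟩, hc⟩
  have hbd : BddBelow (Set.Icc x' y ∩ {w | t ≤ f w}) := ⟨x', fun w hw => hw.1.1⟩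
  have hz := hcl.csInf_mem hne hbd
  set z := sInf (Set.Icc x' y ∩ {w | t ≤ f w})
  have hz' : ∀ w ∈ Set.Ico x' z, f w < t := fun w hw => by
    by_contra! h
    exact absurd (csInf_le hbd ⟨⟨hw.1, hw.2.le.trans hz.1.2⟩, h⟩) (not_le.2 hw.2)
  have hxz : x' < z := lt_of_le_of_ne hz.1.1 fun h => absurd hz.2 (by
    rw [Set.mem_ofPred_eq, ← h]; exact not_le.2 hfx')
  have hev : ∀ᶠ w in 𝓝[<] z, f w < t := by
    filter_upwards [Ico_mem_nhdsLT hxz] with w hw using hz' w hw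
  have hfz : f z = t := le_antisymm
    (le_of_tendsto (hf.continuousAt.tendsto.mono_left nhdsWithin_le_nhds)
      (hev.mono fun w hw => hw.le)) hz.2
  obtain ⟨f', hf', hder⟩ := hd z ⟨hl.trans_le (hx'.1.trans hxz.le), hz.1.2.trans_lt hy⟩ (hfz ▸ ht)
  obtain ⟨w, h1, h2⟩ := ((eventually_of_hasDerivAt_neg hder hf').2.and hev).exists
  linarith

/-- A function that goes from `1` to `-1` and decreases wherever its modulus is at most one takes
the values in `[-1, 1]` on a single interval. -/
theorem decreasing_crossing (hlr : l < r) (hf : Continuous f) (hfl : f l = 1) (hfr : f r = -1)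
    (hd : ∀ x ∈ Set.Ioo l r, |f x| ≤ 1 → ∃ f' < 0, HasDerivAt f f' x) {α β : ℝ}
    (hα : α = sSup (Set.Icc l r ∩ {x | 1 ≤ f x})) (hβ : β = sInf (Set.Icc l r ∩ {x | f x ≤ -1})) :
    l ≤ α ∧ α < β ∧ β ≤ r ∧ f α = 1 ∧ f β = -1 ∧ StrictAntiOn f (Set.Icc α β) ∧
      (∀ x ∈ Set.Ioo l α, 1 < f x) ∧ ∀ x ∈ Set.Ioo β r, f x < -1 := by
  have bA : BddAbove (Set.Icc l r ∩ {x | 1 ≤ f x}) := ⟨r, fun w hw => hw.1.2⟩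
  have bB : BddBelow (Set.Icc l r ∩ {x | f x ≤ -1}) := ⟨l, fun w hw => hw.1.1⟩
  have mA : α ∈ Set.Icc l r ∩ {x | 1 ≤ f x} := by
    rw [hα]
    exact (isClosed_Icc.inter (isClosed_le continuous_const hf)).csSup_mem
      ⟨l, ⟨le_rfl, hlr.le⟩, hfl.ge⟩ bA
  have mB : β ∈ Set.Icc l r ∩ {x | f x ≤ -1} := by
    rw [hβ]
    exact (isClosed_Icc.inter (isClosed_le hf continuous_const)).csInf_mem
      ⟨r, ⟨hlr.le, le_rfl⟩, hfr.le⟩ bB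
  have gA : ∀ x, α < x → x ≤ r → f x < 1 := fun x h1 h2 => by
    by_contra! h
    exact absurd (hα ▸ le_csSup bA ⟨⟨mA.1.1.trans h1.le, h2⟩, h⟩) (not_le.2 h1)
  have gB : ∀ x, l ≤ x → x < β → -1 < f x := fun x h1 h2 => by
    by_contra! h
    exact absurd (hβ ▸ csInf_le bB ⟨⟨h1, h2.le.trans mB.1.2⟩, h⟩) (not_le.2 h2)
  have hAr : α < r := lt_of_le_of_ne mA.1.2 fun h => by
    have : 1 ≤ f α := mA.2
    rw [h, hfr] at this; linarith
  have hBl : l < β := lt_of_le_of_ne mB.1.1 fun h => by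
    have : f β ≤ -1 := mB.2
    rw [← h, hfl] at this; linarith
  have fA : f α = 1 := by
    refine le_antisymm ?_ mA.2
    have hev : ∀ᶠ w in 𝓝[>] α, f w < 1 := by
      filter_upwards [Ioc_mem_nhdsGT hAr] with w hw using gA w hw.1 hw.2
    exact le_of_tendsto (hf.continuousAt.tendsto.mono_left nhdsWithin_le_nhds)
      (hev.mono fun w hw => hw.le)
  have fB : f β = -1 := by
    refine le_antisymm mB.2 ?_
    have hev : ∀ᶠ w in 𝓝[<] β, -1 < f w := by
      filter_upwards [Ico_mem_nhdsLT hBl] with w hw using gB w hw.1 hw.2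
    exact ge_of_tendsto (hf.continuousAt.tendsto.mono_left nhdsWithin_le_nhds)
      (hev.mono fun w hw => hw.le)
  have hAB : α < β := by
    by_contra! h
    rcases h.lt_or_eq with h | h
    · have := lt_of_decreasing_crossing hf hd hBl h hAr (t := 1) (by simp) (by rw [fB]; norm_num)
      linarith
    · rw [h, fA] at fB; norm_num at fB
  refine ⟨mA.1.1, hAB, mB.1.2, fA, fB, ?_, ?_, ?_⟩
  · intro x hx y hy hxy
    rcases hx.1.eq_or_lt with h | h
    · rw [← h, fA]; exact gA y (h ▸ hxy) (hy.2.trans mB.1.2)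
    · rcases hy.2.eq_or_lt with h' | h'
      · rw [h', fB]; exact gB x (mA.1.1.trans hx.1) (h' ▸ hxy)
      · refine lt_of_decreasing_crossing hf hd (mA.1.1.trans_lt h) hxy (h'.trans_le mB.1.2) ?_ le_rfl
        exact abs_le.2 ⟨(gB x (mA.1.1.trans hx.1) (hxy.trans h')).le,
          (gA x h (hx.2.trans mB.1.2)).le⟩
  · intro x hx
    by_contra! h
    have := lt_of_decreasing_crossing hf hd hx.1 hx.2 hAr (t := 1) (by simp) h
    linarith
  · intro x hx
    exact lt_of_decreasing_crossing hf hd hBl hx.1 hx.2 (by simp) fB.le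

end Crossing

/-- The energies at which the Prüfer angle is `n π`: the Dirichlet eigenvalues for `n ≥ 1`. -/
noncomputable def hillDelta (ε μ : ℝ → ℝ) (n : ℕ) : ℝ :=
  -- Although `0` is no Dirichlet eigenvalue, `hillA` equals `1` there, so it serves as left end of
  -- the interval of the first band.
  if n = 0 then 0 else Classical.epsilon fun E => hillTheta ε μ E = n * π

/-- The lower edge of the band `n + 1`. -/
noncomputable def bandLo (ε μ : ℝ → ℝ) (n : ℕ) : ℝ :=
  sSup (Set.Icc (hillDelta ε μ n) (hillDelta ε μ (n + 1)) ∩ {x | 1 ≤ (-1) ^ n * hillA ε μ x})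

/-- The upper edge of the band `n + 1`. -/
noncomputable def bandHi (ε μ : ℝ → ℝ) (n : ℕ) : ℝ :=
  sInf (Set.Icc (hillDelta ε μ n) (hillDelta ε μ (n + 1)) ∩ {x | (-1) ^ n * hillA ε μ x ≤ -1})

/-- The energy in the band `n + 1` as a function of `t = cos k`. -/
noncomputable def bandFn (ε μ : ℝ → ℝ) (n : ℕ) (t : ℝ) : ℝ :=
  Function.invFunOn (hillA ε μ) (Set.Icc (bandLo ε μ n) (bandHi ε μ n)) t

/-! ### One band in each interval of the sequence `hillDelta` -/

section Bands

variable {ε μ : ℝ → ℝ} (h : IsPeriodicStructure ε μ) (hs : IsInversionSymmetric ε μ)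
include h hs

theorem hillTheta_delta (n : ℕ) (hn : n ≠ 0) : hillTheta ε μ (hillDelta ε μ n) = n * π := by
  rw [hillDelta, if_neg hn]
  refine Classical.epsilon_spec (p := fun E => hillTheta ε μ E = n * π) ?_
  obtain ⟨E, hE, hge⟩ := exists_hillTheta_ge h n
  have h1 : (1 : ℝ) ≤ n := by exact_mod_cast Nat.one_le_iff_ne_zero.2 hn
  obtain ⟨x, -, hx⟩ := intermediate_value_Icc hE.le
    (continuous_hillTheta h.coef_ε h.coef_μ).continuousOn
    ⟨(hillTheta_zero h hs).2.le.trans (by nlinarith [Real.pi_pos]), hge⟩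
  exact ⟨x, hx⟩

omit h hs in
theorem hillDelta_zero : hillDelta ε μ 0 = 0 := if_pos rfl

theorem strictMono_hillDelta : StrictMono (hillDelta ε μ) := by
  refine strictMono_nat_of_lt_succ fun n => ?_
  rw [← (strictMono_hillTheta h hs).lt_iff_lt, hillTheta_delta h hs (n + 1) (by omega)]
  rcases Nat.eq_zero_or_pos n with hn | hn
  · rw [hn, hillDelta_zero]
    simpa using (hillTheta_zero h hs).2
  · rw [hillTheta_delta h hs n hn.ne']
    push_cast
    nlinarith [Real.pi_pos]

theorem exists_lt_hillDelta (E : ℝ) : ∃ n, E < hillDelta ε μ n := by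
  obtain ⟨n, hn⟩ := exists_nat_gt (hillTheta ε μ E / π)
  refine ⟨n + 1, ?_⟩
  rw [← (strictMono_hillTheta h hs).lt_iff_lt, hillTheta_delta h hs (n + 1) (by omega)]
  rw [div_lt_iff₀ Real.pi_pos] at hn
  push_cast
  nlinarith [Real.pi_pos]

/-- The angle lies strictly between nπ and (n+1)π, where the sine has the sign (-1)^n. -/
theorem hillB_sign {n : ℕ} {E : ℝ} (hE : E ∈ Set.Ioo (hillDelta ε μ n) (hillDelta ε μ (n + 1))) :
    0 < (-1) ^ n * hillB ε μ E := by
  have m := strictMono_hillTheta h hs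
  have h1 : n * π < hillTheta ε μ E := by
    rcases Nat.eq_zero_or_pos n with hn | hn
    · have := m hE.1
      rw [hn, hillDelta_zero] at this
      rw [hn, Nat.cast_zero, zero_mul]
      exact (hillTheta_zero h hs).1.trans this
    · rw [← hillTheta_delta h hs n hn.ne']
      exact m hE.1
  have h2 := m hE.2
  rw [hillTheta_delta h hs (n + 1) (by omega)] at h2
  push_cast at h2
  obtain ⟨r, hr, hb, -⟩ := hill_polar h hs E
  have := Real.sin_pos_of_pos_of_lt_pi (sub_pos.2 h1) (by linarith)
  rw [Real.sin_sub_nat_mul_pi] at this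
  rw [hb]
  have := mul_pos hr this
  linarith

theorem hillB_delta {n : ℕ} (hn : n ≠ 0) : hillB ε μ (hillDelta ε μ n) = 0 := by
  obtain ⟨r, hr, hb, -⟩ := hill_polar h hs (hillDelta ε μ n)
  rw [hb, hillTheta_delta h hs n hn, Real.sin_nat_mul_pi, mul_zero]

omit h hs in
theorem neg_one_pow_sq (n : ℕ) : ((-1 : ℝ) ^ n) ^ 2 = 1 := by
  rw [← pow_mul, mul_comm, pow_mul]; norm_num

omit h hs in
theorem neg_one_pow_mul_self (n : ℕ) : ((-1 : ℝ) ^ n) * (-1) ^ n = 1 := by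
  rw [← sq, neg_one_pow_sq]

/-- Where B vanishes, the determinant gives A² = 1, so the polar radius is 1 and A = cos nπ. The
index `0` rests on the constant solution instead. -/
theorem hillA_delta (n : ℕ) : (-1) ^ n * hillA ε μ (hillDelta ε μ n) = 1 := by
  rcases Nat.eq_zero_or_pos n with hn | hn
  · rw [hn, hillDelta_zero, (hill_zero h).1]; simp
  · obtain ⟨r, hr, hb, ha⟩ := hill_polar h hs (hillDelta ε μ n)
    have hd := hill_det h hs (hillDelta ε μ n)
    rw [hillB_delta h hs hn.ne', ha, hillTheta_delta h hs n hn.ne', Real.cos_nat_mul_pi,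
      zero_mul, sub_zero, mul_pow, neg_one_pow_sq, mul_one] at hd
    rw [ha, hillTheta_delta h hs n hn.ne', Real.cos_nat_mul_pi]
    have : r = 1 := by nlinarith
    rw [this, one_mul, neg_one_pow_mul_self]

theorem hillA_delta_succ (n : ℕ) : (-1) ^ n * hillA ε μ (hillDelta ε μ (n + 1)) = -1 := by
  have := hillA_delta h hs (n + 1)
  rw [pow_succ] at this
  linarith

omit h hs in
theorem abs_neg_one_pow_mul (n : ℕ) (x : ℝ) : |(-1) ^ n * x| = |x| := by
  rw [abs_mul, abs_pow, abs_neg, abs_one, one_pow, one_mul]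

/-- Where A² ≤ 1, BC = A² - 1 ≤ 0, so C never has the sign of B. Both terms in the derivative of A
then have the same sign, the one with B strictly. -/
theorem hillA_decreasing {n : ℕ} {E : ℝ}
    (hE : E ∈ Set.Ioo (hillDelta ε μ n) (hillDelta ε μ (n + 1)))
    (hA : |(-1) ^ n * hillA ε μ E| ≤ 1) :
    ∃ f' < 0, HasDerivAt (fun E => (-1) ^ n * hillA ε μ E) f' E := by
  refine ⟨_, ?_, (hasDerivAt_hillA h hs E).const_mul ((-1) ^ n)⟩
  have hb := hillB_sign h hs hE
  rw [abs_neg_one_pow_mul] at hA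
  have hd := hill_det h hs E
  have hA2 : hillA ε μ E ^ 2 ≤ 1 := by rw [← sq_abs]; nlinarith [abs_nonneg (hillA ε μ E)]
  have j1 := solJ_pos h (a := 1) (b := 0) (by simp) E one_pos
  have j2 := solJ_pos h (a := 0) (b := 1) (by simp) E one_pos
  have hc : (-1) ^ n * hillC ε μ E ≤ 0 := by
    by_contra! hc
    have h1 := mul_pos hb hc
    have h2 : (-1) ^ n * hillB ε μ E * ((-1) ^ n * hillC ε μ E) =
        ((-1) ^ n) ^ 2 * (hillB ε μ E * hillC ε μ E) := by ring
    rw [h2, neg_one_pow_sq, one_mul] at h1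
    linarith
  have h1 := mul_pos hb j1
  have h2 := mul_nonpos_of_nonpos_of_nonneg hc j2.le
  linarith

theorem band_spec (n : ℕ) : hillDelta ε μ n ≤ bandLo ε μ n ∧ bandLo ε μ n < bandHi ε μ n ∧
    bandHi ε μ n ≤ hillDelta ε μ (n + 1) ∧ (-1) ^ n * hillA ε μ (bandLo ε μ n) = 1 ∧
    (-1) ^ n * hillA ε μ (bandHi ε μ n) = -1 ∧
    StrictAntiOn (fun E => (-1) ^ n * hillA ε μ E) (Set.Icc (bandLo ε μ n) (bandHi ε μ n)) ∧
    (∀ E ∈ Set.Ioo (hillDelta ε μ n) (bandLo ε μ n), 1 < (-1) ^ n * hillA ε μ E) ∧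
    ∀ E ∈ Set.Ioo (bandHi ε μ n) (hillDelta ε μ (n + 1)), (-1) ^ n * hillA ε μ E < -1 :=
  decreasing_crossing (strictMono_hillDelta h hs n.lt_succ_self)
    (continuous_const.mul (continuous_hillA h)) (hillA_delta h hs n) (hillA_delta_succ h hs n)
    (fun _ hx hA => hillA_decreasing h hs hx hA) rfl rfl

theorem delta_le_lo (n : ℕ) : hillDelta ε μ n ≤ bandLo ε μ n := (band_spec h hs n).1

theorem lo_lt_hi (n : ℕ) : bandLo ε μ n < bandHi ε μ n := (band_spec h hs n).2.1

theorem hi_le_delta (n : ℕ) : bandHi ε μ n ≤ hillDelta ε μ (n + 1) := (band_spec h hs n).2.2.1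

theorem hi_le_lo (n : ℕ) : bandHi ε μ n ≤ bandLo ε μ (n + 1) :=
  (hi_le_delta h hs n).trans (delta_le_lo h hs (n + 1))

theorem hillA_lo (n : ℕ) : hillA ε μ (bandLo ε μ n) = (-1) ^ n := by
  have := (band_spec h hs n).2.2.2.1
  calc _ = ((-1) ^ n * (-1) ^ n) * hillA ε μ (bandLo ε μ n) := by
        rw [neg_one_pow_mul_self, one_mul]
    _ = _ := by rw [mul_assoc, this, mul_one]

theorem hillA_hi (n : ℕ) : hillA ε μ (bandHi ε μ n) = -(-1) ^ n := by
  have := (band_spec h hs n).2.2.2.2.1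
  calc _ = ((-1) ^ n * (-1) ^ n) * hillA ε μ (bandHi ε μ n) := by
        rw [neg_one_pow_mul_self, one_mul]
    _ = _ := by rw [mul_assoc, this, mul_neg, mul_one]

theorem abs_hillA_le {n : ℕ} {E : ℝ} (hE : E ∈ Set.Icc (bandLo ε μ n) (bandHi ε μ n)) :
    |hillA ε μ E| ≤ 1 := by
  obtain ⟨-, hlt, -, h1, h2, h3, -, -⟩ := band_spec h hs n
  rw [← abs_neg_one_pow_mul n]
  refine abs_le.2 ⟨?_, ?_⟩
  · exact h2.ge.trans (h3.antitoneOn hE ⟨hlt.le, le_rfl⟩ hE.2)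
  · exact (h3.antitoneOn ⟨le_rfl, hlt.le⟩ hE hE.1).trans h1.le

theorem abs_hillA_lt {n : ℕ} {E : ℝ} (hE : E ∈ Set.Ioo (bandLo ε μ n) (bandHi ε μ n)) :
    |hillA ε μ E| < 1 := by
  obtain ⟨-, hlt, -, h1, h2, h3, -, -⟩ := band_spec h hs n
  rw [← abs_neg_one_pow_mul n]
  refine abs_lt.2 ⟨?_, ?_⟩
  · exact h2.ge.trans_lt (h3 ⟨hE.1.le, hE.2.le⟩ ⟨hlt.le, le_rfl⟩ hE.2)
  · exact (h3 ⟨le_rfl, hlt.le⟩ ⟨hE.1.le, hE.2.le⟩ hE.1).trans_le h1.le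

theorem injOn_hillA (n : ℕ) :
    Set.InjOn (hillA ε μ) (Set.Icc (bandLo ε μ n) (bandHi ε μ n)) := by
  intro x hx y hy hxy
  exact (band_spec h hs n).2.2.2.2.2.1.injOn hx hy (by simp only [hxy])

theorem exists_band_energy (n : ℕ) {t : ℝ} (ht : |t| ≤ 1) :
    ∃ E ∈ Set.Icc (bandLo ε μ n) (bandHi ε μ n), hillA ε μ E = t := by
  obtain ⟨-, hlt, -, h1, h2, -, -, -⟩ := band_spec h hs n
  rw [← abs_neg_one_pow_mul n, abs_le] at ht
  obtain ⟨E, hE, hEt⟩ := intermediate_value_Icc' hlt.le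
    (continuous_const.mul (continuous_hillA h)).continuousOn (f := fun E => (-1) ^ n * hillA ε μ E)
    (show (-1) ^ n * t ∈ _ from ⟨by rw [h2]; exact ht.1, by rw [h1]; exact ht.2⟩)
  refine ⟨E, hE, ?_⟩
  have hne : ((-1 : ℝ) ^ n) ≠ 0 := by positivity
  exact mul_left_cancel₀ hne hEt

theorem bandFn_mem (n : ℕ) {t : ℝ} (ht : |t| ≤ 1) :
    bandFn ε μ n t ∈ Set.Icc (bandLo ε μ n) (bandHi ε μ n) :=
  Function.invFunOn_mem (exists_band_energy h hs n ht)

theorem hillA_bandFn (n : ℕ) {t : ℝ} (ht : |t| ≤ 1) : hillA ε μ (bandFn ε μ n t) = t :=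
  Function.invFunOn_eq (exists_band_energy h hs n ht)

theorem bandFn_hillA {n : ℕ} {E : ℝ} (hE : E ∈ Set.Icc (bandLo ε μ n) (bandHi ε μ n)) :
    bandFn ε μ n (hillA ε μ E) = E :=
  injOn_hillA h hs n (bandFn_mem h hs n (abs_hillA_le h hs hE)) hE
    (hillA_bandFn h hs n (abs_hillA_le h hs hE))

theorem bandFn_lo (n : ℕ) : bandFn ε μ n ((-1) ^ n) = bandLo ε μ n := by
  rw [← hillA_lo h hs n]
  exact bandFn_hillA h hs ⟨le_rfl, (lo_lt_hi h hs n).le⟩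

theorem bandFn_hi (n : ℕ) : bandFn ε μ n (-(-1) ^ n) = bandHi ε μ n := by
  rw [← hillA_hi h hs n]
  exact bandFn_hillA h hs ⟨(lo_lt_hi h hs n).le, le_rfl⟩

theorem bandFn_le_succ (n : ℕ) {t : ℝ} (ht : |t| ≤ 1) : bandFn ε μ n t ≤ bandFn ε μ (n + 1) t :=
  (bandFn_mem h hs n ht).2.trans ((hi_le_lo h hs n).trans (bandFn_mem h hs (n + 1) ht).1)

theorem monotone_bandFn {t : ℝ} (ht : |t| ≤ 1) : Monotone fun n => bandFn ε μ n t :=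
  monotone_nat_of_le_succ fun n => bandFn_le_succ h hs n ht

theorem continuousOn_bandFn (n : ℕ) : ContinuousOn (bandFn ε μ n) {t | |t| ≤ 1} := by
  intro t₀ ht₀
  have m₀ := bandFn_mem h hs n ht₀
  have a₀ := hillA_bandFn h hs n ht₀
  obtain ⟨-, -, -, -, -, hanti, -, -⟩ := band_spec h hs n
  have hc : ContinuousWithinAt (fun t : ℝ => (-1) ^ n * t) {t | |t| ≤ 1} t₀ := by fun_prop
  refine tendsto_order.2 ⟨fun y hy => ?_, fun y hy => ?_⟩
  · by_cases hyl : bandLo ε μ n ≤ y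
    · have hym : y ∈ Set.Icc (bandLo ε μ n) (bandHi ε μ n) := ⟨hyl, hy.le.trans m₀.2⟩
      have := hanti hym m₀ hy
      simp only [a₀] at this
      filter_upwards [hc.eventually_lt_const this, self_mem_nhdsWithin] with t h1 h2
      rw [← hillA_bandFn h hs n h2] at h1
      by_contra! hcon
      exact absurd (hanti.antitoneOn (bandFn_mem h hs n h2) hym hcon) (not_le.2 h1)
    · filter_upwards [self_mem_nhdsWithin] with t ht
      exact (not_le.1 hyl).trans_le (bandFn_mem h hs n ht).1
  · by_cases hyl : y ≤ bandHi ε μ n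
    · have hym : y ∈ Set.Icc (bandLo ε μ n) (bandHi ε μ n) := ⟨m₀.1.trans hy.le, hyl⟩
      have := hanti m₀ hym hy
      simp only [a₀] at this
      filter_upwards [hc.eventually_const_lt this, self_mem_nhdsWithin] with t h1 h2
      rw [← hillA_bandFn h hs n h2] at h1
      by_contra! hcon
      exact absurd (hanti.antitoneOn hym (bandFn_mem h hs n h2) hcon) (not_le.2 h1)
    · filter_upwards [self_mem_nhdsWithin] with t ht
      exact (bandFn_mem h hs n ht).2.trans_lt (not_le.1 hyl)

/-! ### The band edges at a Dirichlet eigenvalue -/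

/-- Strictly between the band and the next `hillDelta` the signed trace lies beyond its band values,
so its behaviour just below that energy decides whether the band reaches it. The next three lemmas
vary this. -/
theorem hi_eq_delta_of_eventually {n : ℕ}
    (hev : ∀ᶠ E in 𝓝[<] hillDelta ε μ (n + 1), (-1) ^ (n + 1) * hillA ε μ E < 1) :
    bandHi ε μ n = hillDelta ε μ (n + 1) := by
  refine le_antisymm (hi_le_delta h hs n) ?_
  by_contra! hlt
  obtain ⟨E, h1, h2⟩ := (hev.and (Ioo_mem_nhdsLT hlt)).exists
  have := (band_spec h hs n).2.2.2.2.2.2.2 E h2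
  rw [pow_succ] at h1
  linarith

theorem hi_lt_delta_of_eventually {n : ℕ}
    (hev : ∀ᶠ E in 𝓝[<] hillDelta ε μ (n + 1), 1 < (-1) ^ (n + 1) * hillA ε μ E) :
    bandHi ε μ n < hillDelta ε μ (n + 1) := by
  refine lt_of_le_of_ne (hi_le_delta h hs n) fun heq => ?_
  rw [← heq] at hev
  obtain ⟨E, h1, h2⟩ := (hev.and (Ioo_mem_nhdsLT (lo_lt_hi h hs n))).exists
  have := abs_hillA_lt h hs h2
  rw [← abs_neg_one_pow_mul (n + 1)] at this
  linarith [(abs_lt.1 this).2]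

theorem lo_eq_delta_of_eventually {n : ℕ}
    (hev : ∀ᶠ E in 𝓝[>] hillDelta ε μ n, (-1) ^ n * hillA ε μ E < 1) :
    bandLo ε μ n = hillDelta ε μ n := by
  refine le_antisymm ?_ (delta_le_lo h hs n)
  by_contra! hlt
  obtain ⟨E, h1, h2⟩ := (hev.and (Ioo_mem_nhdsGT hlt)).exists
  have := (band_spec h hs n).2.2.2.2.2.2.1 E h2
  linarith

theorem delta_lt_lo_of_eventually {n : ℕ}
    (hev : ∀ᶠ E in 𝓝[>] hillDelta ε μ n, 1 < (-1) ^ n * hillA ε μ E) :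
    hillDelta ε μ n < bandLo ε μ n := by
  refine lt_of_le_of_ne (delta_le_lo h hs n) fun heq => ?_
  rw [heq] at hev
  obtain ⟨E, h1, h2⟩ := (hev.and (Ioo_mem_nhdsGT (lo_lt_hi h hs n))).exists
  have := abs_hillA_lt h hs h2
  rw [← abs_neg_one_pow_mul n] at this
  linarith [(abs_lt.1 this).2]

theorem bandLo_zero : bandLo ε μ 0 = 0 := by
  rw [lo_eq_delta_of_eventually h hs, hillDelta_zero]
  rw [hillDelta_zero]
  have hd := hasDerivAt_hillA h hs 0
  have h1 := (eventually_of_hasDerivAt_neg hd (by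
    rw [(hill_zero h).2]
    have := hillB_pos h hs le_rfl
    have := solJ_pos h (a := 1) (b := 0) (by simp) 0 one_pos
    have : 0 < hillB ε μ 0 * solJ ε μ 1 0 1 0 0 0 1 := by positivity
    linarith)).1
  rw [(hill_zero h).1] at h1
  simpa using h1

/-- As B vanishes here, the derivative of A is a positive multiple of C. The signed trace increases
through 1: the energy ends the band below it and begins a gap. -/
theorem edges_of_pos {n : ℕ} (hc : 0 < (-1) ^ (n + 1) * hillC ε μ (hillDelta ε μ (n + 1))) :
    bandHi ε μ n = hillDelta ε μ (n + 1) ∧ hillDelta ε μ (n + 1) < bandLo ε μ (n + 1) := by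
  have hd := ((hasDerivAt_hillA h hs (hillDelta ε μ (n + 1))).const_mul ((-1) ^ (n + 1))).neg
  have h1 := eventually_of_hasDerivAt_neg hd (by
    rw [hillB_delta h hs (by omega)]
    have := solJ_pos h (a := 0) (b := 1) (by simp) (hillDelta ε μ (n + 1)) one_pos
    have := mul_pos hc this
    linarith)
  simp only [Pi.neg_apply, neg_lt_neg_iff, hillA_delta h hs] at h1
  exact ⟨hi_eq_delta_of_eventually h hs h1.2, delta_lt_lo_of_eventually h hs h1.1⟩

/-- The mirror case: the signed trace decreases through 1, so the gap lies below this energy. -/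
theorem edges_of_neg {n : ℕ} (hc : (-1) ^ (n + 1) * hillC ε μ (hillDelta ε μ (n + 1)) < 0) :
    bandHi ε μ n < hillDelta ε μ (n + 1) ∧ bandLo ε μ (n + 1) = hillDelta ε μ (n + 1) := by
  have hd := ((hasDerivAt_hillA h hs (hillDelta ε μ (n + 1))).const_mul ((-1) ^ (n + 1)))
  have h1 := eventually_of_hasDerivAt_neg hd (by
    rw [hillB_delta h hs (by omega)]
    have := solJ_pos h (a := 0) (b := 1) (by simp) (hillDelta ε μ (n + 1)) one_pos
    have := mul_pos (neg_pos.2 hc) this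
    linarith)
  rw [hillA_delta h hs] at h1
  exact ⟨hi_lt_delta_of_eventually h hs h1.2, lo_eq_delta_of_eventually h hs h1.1⟩

/-- Near an energy at which the monodromy matrix is scalar. -/
theorem one_sub_hillA_sq {E : ℝ} (hb : hillB ε μ E = 0) (hc : hillC ε μ E = 0) (E' : ℝ) :
    1 - hillA ε μ E' ^ 2 =
      (E' - E) ^ 2 * (solJ ε μ 1 0 1 0 E E' 1 * solJ ε μ 0 1 0 1 E E' 1) := by
  have d := hill_det h hs E
  have d' := hill_det h hs E'
  have l1 := hill_lagrange_B h hs E E'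
  have l2 := hill_lagrange_C h E E'
  rw [hb] at d l1
  rw [hc] at l2
  simp only [zero_mul, sub_zero] at d l1 l2
  have : (hillA ε μ E * hillB ε μ E') * (hillA ε μ E * hillC ε μ E') =
    hillB ε μ E' * hillC ε μ E' := by linear_combination (hillB ε μ E' * hillC ε μ E') * d
  rw [l1, l2] at this
  linear_combination this - d'

/-- The monodromy matrix is plus or minus the identity. By `one_sub_hillA_sq`, |A| < 1 on both
sides, so the neighbouring bands touch. -/
theorem edges_of_zero {n : ℕ} (hc : hillC ε μ (hillDelta ε μ (n + 1)) = 0) :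
    bandHi ε μ n = hillDelta ε μ (n + 1) ∧ bandLo ε μ (n + 1) = hillDelta ε μ (n + 1) := by
  have hb := hillB_delta h hs (n := n + 1) (by omega)
  set E := hillDelta ε μ (n + 1)
  have e1 : ∀ᶠ E' in 𝓝 E, 0 < solJ ε μ 1 0 1 0 E E' 1 :=
    (continuous_solJ_right h.coef_ε h.coef_μ 1 0 1 0 E 1).eventually_const_lt
      (solJ_pos h (by simp) E one_pos)
  have e2 : ∀ᶠ E' in 𝓝 E, 0 < solJ ε μ 0 1 0 1 E E' 1 :=
    (continuous_solJ_right h.coef_ε h.coef_μ 0 1 0 1 E 1).eventually_const_lt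
      (solJ_pos h (by simp) E one_pos)
  have e3 : ∀ᶠ E' in 𝓝 E, E' ≠ E → (-1) ^ (n + 1) * hillA ε μ E' < 1 := by
    filter_upwards [e1, e2] with E' h1 h2 hne
    have h3 := one_sub_hillA_sq h hs hb hc E'
    have h4 : 0 < (E' - E) ^ 2 := by have := sub_ne_zero.2 hne; positivity
    have h5 := mul_pos h4 (mul_pos h1 h2)
    have h6 : |hillA ε μ E'| < 1 := by rw [← sq_lt_one_iff_abs_lt_one]; linarith
    rw [← abs_neg_one_pow_mul (n + 1)] at h6
    exact (abs_lt.1 h6).2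
  constructor
  · refine hi_eq_delta_of_eventually h hs ?_
    filter_upwards [e3.filter_mono nhdsWithin_le_nhds, self_mem_nhdsWithin] with x h1 h2
    exact h1 (ne_of_lt h2)
  · refine lo_eq_delta_of_eventually h hs ?_
    filter_upwards [e3.filter_mono nhdsWithin_le_nhds, self_mem_nhdsWithin] with x h1 h2
    exact h1 (ne_of_gt h2)

/-- Locate the energy in the sequence `hillDelta`. In the interior of an interval `band_spec`
decides; at a positive term of the sequence the sign of C tells which band has it as an edge. -/
theorem exists_band_of_abs_hillA_le {E : ℝ} (hE : |hillA ε μ E| ≤ 1) :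
    ∃ n, E ∈ Set.Icc (bandLo ε μ n) (bandHi ε μ n) := by
  have hE0 : 0 ≤ E := by
    by_contra! hlt
    exact absurd (one_lt_hillA h hs hlt) (not_lt.2 (abs_le.1 hE).2)
  obtain ⟨N, hN⟩ := exists_lt_hillDelta h hs E
  have hex : ∃ n, E < hillDelta ε μ (n + 1) := ⟨N, hN.trans (strictMono_hillDelta h hs N.lt_succ_self)⟩
  classical
  have hn := Nat.find_spec hex
  have hmin := fun m => Nat.find_min hex (m := m)
  set n := Nat.find hex
  have hle : hillDelta ε μ n ≤ E := by
    rcases Nat.eq_zero_or_pos n with h0 | h0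
    · rw [h0, hillDelta_zero]; exact hE0
    · have := hmin (n - 1) (by omega)
      rw [Nat.sub_add_cancel h0] at this
      exact not_lt.1 this
  rcases hle.eq_or_lt with heq | hlt
  · rcases Nat.eq_zero_or_pos n with h0 | h0
    · refine ⟨0, ?_⟩
      rw [bandLo_zero h hs, ← heq, h0, hillDelta_zero]
      refine ⟨le_rfl, ?_⟩
      have := lo_lt_hi h hs 0
      rw [bandLo_zero h hs] at this
      exact this.le
    · obtain ⟨m, hm⟩ := Nat.exists_eq_add_of_lt h0
      rw [zero_add] at hm
      rw [← heq, hm]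
      rcases lt_trichotomy ((-1) ^ (m + 1) * hillC ε μ (hillDelta ε μ (m + 1))) 0 with hc | hc | hc
      · refine ⟨m + 1, ?_⟩
        rw [← (edges_of_neg h hs hc).2]
        exact ⟨le_rfl, (lo_lt_hi h hs _).le⟩
      · refine ⟨m, ?_⟩
        have hc' : hillC ε μ (hillDelta ε μ (m + 1)) = 0 := by
          have hne : ((-1 : ℝ) ^ (m + 1)) ≠ 0 := by positivity
          exact (mul_eq_zero.1 hc).resolve_left hne
        rw [← (edges_of_zero h hs hc').1]
        exact ⟨(lo_lt_hi h hs _).le, le_rfl⟩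
      · refine ⟨m, ?_⟩
        rw [← (edges_of_pos h hs hc).1]
        exact ⟨(lo_lt_hi h hs _).le, le_rfl⟩
  · obtain ⟨-, -, -, -, -, -, h1, h2⟩ := band_spec h hs n
    rw [← abs_neg_one_pow_mul n, abs_le] at hE
    refine ⟨n, ?_, ?_⟩
    · by_contra! hc
      linarith [h1 E ⟨hlt, hc⟩]
    · by_contra! hc
      linarith [h2 E ⟨hc, hn⟩]

end Bands

end Photonic


namespace Photonic

/-! ### Bloch modes and the dispersion relation -/

/-! ### Complex solutions as combinations of the real fundamental pair -/

section Complex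

variable {ε μ : ℝ → ℝ}

theorem isSolution_iff (hε : Coef ε) (hμ : Coef μ) {E : ℝ} {ψ p : ℝ → ℂ} :
    IsSolution ε μ E ψ p ↔ Sol μ (fun t => E * ε t) ψ p := by
  have key : ∀ x y, ∫ t in x..y, (E * ε t) • ψ t = (E : ℂ) * ∫ t in x..y, (ε t : ℂ) * ψ t := by
    intro x y
    rw [← intervalIntegral.integral_const_mul]
    congr 1; funext t
    rw [Complex.real_smul]; push_cast; ring
  constructor
  · intro h
    refine ⟨h.continuous_ψ, h.continuous_p, fun x y => ?_, fun x y => ?_⟩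
    · have i := fun x y => hμ.intervalIntegrable_smul h.continuous_p x y
      simp only [Complex.real_smul] at i ⊢
      rw [h.eq_ψ y, h.eq_ψ x, add_sub_add_left_eq_sub]
      exact intervalIntegral.integral_interval_sub_left (i _ _) (i _ _)
    · have i := fun x y => hε.intervalIntegrable_smul h.continuous_ψ x y
      simp only [Complex.real_smul] at i
      rw [key, h.eq_p y, h.eq_p x, sub_sub_sub_cancel_left, ← mul_sub, ← neg_sub, mul_neg]
      rw [intervalIntegral.integral_interval_sub_left (i _ _) (i _ _)]
  · intro h
    refine ⟨h.continuous_u, h.continuous_p, fun x => ?_, fun x => ?_⟩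
    · have := h.eq_u 0 x
      simp only [Complex.real_smul] at this
      rw [← this]; ring
    · have := h.eq_p 0 x
      rw [key] at this
      rw [sub_eq_add_neg, ← this]; ring

theorem sol_combination (hε : Coef ε) (hμ : Coef μ) (E : ℝ) (A B : ℂ) :
    Sol μ (fun t => E * ε t) (fun x => A * solU ε μ 1 0 E x + B * solU ε μ 0 1 E x)
      (fun x => A * solP ε μ 1 0 E x + B * solP ε μ 0 1 E x) := by
  have he := hε.const_mul E
  exact Sol.add hμ he
    (((sol_solU hε hμ 1 0 E).map hμ he Complex.ofRealCLM).const_mul hμ he A)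
    (((sol_solU hε hμ 0 1 E).map hμ he Complex.ofRealCLM).const_mul hμ he B)

theorem sol_complex_repr (hε : Coef ε) (hμ : Coef μ) {E : ℝ} {ψ p : ℝ → ℂ}
    (h : Sol μ (fun t => E * ε t) ψ p) (x : ℝ) :
    ψ x = ψ 0 * solU ε μ 1 0 E x + p 0 * solU ε μ 0 1 E x ∧
      p x = ψ 0 * solP ε μ 1 0 E x + p 0 * solP ε μ 0 1 E x := by
  have := h.repr_self hε hμ x
  simp only [Complex.real_smul] at this
  constructor
  · rw [this.1]; ring
  · rw [this.2]; ring

theorem initialSolution_eq (hε : Coef ε) (hμ : Coef μ) (E : ℝ) (a b : ℂ) :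
    initialSolution ε μ E a b = fun x => a * solU ε μ 1 0 E x + b * solU ε μ 0 1 E x := by
  have hex : ∃ ψ p, IsSolution ε μ E ψ p ∧ ψ 0 = a ∧ p 0 = b :=
    ⟨_, _, (isSolution_iff hε hμ).2 (sol_combination hε hμ E a b),
      by simp [solU_zero hε hμ], by simp [solP_zero hε hμ]⟩
  obtain ⟨p, hS, h0, h1⟩ := Classical.epsilon_spec hex
  funext x
  have := (sol_complex_repr hε hμ ((isSolution_iff hε hμ).1 hS) x).1
  rw [h0, h1] at this
  exact this

theorem fund₁_eq (hε : Coef ε) (hμ : Coef μ) (E x : ℝ) : fund₁ ε μ E x = solU ε μ 1 0 E x := by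
  rw [fund₁, initialSolution_eq hε hμ]; simp

theorem fund₂_eq (hε : Coef ε) (hμ : Coef μ) (E x : ℝ) : fund₂ ε μ E x = solU ε μ 0 1 E x := by
  rw [fund₂, initialSolution_eq hε hμ]; simp

end Complex

section Bloch

variable {ε μ : ℝ → ℝ} (h : IsPeriodicStructure ε μ) (hs : IsInversionSymmetric ε μ)
include h

/-- The Bloch condition is imposed on ψ alone; applied to ψ(x+1) - zψ(x), this lemma gives it for
the flux in `flux_bloch`. -/
theorem flux_eq_zero {e : ℝ → ℝ} {p : ℝ → ℂ} (hS : Sol μ e (fun _ => 0) p) (x : ℝ) : p x = 0 := by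
  have hc : ∀ t, p t = p x := fun t => by
    have := hS.eq_p x t
    simp only [smul_zero, intervalIntegral.integral_zero, neg_zero] at this
    exact sub_eq_zero.1 this
  have h1 := hS.eq_u 0 1
  simp only [hc, sub_self, intervalIntegral.integral_smul_const] at h1
  have h2 := integral_mul_pos h.coef_μ (g := fun _ => 1) continuous_const
    (fun x _ => h.μ_pos x) (fun _ => zero_le_one) (x₀ := 1 / 2) (a := 0) (b := 1)
    ⟨by norm_num, by norm_num⟩ one_pos
  simp only [mul_one] at h2
  exact (smul_eq_zero.1 h1.symm).resolve_left h2.ne'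

theorem Sol.shift_one {E : ℝ} {ψ p : ℝ → ℂ} (hS : Sol μ (fun t => E * ε t) ψ p) :
    Sol μ (fun t => E * ε t) (fun x => ψ (x + 1)) (fun x => p (x + 1)) := by
  have := hS.comp_add 1
  simp only [h.μ_periodic _, h.ε_periodic _] at this
  exact this

theorem flux_bloch {E : ℝ} {ψ p : ℝ → ℂ} (hS : Sol μ (fun t => E * ε t) ψ p) {z : ℂ}
    (hz : ∀ x, ψ (x + 1) = z * ψ x) (x : ℝ) : p (x + 1) = z * p x := by
  have he := h.coef_ε.const_mul E
  have h1 := Sol.add h.coef_μ he (hS.shift_one h) (hS.const_mul h.coef_μ he (-z))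
  have h2 : (fun x => ψ (x + 1) + -z * ψ x) = fun _ => (0 : ℂ) := by
    funext x; rw [hz]; ring
  rw [h2] at h1
  have := flux_eq_zero h h1 x
  linear_combination this

include hs

/-- By uniqueness the Bloch condition need only hold for the initial data: the two equations are the
rows of the eigenvalue problem of the monodromy matrix for the eigenvalue e^{ik}. -/
theorem isBlochMode_iff {k E : ℝ} {ψ : ℝ → ℂ} : IsBlochMode ε μ k E ψ ↔ ∃ A B : ℂ,
    (∀ x, ψ x = A * solU ε μ 1 0 E x + B * solU ε μ 0 1 E x) ∧
    hillB ε μ E * B = (Complex.exp (Complex.I * k) - hillA ε μ E) * A ∧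
    hillC ε μ E * A = (Complex.exp (Complex.I * k) - hillA ε μ E) * B := by
  have hε := h.coef_ε
  have hμ := h.coef_μ
  constructor
  · rintro ⟨⟨p, hS⟩, hz⟩
    have hS' := (isSolution_iff hε hμ).1 hS
    have hp := flux_bloch h hS' hz 0
    have hψ := hz 0
    have r := sol_complex_repr hε hμ hS'
    rw [zero_add, (r 1).1] at hψ
    rw [zero_add, (r 1).2, hill_p₂ h hs] at hp
    refine ⟨ψ 0, p 0, fun x => (r x).1, ?_, ?_⟩
    · rw [hillA, hillB]; linear_combination hψ
    · rw [hillC]; linear_combination hp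
  · rintro ⟨A, B, hψ, e1, e2⟩
    have hS := sol_combination hε hμ E A B
    have hψ' : ψ = fun x => A * solU ε μ 1 0 E x + B * solU ε μ 0 1 E x := funext hψ
    refine ⟨⟨_, (isSolution_iff hε hμ).2 (hψ' ▸ hS)⟩, fun x => ?_⟩
    have r := (sol_complex_repr hε hμ (hS.shift_one h) x).1
    simp only [zero_add, hill_p₂ h hs] at r
    rw [hψ, hψ, r]
    rw [hillA, hillB] at e1
    rw [hillC] at e2
    have e1' : A * solU ε μ 1 0 E 1 + B * solU ε μ 0 1 E 1 = Complex.exp (Complex.I * k) * A := by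
      linear_combination e1
    have e2' : A * solP ε μ 1 0 E 1 + B * hillA ε μ E = Complex.exp (Complex.I * k) * B := by
      linear_combination e2
    rw [e1', e2']
    ring

omit h hs in
theorem exp_sub_cos (k : ℝ) : Complex.exp (Complex.I * k) - (Real.cos k : ℝ) =
    Complex.I * (Real.sin k : ℝ) := by
  rw [mul_comm, Complex.exp_mul_I]
  push_cast
  ring

/-- An eigenvalue z = e^{ik} satisfies (z - A)² = BC = A² - 1, that is, z + 1/z = 2A. -/
theorem hillA_eq_cos_of_bloch {k E : ℝ} {ψ : ℝ → ℂ} (hψ : IsBlochMode ε μ k E ψ) (hne : ψ ≠ 0) :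
    hillA ε μ E = Real.cos k := by
  obtain ⟨A, B, hf, e1, e2⟩ := (isBlochMode_iff h hs).1 hψ
  set z := Complex.exp (Complex.I * k) with hz
  have hd : (hillA ε μ E : ℂ) ^ 2 - hillB ε μ E * hillC ε μ E = 1 := by
    exact_mod_cast congrArg (fun x : ℝ => (x : ℂ)) (hill_det h hs E)
  have hAB : A ≠ 0 ∨ B ≠ 0 := by
    by_contra! hc
    exact hne (funext fun x => by rw [hf, hc.1, hc.2]; simp)
  have hsq : (z - hillA ε μ E) ^ 2 = hillB ε μ E * hillC ε μ E := by
    rcases hAB with h0 | h0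
    · refine mul_right_cancel₀ h0 ?_
      linear_combination (-hillB ε μ E : ℂ) * e2 - (z - hillA ε μ E) * e1
    · refine mul_right_cancel₀ h0 ?_
      linear_combination (-hillC ε μ E : ℂ) * e1 - (z - hillA ε μ E) * e2
  have hzz : z * Complex.exp (-(Complex.I * k)) = 1 := by rw [hz, ← Complex.exp_add]; simp
  have h2 : (hillA ε μ E : ℂ) = Complex.cos k := by
    rw [Complex.cos, mul_comm (k : ℂ), neg_mul, mul_comm (k : ℂ), ← hz]
    linear_combination (-1 / 2 : ℂ) * Complex.exp (-(Complex.I * k)) * (hsq - hd) -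
      ((hillA ε μ E : ℂ) - z / 2) * hzz
  exact_mod_cast h2

omit hs in
-- Self-adjointness: in Lagrange's identity with the conjugate of `χ` the boundary terms cancel
-- because |e^{ik}| = 1.
theorem innerX_bloch_eq_zero {k E E' : ℝ} {ψ χ : ℝ → ℂ} (hψ : IsBlochMode ε μ k E ψ)
    (hχ : IsBlochMode ε μ k E' χ) (hE : E ≠ E') : innerX ε ψ χ = 0 := by
  have hε := h.coef_ε
  have hμ := h.coef_μ
  obtain ⟨⟨p, hS⟩, hz⟩ := hψ
  obtain ⟨⟨q, hT⟩, hw⟩ := hχ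
  have hS' := (isSolution_iff hε hμ).1 hS
  have hT' := (isSolution_iff hε hμ).1 hT
  have hp := flux_bloch h hS' hz 0
  have hq := flux_bloch h hT' hw 0
  have l := hS'.lagrange (hT'.map hμ (hε.const_mul E') Complex.conjCLE.toContinuousLinearMap) hμ
    (hε.const_mul E) hμ (hε.const_mul E') (x := 0) (y := 1) (fun _ _ => rfl)
  have hz0 := hz 0
  have hw0 := hw 0
  have hu : Complex.exp (Complex.I * k) * (starRingEnd ℂ) (Complex.exp (Complex.I * k)) = 1 := by
    rw [← Complex.exp_conj, ← Complex.exp_add]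
    simp
  simp only [zero_add] at hz0 hw0 hp hq
  have e1 : (starRingEnd ℂ) (χ 1) = (starRingEnd ℂ) (Complex.exp (Complex.I * k)) *
      (starRingEnd ℂ) (χ 0) := by rw [hw0, map_mul]
  have e2 : (starRingEnd ℂ) (q 1) = (starRingEnd ℂ) (Complex.exp (Complex.I * k)) *
      (starRingEnd ℂ) (q 0) := by rw [hq, map_mul]
  simp only [ContinuousLinearEquiv.coe_coe, Complex.conjCLE_apply] at l
  rw [hz0, hp, e1, e2] at l
  have l2 : ∫ t in (0 : ℝ)..1, (E * ε t - E' * ε t) • (ψ t * (starRingEnd ℂ) (χ t)) =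
      ((E : ℂ) - E') * innerX ε ψ χ := by
    rw [innerX, ← intervalIntegral.integral_const_mul]
    congr 1; funext t
    rw [Complex.real_smul]; push_cast; ring
  rw [l2] at l
  have l3 : ((E : ℂ) - E') * innerX ε ψ χ = 0 := by
    rw [← l]
    linear_combination (ψ 0 * (starRingEnd ℂ) (q 0) - p 0 * (starRingEnd ℂ) (χ 0)) * hu
  refine (mul_eq_zero.1 l3).resolve_left ?_
  exact sub_ne_zero.2 (by exact_mod_cast hE)

/-- The derivative of A taken from the first diagonal entry is A times this mixed integral when B =
0; the averaged formula gives 0 when B = C = 0, and A is not zero. -/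
theorem solJ_cross_eq_zero {E : ℝ} (hb : hillB ε μ E = 0) (hc : hillC ε μ E = 0) :
    solJ ε μ 1 0 0 1 E E 1 = 0 := by
  have d1 := (hasDerivAt_sol_energy h.coef_ε h.coef_μ 1 0 E 1).1
  change HasDerivAt (hillA ε μ) (hillA ε μ E * _ - hillB ε μ E * _) E at d1
  have := d1.unique (hasDerivAt_hillA h hs E)
  have hd := hill_det h hs E
  rw [hb, hc] at this
  rw [hb] at hd
  have ha : hillA ε μ E ≠ 0 := by intro h0; rw [h0] at hd; norm_num at hd
  have hsym : solJ ε μ 0 1 1 0 E E 1 = solJ ε μ 1 0 0 1 E E 1 := by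
    simp only [solJ, mul_comm (solU ε μ 0 1 E _)]
  rw [hsym] at this
  simp only [zero_mul, sub_zero, zero_div] at this
  exact (mul_eq_zero.1 this).resolve_left ha

omit h hs in
-- The real and imaginary parts are real solutions, and at least one has nonzero initial data.
theorem normSq_integral_pos (h : IsPeriodicStructure ε μ) (E : ℝ) {A B : ℂ}
    (hAB : A ≠ 0 ∨ B ≠ 0) : 0 < ∫ t in (0 : ℝ)..1,
      ε t * ‖A * solU ε μ 1 0 E t + B * solU ε μ 0 1 E t‖ ^ 2 := by
  have hε := h.coef_ε
  have hμ := h.coef_μ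
  have hS := sol_combination hε hμ E A B
  have hc : Continuous fun t => ‖A * solU ε μ 1 0 E t + B * solU ε μ 0 1 E t‖ ^ 2 :=
    hS.continuous_u.norm.pow 2
  have comp : ∀ a b : ℝ, (a ≠ 0 ∨ b ≠ 0) →
      (∀ t, ‖A * solU ε μ 1 0 E t + B * solU ε μ 0 1 E t‖ ^ 2 ≥ solU ε μ a b E t ^ 2) →
      0 < ∫ t in (0 : ℝ)..1, ε t * ‖A * solU ε μ 1 0 E t + B * solU ε μ 0 1 E t‖ ^ 2 := by
    intro a b hab hle
    refine (solJ_pos h hab E one_pos).trans_le ?_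
    have cu := (sol_solU hε hμ a b E).continuous_u
    refine intervalIntegral.integral_mono_on zero_le_one
      (hε.intervalIntegrable_mul (cu.mul cu) _ _) (hε.intervalIntegrable_mul hc _ _)
      fun t _ => mul_le_mul_of_nonneg_left ?_ (h.ε_pos t).le
    rw [← sq]; exact hle t
  have split : ∀ t, solU ε μ A.re B.re E t = A.re * solU ε μ 1 0 E t + B.re * solU ε μ 0 1 E t ∧
      solU ε μ A.im B.im E t = A.im * solU ε μ 1 0 E t + B.im * solU ε μ 0 1 E t := by
    intro t
    have r1 := ((sol_solU hε hμ A.re B.re E).repr_self hε hμ t).1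
    have r2 := ((sol_solU hε hμ A.im B.im E).repr_self hε hμ t).1
    rw [solU_zero hε hμ, solP_zero hε hμ] at r1 r2
    simp only [smul_eq_mul] at r1 r2
    constructor <;> linarith
  have nsq : ∀ t, ‖A * solU ε μ 1 0 E t + B * solU ε μ 0 1 E t‖ ^ 2 =
      solU ε μ A.re B.re E t ^ 2 + solU ε μ A.im B.im E t ^ 2 := by
    intro t
    rw [(split t).1, (split t).2, Complex.sq_norm, Complex.normSq_apply]
    simp
    ring
  by_cases h1 : A.re ≠ 0 ∨ B.re ≠ 0
  · exact comp _ _ h1 fun t => by rw [nsq]; nlinarith [sq_nonneg (solU ε μ A.im B.im E t)]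
  · refine comp A.im B.im ?_ fun t => by rw [nsq]; nlinarith [sq_nonneg (solU ε μ A.re B.re E t)]
    push Not at h1
    rcases hAB with h2 | h2
    · left; intro h3; exact h2 (Complex.ext h1.1 h3)
    · right; intro h3; exact h2 (Complex.ext h1.2 h3)

omit h hs in
theorem innerX_self (ε : ℝ → ℝ) (u : ℝ → ℂ) :
    innerX ε u u = ((∫ t in (0 : ℝ)..1, ε t * ‖u t‖ ^ 2 : ℝ) : ℂ) := by
  rw [innerX, ← intervalIntegral.integral_ofReal]
  congr 1; funext t
  rw [mul_assoc, Complex.mul_conj, Complex.normSq_eq_norm_sq]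
  push_cast; ring

/-- Bands overlap at most in a shared edge, and only neighbours can do so. The common value is
squeezed onto `hillDelta`, where C ≠ 0 would open a gap. -/
theorem degenerate_of_bandFn_eq {t : ℝ} (ht : |t| ≤ 1) {i j : ℕ} (hij : i < j)
    (heq : bandFn ε μ i t = bandFn ε μ j t) : j = i + 1 ∧
      bandFn ε μ i t = hillDelta ε μ (i + 1) ∧ hillB ε μ (hillDelta ε μ (i + 1)) = 0 ∧
      hillC ε μ (hillDelta ε μ (i + 1)) = 0 := by
  have m1 := bandFn_mem h hs i ht
  have m2 := bandFn_mem h hs j ht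
  have hlo : Monotone (bandLo ε μ) := monotone_nat_of_le_succ fun n =>
    (lo_lt_hi h hs n).le.trans (hi_le_lo h hs n)
  have hj : j = i + 1 := by
    by_contra hne
    have h1 : bandLo ε μ (i + 2) ≤ bandLo ε μ j := hlo (by omega)
    have h2 := lo_lt_hi h hs (i + 1)
    have h3 := hi_le_lo h hs (i + 1)
    have h4 := hi_le_lo h hs i
    linarith [m1.2, m2.1]
  subst hj
  have h3 := hi_le_delta h hs i
  have h4 := delta_le_lo h hs (i + 1)
  refine ⟨rfl, by linarith [m1.2, m2.1], hillB_delta h hs (by omega), ?_⟩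
  by_contra hc
  have hne : ((-1 : ℝ) ^ (i + 1)) ≠ 0 := by positivity
  rcases lt_or_gt_of_ne (mul_ne_zero hne hc) with h5 | h5
  · have := (edges_of_neg h hs h5).1
    linarith [m1.2, m2.1]
  · have := (edges_of_pos h hs h5).2
    linarith [m1.2, m2.1]

/-- Here A² = 1, so the energy belongs to a band; B has no zero inside the interval of that band,
nor at energy zero. -/
theorem eq_delta_of_degenerate {E : ℝ} (hb : hillB ε μ E = 0) (hc : hillC ε μ E = 0) :
    ∃ m, E = hillDelta ε μ (m + 1) ∧ E = bandHi ε μ m ∧ E = bandLo ε μ (m + 1) := by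
  have hd := hill_det h hs E
  rw [hb, zero_mul, sub_zero] at hd
  obtain ⟨n, hn⟩ := exists_band_of_abs_hillA_le h hs (E := E)
    (by rw [← sq_le_one_iff_abs_le_one]; exact hd.le)
  have key : ∃ m, E = hillDelta ε μ (m + 1) := by
    rcases ((delta_le_lo h hs n).trans hn.1).eq_or_lt with h1 | h1
    · rcases Nat.eq_zero_or_pos n with h0 | h0
      · rw [h0, hillDelta_zero] at h1
        have := hillB_pos h hs h1.ge
        exact absurd hb this.ne'
      · exact ⟨n - 1, by rw [Nat.sub_add_cancel h0]; exact h1.symm⟩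
    · rcases (hn.2.trans (hi_le_delta h hs n)).eq_or_lt with h2 | h2
      · exact ⟨n, h2⟩
      · have := hillB_sign h hs ⟨h1, h2⟩
        rw [hb, mul_zero] at this
        exact absurd this (lt_irrefl _)
  obtain ⟨m, hm⟩ := key
  have := edges_of_zero h hs (hm ▸ hc)
  exact ⟨m, hm, hm.trans this.1.symm, hm.trans this.2.symm⟩

/-- One mode per band, mutually orthogonal and spanning: this is what counting eigenvalues with
multiplicity needs. -/
theorem exists_modes (k : ℝ) : ∃ v : ℕ → ℝ → ℂ,
    (∀ n, IsBlochMode ε μ k (bandFn ε μ n (Real.cos k)) (v n)) ∧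
    (∀ n, innerX ε (v n) (v n) ≠ 0) ∧ (∀ i j, i ≠ j → innerX ε (v i) (v j) = 0) ∧
    ∀ E ψ, IsBlochMode ε μ k E ψ → ∀ N, (∀ n, bandFn ε μ n (Real.cos k) ≤ E → n < N) →
      ψ ∈ Submodule.span ℂ (v '' Set.Iio N) := by
  classical
  have hk := Real.abs_cos_le_one k
  set t := Real.cos k with ht
  set z : ℂ := Complex.I * (Real.sin k : ℝ) with hz
  have hzE : ∀ E, hillA ε μ E = t → Complex.exp (Complex.I * k) - hillA ε μ E = z := fun E hE => by
    rw [hE, exp_sub_cos]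
  have hzsq : ∀ E, hillA ε μ E = t → z ^ 2 = hillB ε μ E * hillC ε μ E := fun E hE => by
    have hd := hill_det h hs E
    rw [hE, ht, ← Real.cos_sq_add_sin_sq k] at hd
    have : (hillB ε μ E : ℂ) * hillC ε μ E = -(Real.sin k : ℂ) ^ 2 := by
      have h1 : hillB ε μ E * hillC ε μ E = -Real.sin k ^ 2 := by linarith
      exact_mod_cast congrArg (fun x : ℝ => (x : ℂ)) h1
    rw [this, hz, mul_pow, Complex.I_sq]; ring
  -- Initial value and flux of the mode. When the matrix is scalar, two neighbouring bands share the
  -- energy: the upper one, recognized by `E = hillDelta n`, takes ψ_{E,2} and the lower one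
  -- ψ_{E,1}. Otherwise the eigenspace is a line.
  let P : ℕ → ℂ × ℂ := fun n =>
    let E := bandFn ε μ n t
    if hillB ε μ E = 0 ∧ hillC ε μ E = 0 then
      if E = hillDelta ε μ n then (0, 1) else (1, 0)
    else if hillB ε μ E = 0 then (0, 1) else (hillB ε μ E, z)
  let v : ℕ → ℝ → ℂ := fun n x => (P n).1 * solU ε μ 1 0 (bandFn ε μ n t) x +
    (P n).2 * solU ε μ 0 1 (bandFn ε μ n t) x
  have hA : ∀ n, hillA ε μ (bandFn ε μ n t) = t := fun n => hillA_bandFn h hs n hk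
  have hmode : ∀ n, IsBlochMode ε μ k (bandFn ε μ n t) (v n) := by
    intro n
    refine (isBlochMode_iff h hs).2 ⟨(P n).1, (P n).2, fun x => rfl, ?_⟩
    rw [hzE _ (hA n)]
    have hsq := hzsq _ (hA n)
    by_cases hdeg : hillB ε μ (bandFn ε μ n t) = 0 ∧ hillC ε μ (bandFn ε μ n t) = 0
    · have hz0 : z = 0 := by
        rw [hdeg.1] at hsq
        exact pow_eq_zero_iff two_ne_zero |>.1 (by rw [hsq]; simp)
      rw [hdeg.1, hdeg.2, hz0]; simp
    · by_cases hb : hillB ε μ (bandFn ε μ n t) = 0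
      · have hz0 : z = 0 := by
          rw [hb] at hsq
          exact pow_eq_zero_iff two_ne_zero |>.1 (by rw [hsq]; simp)
        simp only [P]
        rw [if_neg hdeg, if_pos hb, hb, hz0]; simp
      · simp only [P]
        rw [if_neg hdeg, if_neg hb]
        refine ⟨by ring, ?_⟩
        rw [mul_comm, ← hsq, sq]
  have hPne : ∀ n, (P n).1 ≠ 0 ∨ (P n).2 ≠ 0 := by
    intro n
    simp only [P]
    split_ifs with h1 h2 h3
    · right; simp
    · left; simp
    · right; simp
    · left; simpa using h3
  have hdegP : ∀ i, bandFn ε μ i t = hillDelta ε μ (i + 1) →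
      bandFn ε μ (i + 1) t = hillDelta ε μ (i + 1) →
      hillB ε μ (hillDelta ε μ (i + 1)) = 0 → hillC ε μ (hillDelta ε μ (i + 1)) = 0 →
      P i = (1, 0) ∧ P (i + 1) = (0, 1) := by
    intro i h1 h2 hb hc
    have hlt := strictMono_hillDelta h hs i.lt_succ_self
    constructor
    · simp only [P]
      rw [h1, if_pos ⟨hb, hc⟩, if_neg (ne_of_gt hlt)]
    · simp only [P]
      rw [h2, if_pos ⟨hb, hc⟩, if_pos rfl]
  have hcross : ∀ i j, i < j → bandFn ε μ i t = bandFn ε μ j t → innerX ε (v i) (v j) = 0 ∧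
      innerX ε (v j) (v i) = 0 := by
    intro i j hij heq
    obtain ⟨rfl, h1, hb, hc⟩ := degenerate_of_bandFn_eq h hs hk hij heq
    obtain ⟨e1, e2⟩ := hdegP i h1 (heq ▸ h1) hb hc
    have hJ := solJ_cross_eq_zero h hs hb hc
    have hJc : ∫ t in (0 : ℝ)..1, ((ε t * (solU ε μ 1 0 (hillDelta ε μ (i + 1)) t *
        solU ε μ 0 1 (hillDelta ε μ (i + 1)) t) : ℝ) : ℂ) = 0 := by
      rw [intervalIntegral.integral_ofReal]
      exact_mod_cast congrArg (fun x : ℝ => (x : ℂ)) hJ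
    constructor
    · rw [innerX, ← hJc]
      congr 1; funext x
      simp only [v, e1, e2, ← heq, h1]
      simp
      ring
    · rw [innerX, ← hJc]
      congr 1; funext x
      simp only [v, e1, e2, ← heq, h1]
      simp
      ring
  refine ⟨v, hmode, fun n => ?_, fun i j hij => ?_, fun E ψ hψ N hN => ?_⟩
  · rw [innerX_self]
    exact_mod_cast (normSq_integral_pos h _ (hPne n)).ne'
  · by_cases heq : bandFn ε μ i t = bandFn ε μ j t
    · rcases lt_or_gt_of_ne hij with hlt | hlt
      · exact (hcross i j hlt heq).1
      · exact (hcross j i hlt heq.symm).2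
    · exact innerX_bloch_eq_zero h (hmode i) (hmode j) heq
  · by_cases hψ0 : ψ = 0
    · rw [hψ0]; exact Submodule.zero_mem _
    have haE := hillA_eq_cos_of_bloch h hs hψ hψ0
    rw [← ht] at haE
    obtain ⟨A, B, hf, e1, e2⟩ := (isBlochMode_iff h hs).1 hψ
    rw [hzE E haE] at e1 e2
    by_cases hdeg : hillB ε μ E = 0 ∧ hillC ε μ E = 0
    · obtain ⟨m, hm, hm1, hm2⟩ := eq_delta_of_degenerate h hs hdeg.1 hdeg.2
      have E1 : bandFn ε μ m t = E := by
        rw [← haE, hm1]; exact bandFn_hillA h hs ⟨(lo_lt_hi h hs m).le, le_rfl⟩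
      have E2 : bandFn ε μ (m + 1) t = E := by
        rw [← haE, hm2]; exact bandFn_hillA h hs ⟨le_rfl, (lo_lt_hi h hs (m + 1)).le⟩
      obtain ⟨p1, p2⟩ := hdegP m (E1.trans hm) (E2.trans hm) (hm ▸ hdeg.1) (hm ▸ hdeg.2)
      have : ψ = A • v m + B • v (m + 1) := by
        funext x
        simp only [Pi.add_apply, Pi.smul_apply, smul_eq_mul, v, p1, p2, E1, E2, hf]
        ring
      rw [this]
      exact Submodule.add_mem _
        (Submodule.smul_mem _ _ (Submodule.subset_span ⟨m, hN m E1.le, rfl⟩))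
        (Submodule.smul_mem _ _ (Submodule.subset_span ⟨m + 1, hN _ E2.le, rfl⟩))
    · obtain ⟨n, hn⟩ := exists_band_of_abs_hillA_le h hs (haE ▸ hk)
      have E1 : bandFn ε μ n t = E := by rw [← haE]; exact bandFn_hillA h hs hn
      have hmem : v n ∈ Submodule.span ℂ (v '' Set.Iio N) :=
        Submodule.subset_span ⟨n, hN n E1.le, rfl⟩
      by_cases hb : hillB ε μ E = 0
      · have hcne : (hillC ε μ E : ℂ) ≠ 0 := by
          intro hc; exact hdeg ⟨hb, by exact_mod_cast hc⟩
        have hz0 : z = 0 := by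
          have hsq := hzsq E haE
          rw [hb] at hsq
          exact pow_eq_zero_iff two_ne_zero |>.1 (by rw [hsq]; simp)
        have hA0 : A = 0 := by
          rw [hz0, zero_mul] at e2
          exact (mul_eq_zero.1 e2).resolve_left hcne
        have hP : P n = (0, 1) := by
          simp only [P]
          rw [E1, if_neg hdeg, if_pos hb]
        have : ψ = B • v n := by
          funext x
          simp only [Pi.smul_apply, smul_eq_mul, v, hP, E1, hf, hA0]
          ring
        rw [this]
        exact Submodule.smul_mem _ _ hmem
      · have hbne : (hillB ε μ E : ℂ) ≠ 0 := by exact_mod_cast hb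
        have hP : P n = ((hillB ε μ E : ℂ), z) := by
          simp only [P]
          rw [E1, if_neg hdeg, if_neg hb]
        have : ψ = (A / hillB ε μ E) • v n := by
          funext x
          simp only [Pi.smul_apply, smul_eq_mul, v, hP, E1, hf]
          field_simp
          linear_combination (solU ε μ 0 1 E x : ℂ) * e1
        rw [this]
        exact Submodule.smul_mem _ _ hmem

omit h hs in
theorem IsBlochMode.continuous {k E : ℝ} {ψ : ℝ → ℂ} (hψ : IsBlochMode ε μ k E ψ) :
    Continuous ψ := by
  obtain ⟨⟨p, hS⟩, -⟩ := hψ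
  exact hS.continuous_ψ

/-- The dispersion relation. -/
theorem bandEnergy_eq (n : ℕ) (k : ℝ) :
    bandEnergy ε μ (n + 1) k = bandFn ε μ n (Real.cos k) := by
  have hk := Real.abs_cos_le_one k
  obtain ⟨v, hmode, hne, horth, hspan⟩ := exists_modes h hs k
  have hmono := monotone_bandFn h hs hk
  have hset : {lam : ℝ | ((n + 1 : ℕ) : Cardinal) ≤
      Module.rank ℂ (Submodule.span ℂ {ψ : ℝ → ℂ | ∃ E ≤ lam, IsBlochMode ε μ k E ψ})} =
      Set.Ici (bandFn ε μ n (Real.cos k)) := by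
    ext lam
    simp only [Set.mem_ofPred_eq, Set.mem_Ici]
    constructor
    · intro hrank
      by_contra! hlt
      -- Below the energy of mode `n` only the modes with smaller index are available, which bounds
      -- the rank by `n`.
      have hsub : Submodule.span ℂ {ψ : ℝ → ℂ | ∃ E ≤ lam, IsBlochMode ε μ k E ψ} ≤
          Submodule.span ℂ (v '' Set.Iio n) := by
        refine Submodule.span_le.2 ?_
        rintro ψ ⟨E, hE, hψ⟩
        refine hspan E ψ hψ n fun m hm => ?_
        by_contra! hnm
        exact absurd ((hmono hnm).trans (hm.trans hE)) (not_le.2 hlt)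
      have h1 := Submodule.rank_mono hsub
      have h2 : Module.rank ℂ (Submodule.span ℂ (v '' Set.Iio n)) ≤ n := by
        refine (rank_span_le _).trans ?_
        refine Cardinal.mk_image_le.trans ?_
        simp
      have h3 := hrank.trans (h1.trans h2)
      have : n + 1 ≤ n := by exact_mod_cast h3
      omega
    · intro hle
      set W := Submodule.span ℂ {ψ : ℝ → ℂ | ∃ E ≤ lam, IsBlochMode ε μ k E ψ}
      let w : Fin (n + 1) → W := fun i => ⟨v i, Submodule.subset_span
        ⟨_, (hmono (Nat.lt_succ_iff.1 i.2)).trans hle, hmode i⟩⟩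
      -- Pairing a vanishing combination with `v j` isolates the `j`-th coefficient by
      -- orthogonality.
      have hli : LinearIndependent ℂ w := by
        rw [Fintype.linearIndependent_iff]
        intro g hg j
        have hg' : ∀ x, ∑ i, g i * v i x = 0 := by
          intro x
          have := congrArg (fun q : W => (q : ℝ → ℂ) x) hg
          simpa [w] using this
        have hsum : ∑ i : Fin (n + 1), g i * innerX ε (v i) (v j) = 0 := by
          have hcv : ∀ i : Fin (n + 1), Continuous fun t => v i t * (starRingEnd ℂ) (v j t) :=
            fun i => ((hmode i).continuous).mul
              (Complex.continuous_conj.comp ((hmode j).continuous))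
          have : ∀ i : Fin (n + 1), g i * innerX ε (v i) (v j) =
              ∫ t in (0 : ℝ)..1, g i * (ε t • (v i t * (starRingEnd ℂ) (v j t))) := by
            intro i
            rw [intervalIntegral.integral_const_mul, innerX]
            congr 2; funext t
            rw [Complex.real_smul]; ring
          rw [Finset.sum_congr rfl fun i _ => this i, ← intervalIntegral.integral_finsetSum
            fun i _ => (h.coef_ε.intervalIntegrable_smul (hcv i) 0 1).const_mul (g i)]
          rw [intervalIntegral.integral_congr (g := fun _ => (0 : ℂ))]
          · simp
          · intro t _
            simp only [Complex.real_smul]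
            have := hg' t
            calc ∑ i : Fin (n + 1), g i * ((ε t : ℂ) * (v i t * (starRingEnd ℂ) (v j t))) =
                (ε t : ℂ) * (starRingEnd ℂ) (v j t) * ∑ i : Fin (n + 1), g i * v i t := by
                  rw [Finset.mul_sum]
                  exact Finset.sum_congr rfl fun i _ => by ring
              _ = 0 := by rw [this, mul_zero]
        rw [Finset.sum_eq_single j] at hsum
        · exact (mul_eq_zero.1 hsum).resolve_right (hne j)
        · intro i _ hij
          rw [horth i j (fun hc => hij (Fin.ext hc)), mul_zero]
        · simp
      have := hli.cardinal_le_rank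
      simpa using this
  rw [bandEnergy, hset, csInf_Ici]

theorem bandUpper_eq (n : ℕ) : bandUpper ε μ (n + 1) = bandHi ε μ n := by
  have hg : IsGreatest (bandEnergy ε μ (n + 1) '' Set.Icc (-π) π) (bandHi ε μ n) := by
    constructor
    · have hc : |(-(-1) ^ n : ℝ)| ≤ 1 := by rw [abs_neg, abs_pow]; simp
      refine ⟨Real.arccos (-(-1) ^ n), ⟨?_, Real.arccos_le_pi _⟩, ?_⟩
      · exact (neg_nonpos.2 Real.pi_pos.le).trans (Real.arccos_nonneg _)
      · rw [bandEnergy_eq h hs, Real.cos_arccos (abs_le.1 hc).1 (abs_le.1 hc).2, bandFn_hi h hs]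
    · rintro _ ⟨k, -, rfl⟩
      rw [bandEnergy_eq h hs]
      exact (bandFn_mem h hs n (Real.abs_cos_le_one k)).2
  exact hg.csSup_eq

theorem bandLower_eq (n : ℕ) : bandLower ε μ (n + 1) = bandLo ε μ n := by
  have hg : IsLeast (bandEnergy ε μ (n + 1) '' Set.Icc (-π) π) (bandLo ε μ n) := by
    constructor
    · have hc : |((-1) ^ n : ℝ)| ≤ 1 := by rw [abs_pow]; simp
      refine ⟨Real.arccos ((-1) ^ n), ⟨?_, Real.arccos_le_pi _⟩, ?_⟩
      · exact (neg_nonpos.2 Real.pi_pos.le).trans (Real.arccos_nonneg _)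
      · rw [bandEnergy_eq h hs, Real.cos_arccos (abs_le.1 hc).1 (abs_le.1 hc).2, bandFn_lo h hs]
    · rintro _ ⟨k, -, rfl⟩
      rw [bandEnergy_eq h hs]
      exact (bandFn_mem h hs n (Real.abs_cos_le_one k)).1
  exact hg.csInf_eq

end Bloch

end Photonic


namespace Photonic

/-! ### The Berry connection and the phase jumps -/

/-- The normalization of `α ψ_{E,1} + i β ψ_{E,2}`. -/
noncomputable def normalizedMode (ε μ : ℝ → ℝ) (α β E x : ℝ) : ℂ :=
  ((α * solU ε μ 1 0 E x : ℝ) + Complex.I * (β * solU ε μ 0 1 E x : ℝ)) /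
    (Real.sqrt (α ^ 2 * solJ ε μ 1 0 1 0 E E 1 + β ^ 2 * solJ ε μ 0 1 0 1 E E 1) : ℝ)

section Modes

variable {ε μ : ℝ → ℝ} (h : IsPeriodicStructure ε μ) (hs : IsInversionSymmetric ε μ)
include h

theorem normalizedMode_denom_pos {α β : ℝ} (hab : α ≠ 0 ∨ β ≠ 0) (E : ℝ) :
    0 < α ^ 2 * solJ ε μ 1 0 1 0 E E 1 + β ^ 2 * solJ ε μ 0 1 0 1 E E 1 := by
  have j1 := solJ_pos h (a := 1) (b := 0) (by simp) E one_pos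
  have j2 := solJ_pos h (a := 0) (b := 1) (by simp) E one_pos
  rcases hab with h0 | h0
  · have : 0 < α ^ 2 := by positivity
    positivity
  · have : 0 < β ^ 2 := by positivity
    positivity

omit h in
-- Allows a positive common factor to be removed before a limit in which both coefficients tend to
-- zero.
theorem normalizedMode_smul {s : ℝ} (hs : 0 < s) (α β E x : ℝ) :
    normalizedMode ε μ (s * α) (s * β) E x = normalizedMode ε μ α β E x := by
  have h1 : (s * α) ^ 2 * solJ ε μ 1 0 1 0 E E 1 + (s * β) ^ 2 * solJ ε μ 0 1 0 1 E E 1 =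
      s ^ 2 * (α ^ 2 * solJ ε μ 1 0 1 0 E E 1 + β ^ 2 * solJ ε μ 0 1 0 1 E E 1) := by ring
  rw [normalizedMode, normalizedMode, h1, Real.sqrt_mul (sq_nonneg s), Real.sqrt_sq hs.le]
  have hs' : (s : ℂ) ≠ 0 := by exact_mod_cast hs.ne'
  rw [Complex.ofReal_mul s (Real.sqrt _)]
  refine Eq.trans ?_ (mul_div_mul_left _ _ hs')
  congr 1
  push_cast
  ring

theorem normalizedMode_tendsto {l : Filter ℝ} {α β e : ℝ → ℝ} {α₀ β₀ E₀ : ℝ}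
    (hα : Tendsto α l (𝓝 α₀)) (hβ : Tendsto β l (𝓝 β₀)) (he : Tendsto e l (𝓝 E₀))
    (hab : α₀ ≠ 0 ∨ β₀ ≠ 0) (x : ℝ) :
    Tendsto (fun k => normalizedMode ε μ (α k) (β k) (e k) x) l
      (𝓝 (normalizedMode ε μ α₀ β₀ E₀ x)) := by
  have hε := h.coef_ε
  have hμ := h.coef_μ
  have u1 := ((continuous_solU_energy hε hμ 1 0 x).tendsto E₀).comp he
  have u2 := ((continuous_solU_energy hε hμ 0 1 x).tendsto E₀).comp he
  have j1 := ((continuous_solJ_diag hε hμ 1 0 1 0 1).tendsto E₀).comp he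
  have j2 := ((continuous_solJ_diag hε hμ 0 1 0 1 1).tendsto E₀).comp he
  refine Tendsto.div ?_ ?_ ?_
  · exact ((Complex.continuous_ofReal.tendsto _).comp (hα.mul u1)).add
      (tendsto_const_nhds.mul ((Complex.continuous_ofReal.tendsto _).comp (hβ.mul u2)))
  · exact (Complex.continuous_ofReal.tendsto _).comp ((Real.continuous_sqrt.tendsto _).comp
      (((hα.pow 2).mul j1).add ((hβ.pow 2).mul j2)))
  · have := Real.sqrt_pos.2 (normalizedMode_denom_pos h hab E₀)
    exact_mod_cast this.ne'

include hs

/-- ψ_{E,1} is even, ψ_{E,2} is odd and carries the factor i, so reflection acts as conjugation. -/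
theorem normalizedMode_neg (α β E x : ℝ) :
    normalizedMode ε μ α β E (-x) = (starRingEnd ℂ) (normalizedMode ε μ α β E x) := by
  rw [normalizedMode, normalizedMode, (sol_parity h hs E x).1, (sol_parity h hs E x).2]
  simp only [map_div₀, map_add, map_mul, Complex.conj_ofReal, Complex.conj_I]
  push_cast
  ring

omit hs in
-- There is no conjugate in the integrand: this mode is real, whereas the one in the next lemma is
-- purely imaginary, hence the opposite sign there.
theorem integral_normalizedMode_sq (E : ℝ) {α : ℝ} (hα : α ≠ 0) :
    ∫ x in (0 : ℝ)..1, (ε x : ℂ) * normalizedMode ε μ α 0 E x * normalizedMode ε μ α 0 E x = 1 := by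
  have j1 := solJ_pos h (a := 1) (b := 0) (by simp) E one_pos
  have hpos : 0 < α ^ 2 * solJ ε μ 1 0 1 0 E E 1 := by positivity
  have hint : ∫ x in (0 : ℝ)..1, (ε x : ℂ) * normalizedMode ε μ α 0 E x *
      normalizedMode ε μ α 0 E x = ((α ^ 2 / (α ^ 2 * solJ ε μ 1 0 1 0 E E 1) *
        solJ ε μ 1 0 1 0 E E 1 : ℝ) : ℂ) := by
    rw [solJ, ← intervalIntegral.integral_const_mul, ← intervalIntegral.integral_ofReal]
    congr 1; funext x
    rw [← solJ, normalizedMode]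
    have hsq := Real.mul_self_sqrt hpos.le
    have hne := (Real.sqrt_pos.2 hpos).ne'
    have e0 : α ^ 2 * solJ ε μ 1 0 1 0 E E 1 + (0 : ℝ) ^ 2 * solJ ε μ 0 1 0 1 E E 1 =
        α ^ 2 * solJ ε μ 1 0 1 0 E E 1 := by ring
    rw [e0]
    set s := Real.sqrt (α ^ 2 * solJ ε μ 1 0 1 0 E E 1)
    rw [← hsq]
    have hne' : (s : ℂ) ≠ 0 := by exact_mod_cast hne
    push_cast
    field_simp
    ring
  rw [hint]
  have : α ^ 2 / (α ^ 2 * solJ ε μ 1 0 1 0 E E 1) * solJ ε μ 1 0 1 0 E E 1 = 1 := by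
    field_simp
  rw [this, Complex.ofReal_one]

omit hs in
theorem integral_normalizedMode_sq' (E : ℝ) :
    ∫ x in (0 : ℝ)..1, (ε x : ℂ) * normalizedMode ε μ 0 1 E x * normalizedMode ε μ 0 1 E x =
      -1 := by
  have hpos := solJ_pos h (a := 0) (b := 1) (by simp) E one_pos
  have hint : ∫ x in (0 : ℝ)..1, (ε x : ℂ) * normalizedMode ε μ 0 1 E x *
      normalizedMode ε μ 0 1 E x = ((-1 / (solJ ε μ 0 1 0 1 E E 1) *
        solJ ε μ 0 1 0 1 E E 1 : ℝ) : ℂ) := by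
    rw [solJ, ← intervalIntegral.integral_const_mul, ← intervalIntegral.integral_ofReal]
    congr 1; funext x
    rw [← solJ, normalizedMode]
    have hsq := Real.mul_self_sqrt hpos.le
    have hne := (Real.sqrt_pos.2 hpos).ne'
    have e0 : (0 : ℝ) ^ 2 * solJ ε μ 1 0 1 0 E E 1 + (1 : ℝ) ^ 2 * solJ ε μ 0 1 0 1 E E 1 =
        solJ ε μ 0 1 0 1 E E 1 := by ring
    rw [e0]
    set s := Real.sqrt (solJ ε μ 0 1 0 1 E E 1)
    rw [← hsq]
    have hne' : (s : ℂ) ≠ 0 := by exact_mod_cast hne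
    push_cast
    field_simp
    ring_nf
    rw [Complex.I_sq]
    ring
  rw [hint, div_mul_cancel₀ _ hpos.ne']
  simp

/-- On the band A = cos k, so e^{ik} - A = i sin k. -/
theorem rawBloch_eq (n : ℕ) (k x : ℝ) : rawBloch ε μ (n + 1) k x =
    (hillB ε μ (bandFn ε μ n (Real.cos k)) * solU ε μ 1 0 (bandFn ε μ n (Real.cos k)) x : ℝ) +
      Complex.I * (Real.sin k * solU ε μ 0 1 (bandFn ε μ n (Real.cos k)) x : ℝ) := by
  have hA := hillA_bandFn h hs n (Real.abs_cos_le_one k)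
  rw [rawBloch, bandEnergy_eq h hs]
  simp only [fund₁_eq h.coef_ε h.coef_μ, fund₂_eq h.coef_ε h.coef_μ]
  have he := exp_sub_cos k
  rw [← hA, hillA] at he
  rw [he, hillB]
  push_cast
  ring

omit h hs in
theorem normX_eq (h : IsPeriodicStructure ε μ) (α β E : ℝ) :
    normX ε (fun x => ((α * solU ε μ 1 0 E x : ℝ) : ℂ) +
      Complex.I * (β * solU ε μ 0 1 E x : ℝ)) =
    Real.sqrt (α ^ 2 * solJ ε μ 1 0 1 0 E E 1 + β ^ 2 * solJ ε μ 0 1 0 1 E E 1) := by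
  have hε := h.coef_ε
  have hμ := h.coef_μ
  have c1 := (sol_solU hε hμ 1 0 E).continuous_u
  have c2 := (sol_solU hε hμ 0 1 E).continuous_u
  rw [normX, solJ, solJ, ← intervalIntegral.integral_const_mul,
    ← intervalIntegral.integral_const_mul]
  congr 1
  refine Eq.trans ?_ (intervalIntegral.integral_add
    ((hε.intervalIntegrable_mul (c1.mul c1) _ _).const_mul _)
    ((hε.intervalIntegrable_mul (c2.mul c2) _ _).const_mul _))
  congr 1; funext x
  rw [Complex.sq_norm, Complex.normSq_apply]
  simp
  ring

theorem rawBloch_eq_zero_iff (n : ℕ) (k : ℝ) : rawBloch ε μ (n + 1) k = 0 ↔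
    hillB ε μ (bandFn ε μ n (Real.cos k)) = 0 ∧ Real.sin k = 0 := by
  constructor
  · intro h0
    by_contra hc
    rw [not_and_or] at hc
    have h1 := normX_eq h (hillB ε μ (bandFn ε μ n (Real.cos k))) (Real.sin k)
      (bandFn ε μ n (Real.cos k))
    have h2 : (fun x => ((hillB ε μ (bandFn ε μ n (Real.cos k)) *
        solU ε μ 1 0 (bandFn ε μ n (Real.cos k)) x : ℝ) : ℂ) +
        Complex.I * (Real.sin k * solU ε μ 0 1 (bandFn ε μ n (Real.cos k)) x : ℝ)) = 0 := by
      rw [← h0]; funext x; rw [rawBloch_eq h hs]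
    rw [h2] at h1
    have h3 := Real.sqrt_pos.2 (normalizedMode_denom_pos h hc (bandFn ε μ n (Real.cos k)))
    rw [← h1] at h3
    simp [normX] at h3
  · rintro ⟨h1, h2⟩
    funext x
    rw [rawBloch_eq h hs, h1, h2]
    simp

theorem blochModeHalf_of_ne {n : ℕ} {k : ℝ}
    (hne : hillB ε μ (bandFn ε μ n (Real.cos k)) ≠ 0 ∨ Real.sin k ≠ 0) (x : ℝ) :
    blochModeHalf ε μ (n + 1) k x = normalizedMode ε μ
      (hillB ε μ (bandFn ε μ n (Real.cos k))) (Real.sin k) (bandFn ε μ n (Real.cos k)) x := by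
  have hr : rawBloch ε μ (n + 1) k ≠ 0 := by
    rw [ne_eq, rawBloch_eq_zero_iff h hs, not_and_or]; exact hne
  have h2 : rawBloch ε μ (n + 1) k = fun x => ((hillB ε μ (bandFn ε μ n (Real.cos k)) *
        solU ε μ 1 0 (bandFn ε μ n (Real.cos k)) x : ℝ) : ℂ) +
        Complex.I * (Real.sin k * solU ε μ 0 1 (bandFn ε μ n (Real.cos k)) x : ℝ) :=
    funext (rawBloch_eq h hs n k)
  rw [blochModeHalf, if_pos hr, h2, normX_eq h, normalizedMode]

theorem blochModeHalf_of_eq {n : ℕ} {k : ℝ}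
    (hb : hillB ε μ (bandFn ε μ n (Real.cos k)) = 0) (hk : Real.sin k = 0) (x : ℝ) :
    blochModeHalf ε μ (n + 1) k x = normalizedMode ε μ 0 1 (bandFn ε μ n (Real.cos k)) x := by
  have hr : ¬ rawBloch ε μ (n + 1) k ≠ 0 := by
    rw [not_not, rawBloch_eq_zero_iff h hs]; exact ⟨hb, hk⟩
  have h2 : normX ε (fund₂ ε μ (bandFn ε μ n (Real.cos k))) =
      Real.sqrt ((0 : ℝ) ^ 2 * solJ ε μ 1 0 1 0 (bandFn ε μ n (Real.cos k))
        (bandFn ε μ n (Real.cos k)) 1 + (1 : ℝ) ^ 2 * solJ ε μ 0 1 0 1 (bandFn ε μ n (Real.cos k))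
        (bandFn ε μ n (Real.cos k)) 1) := by
    rw [← normX_eq h, normX, normX]
    congr 2; funext x
    rw [fund₂_eq h.coef_ε h.coef_μ]
    simp
  rw [blochModeHalf, if_neg hr, bandEnergy_eq h hs, h2, normalizedMode,
    fund₂_eq h.coef_ε h.coef_μ]
  simp

theorem blochModeHalf_neg (n : ℕ) (k x : ℝ) : blochModeHalf ε μ (n + 1) k (-x) =
    (starRingEnd ℂ) (blochModeHalf ε μ (n + 1) k x) := by
  by_cases hne : hillB ε μ (bandFn ε μ n (Real.cos k)) ≠ 0 ∨ Real.sin k ≠ 0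
  · rw [blochModeHalf_of_ne h hs hne, blochModeHalf_of_ne h hs hne, normalizedMode_neg h hs]
  · push Not at hne
    rw [blochModeHalf_of_eq h hs hne.1 hne.2, blochModeHalf_of_eq h hs hne.1 hne.2,
      normalizedMode_neg h hs]

theorem blochModeHalf_add_one {n : ℕ} {k : ℝ} (hk : Real.sin k ≠ 0) (x : ℝ) :
    blochModeHalf ε μ (n + 1) k (x + 1) =
      Complex.exp (Complex.I * k) * blochModeHalf ε μ (n + 1) k x := by
  have hA := hillA_bandFn h hs n (Real.abs_cos_le_one k)
  have hd := hill_det h hs (bandFn ε μ n (Real.cos k))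
  have hmode : IsBlochMode ε μ k (bandFn ε μ n (Real.cos k)) (rawBloch ε μ (n + 1) k) := by
    refine (isBlochMode_iff h hs).2 ⟨hillB ε μ (bandFn ε μ n (Real.cos k)),
      Complex.I * Real.sin k, fun x => ?_, ?_, ?_⟩
    · rw [rawBloch_eq h hs]; push_cast; ring
    · rw [hA, exp_sub_cos]; ring
    · rw [hA, exp_sub_cos]
      rw [hA, ← Real.cos_sq_add_sin_sq k] at hd
      have : ((hillB ε μ (bandFn ε μ n (Real.cos k)) : ℝ) : ℂ) *
          (hillC ε μ (bandFn ε μ n (Real.cos k)) : ℝ) = -(Real.sin k : ℝ) ^ 2 := by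
        rw [← Complex.ofReal_mul, ← Complex.ofReal_pow, ← Complex.ofReal_neg]
        congr 1
        linarith
      linear_combination this - (Real.sin k : ℂ) ^ 2 * Complex.I_sq
  have hr : rawBloch ε μ (n + 1) k ≠ 0 := by
    rw [ne_eq, rawBloch_eq_zero_iff h hs, not_and_or]; exact Or.inr hk
  simp only [blochModeHalf, if_pos hr]
  rw [hmode.2 x, mul_div_assoc]

/-- If B vanishes at the edge, the coefficients B and sin k both tend to zero. Since BC = -sin² k
with C ≠ 0 at the edge, dividing by sin k leaves -sin k / C and 1, so the limit is the normalized
iψ_{E,2}, exactly the exceptional case of the definition. -/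
theorem blochModeHalf_tendsto {n : ℕ} {l : Filter ℝ} {g : ℝ → ℝ} {κ : ℝ} (hg : Tendsto g l (𝓝 κ))
    (hgI : ∀ᶠ k in l, g k ∈ Set.Ioo 0 π) (hκ : Real.sin κ = 0)
    (hnd : ¬ (hillB ε μ (bandFn ε μ n (Real.cos κ)) = 0 ∧
      hillC ε μ (bandFn ε μ n (Real.cos κ)) = 0)) (x : ℝ) :
    Tendsto (fun k => blochModeHalf ε μ (n + 1) (g k) x) l
      (𝓝 (blochModeHalf ε μ (n + 1) κ x)) := by
  have hE : Tendsto (fun k => bandFn ε μ n (Real.cos (g k))) l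
      (𝓝 (bandFn ε μ n (Real.cos κ))) := by
    refine ((continuousOn_bandFn h hs n) _ (Real.abs_cos_le_one κ)).tendsto.comp ?_
    refine tendsto_nhdsWithin_iff.2 ⟨(Real.continuous_cos.tendsto κ).comp hg, ?_⟩
    exact Eventually.of_forall fun k => Real.abs_cos_le_one _
  have hsin : Tendsto (fun k => Real.sin (g k)) l (𝓝 0) := by
    rw [← hκ]; exact (Real.continuous_sin.tendsto κ).comp hg
  have hspos : ∀ᶠ k in l, 0 < Real.sin (g k) :=
    hgI.mono fun k hk => Real.sin_pos_of_pos_of_lt_pi hk.1 hk.2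
  by_cases hb : hillB ε μ (bandFn ε μ n (Real.cos κ)) = 0
  · rw [blochModeHalf_of_eq h hs hb hκ]
    have hc : hillC ε μ (bandFn ε μ n (Real.cos κ)) ≠ 0 := fun hc => hnd ⟨hb, hc⟩
    have hC := ((continuous_hillC h).tendsto _).comp hE
    have hq : Tendsto (fun k => -Real.sin (g k) / hillC ε μ (bandFn ε μ n (Real.cos (g k)))) l
        (𝓝 0) := by
      have := hsin.neg.div hC hc
      rw [neg_zero, zero_div] at this
      exact this
    refine (normalizedMode_tendsto h hq tendsto_const_nhds hE (Or.inr one_ne_zero) x).congr' ?_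
    filter_upwards [hspos, hC.eventually_ne hc] with k hk hck
    rw [blochModeHalf_of_ne h hs (Or.inr hk.ne'), ← normalizedMode_smul hk]
    simp only [Function.comp_apply] at hck
    have hd := hill_det h hs (bandFn ε μ n (Real.cos (g k)))
    rw [hillA_bandFn h hs n (Real.abs_cos_le_one _), ← Real.cos_sq_add_sin_sq (g k)] at hd
    congr 1
    · rw [mul_div_assoc', div_eq_iff hck]; linarith
    · rw [mul_one]
  · rw [blochModeHalf_of_ne h hs (Or.inl hb)]
    have hB := ((continuous_hillB h).tendsto _).comp hE
    rw [← hκ] at hsin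
    refine (normalizedMode_tendsto h hB hsin hE (Or.inl hb) x).congr' ?_
    filter_upwards [hspos] with k hk
    rw [blochModeHalf_of_ne h hs (Or.inr hk.ne')]
    rfl

theorem blochModeZeroLeft_eq {n : ℕ} (hnd : ¬ (hillB ε μ (bandFn ε μ n 1) = 0 ∧
      hillC ε μ (bandFn ε μ n 1) = 0)) (x : ℝ) : blochModeZeroLeft ε μ (n + 1) x =
      (starRingEnd ℂ) (blochMode ε μ (n + 1) 0 x) := by
  have h1 : Tendsto (fun k : ℝ => -k) (𝓝[<] 0) (𝓝 0) := by
    have := (continuous_neg (G := ℝ)).tendsto 0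
    rw [neg_zero] at this
    exact this.mono_left nhdsWithin_le_nhds
  have h2 : ∀ᶠ k in 𝓝[<] (0 : ℝ), -k ∈ Set.Ioo 0 π := by
    filter_upwards [Ioo_mem_nhdsLT (neg_neg_of_pos Real.pi_pos)] with k hk
    exact ⟨neg_pos.2 hk.2, by linarith [hk.1]⟩
  have := blochModeHalf_tendsto h hs (n := n) h1 h2 Real.sin_zero (by rwa [Real.cos_zero]) (-x)
  rw [blochModeHalf_neg h hs] at this
  rw [blochModeZeroLeft, blochMode, if_pos le_rfl]
  refine Tendsto.limUnder_eq (this.congr' ?_)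
  filter_upwards [self_mem_nhdsWithin] with k hk
  rw [blochMode, if_neg (not_le.2 hk)]

theorem blochModeNegPiRight_eq {n : ℕ} (hnd : ¬ (hillB ε μ (bandFn ε μ n (-1)) = 0 ∧
      hillC ε μ (bandFn ε μ n (-1)) = 0)) (x : ℝ) : blochModeNegPiRight ε μ (n + 1) x =
      (starRingEnd ℂ) (blochMode ε μ (n + 1) π x) := by
  have hpi := neg_neg_of_pos Real.pi_pos
  have h1 : Tendsto (fun k : ℝ => -k) (𝓝[>] (-π)) (𝓝 π) := by
    have := (continuous_neg (G := ℝ)).tendsto (-π)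
    rw [neg_neg] at this
    exact this.mono_left nhdsWithin_le_nhds
  have h2 : ∀ᶠ k in 𝓝[>] (-π), -k ∈ Set.Ioo 0 π := by
    filter_upwards [Ioo_mem_nhdsGT hpi] with k hk
    exact ⟨neg_pos.2 hk.2, by linarith [hk.1]⟩
  have := blochModeHalf_tendsto h hs (n := n) h1 h2 Real.sin_pi (by rwa [Real.cos_pi]) (-x)
  rw [blochModeHalf_neg h hs] at this
  rw [blochModeNegPiRight, blochMode, if_pos Real.pi_pos.le]
  refine Tendsto.limUnder_eq (this.congr' ?_)
  filter_upwards [Ioo_mem_nhdsGT hpi] with k hk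
  rw [blochMode, if_neg (not_le.2 hk.2)]

/-- The left limit is the conjugate mode, so the inner product is ∫ ε φ², with φ real or purely
imaginary. -/
theorem inner_zero_jump {n : ℕ} (hnd : ¬ (hillB ε μ (bandFn ε μ n 1) = 0 ∧
      hillC ε μ (bandFn ε μ n 1) = 0)) :
    innerX ε (blochMode ε μ (n + 1) 0) (blochModeZeroLeft ε μ (n + 1)) =
      if hillB ε μ (bandFn ε μ n 1) = 0 then -1 else 1 := by
  rw [innerX]
  simp only [blochModeZeroLeft_eq h hs hnd, Complex.conj_conj, blochMode, if_pos le_rfl]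
  split_ifs with hb
  · simp only [blochModeHalf_of_eq h hs (n := n) (k := 0) (by rwa [Real.cos_zero]) Real.sin_zero]
    exact integral_normalizedMode_sq' h _
  · simp only [blochModeHalf_of_ne h hs (n := n) (k := 0) (Or.inl (by rwa [Real.cos_zero])),
      Real.sin_zero, Real.cos_zero]
    exact integral_normalizedMode_sq h _ hb

theorem inner_pi_jump {n : ℕ} (hnd : ¬ (hillB ε μ (bandFn ε μ n (-1)) = 0 ∧
      hillC ε μ (bandFn ε μ n (-1)) = 0)) :
    innerX ε (blochModeNegPiRight ε μ (n + 1)) (blochMode ε μ (n + 1) π) =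
      if hillB ε μ (bandFn ε μ n (-1)) = 0 then -1 else 1 := by
  have hconj : innerX ε (blochModeNegPiRight ε μ (n + 1)) (blochMode ε μ (n + 1) π) =
      ∫ x in (0 : ℝ)..1, (ε x : ℂ) * blochModeHalf ε μ (n + 1) π (-x) *
        blochModeHalf ε μ (n + 1) π (-x) := by
    rw [innerX]
    simp only [blochModeNegPiRight_eq h hs hnd, blochMode, if_pos Real.pi_pos.le,
      blochModeHalf_neg h hs]
  rw [hconj]
  split_ifs with hb
  · simp only [blochModeHalf_of_eq h hs (n := n) (k := π) (by rwa [Real.cos_pi]) Real.sin_pi]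
    rw [← integral_normalizedMode_sq' h (bandFn ε μ n (-1))]
    congr 1; funext x
    simp only [Real.cos_pi, normalizedMode, (sol_parity h hs _ x).1, (sol_parity h hs _ x).2]
    push_cast
    ring
  · simp only [blochModeHalf_of_ne h hs (n := n) (k := π) (Or.inl (by rwa [Real.cos_pi])),
      Real.sin_pi, Real.cos_pi]
    rw [← integral_normalizedMode_sq h (bandFn ε μ n (-1)) hb]
    congr 1; funext x
    simp only [normalizedMode, (sol_parity h hs _ x).1, (sol_parity h hs _ x).2]
    push_cast
    ring

/-! ### The Berry connection -/

/-- Combines the Bloch condition with conjugation under `x ↦ -x`. -/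
theorem blochPeriodic_reflect {n : ℕ} {k : ℝ} (hk : k ∈ Set.Ioo 0 π) (x : ℝ) :
    blochPeriodic ε μ (n + 1) k (1 - x) =
      (starRingEnd ℂ) (blochPeriodic ε μ (n + 1) k x) := by
  have hsin := (Real.sin_pos_of_pos_of_lt_pi hk.1 hk.2).ne'
  simp only [blochPeriodic, blochMode, if_pos hk.1.le]
  have e1 : (1 : ℝ) - x = -x + 1 := by ring
  rw [e1, blochModeHalf_add_one h hs hsin, blochModeHalf_neg h hs, map_mul, ← Complex.exp_conj,
    ← mul_assoc, ← Complex.exp_add]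
  congr 2
  simp
  ring

theorem blochPeriodic_neg {n : ℕ} {k : ℝ} (hk : 0 < k) (x : ℝ) :
    blochPeriodic ε μ (n + 1) (-k) x = (starRingEnd ℂ) (blochPeriodic ε μ (n + 1) k x) := by
  simp only [blochPeriodic, blochMode, if_pos hk.le, if_neg (not_le.2 (neg_neg_of_pos hk)),
    neg_neg]
  rw [blochModeHalf_neg h hs, map_mul, ← Complex.exp_conj]
  congr 2
  simp

omit h hs in
theorem deriv_conj (f : ℝ → ℂ) (k : ℝ) :
    deriv (fun k => (starRingEnd ℂ) (f k)) k = (starRingEnd ℂ) (deriv f k) := deriv.star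

/-- The two functions of the wavenumber agree nearby, so no differentiability is needed: a missing
derivative is zero on both sides. -/
theorem deriv_blochPeriodic_reflect {n : ℕ} {k : ℝ} (hk : k ∈ Set.Ioo 0 π) (x : ℝ) :
    deriv (fun k' => blochPeriodic ε μ (n + 1) k' (1 - x)) k =
      (starRingEnd ℂ) (deriv (fun k' => blochPeriodic ε μ (n + 1) k' x) k) := by
  rw [← deriv_conj]
  refine EventuallyEq.deriv_eq ?_
  filter_upwards [Ioo_mem_nhds hk.1 hk.2] with k' hk'
  exact blochPeriodic_reflect h hs hk' x

theorem deriv_blochPeriodic_neg {n : ℕ} {k : ℝ} (hk : 0 < k) (x : ℝ) :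
    deriv (fun k' => blochPeriodic ε μ (n + 1) k' x) (-k) =
      -(starRingEnd ℂ) (deriv (fun k' => blochPeriodic ε μ (n + 1) k' x) k) := by
  rw [← deriv_conj]
  have h1 : deriv (fun k' => blochPeriodic ε μ (n + 1) k' x) (-k) =
      deriv (fun k' => (starRingEnd ℂ) (blochPeriodic ε μ (n + 1) (-k') x)) (-k) := by
    refine EventuallyEq.deriv_eq ?_
    filter_upwards [Iio_mem_nhds (neg_neg_of_pos hk)] with k' hk'
    rw [← blochPeriodic_neg h hs (neg_pos.2 hk'), neg_neg]
  rw [h1, deriv_comp_neg (fun k' => (starRingEnd ℂ) (blochPeriodic ε μ (n + 1) k' x)), neg_neg]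

omit h hs in
theorem intervalIntegral_conj (f : ℝ → ℂ) (a b : ℝ) :
    ∫ x in a..b, (starRingEnd ℂ) (f x) = (starRingEnd ℂ) (∫ x in a..b, f x) := by
  simp only [intervalIntegral, integral_conj, map_sub]

/-- The substitution `x ↦ 1 - x` preserves `ε` and conjugates both other factors, so the connection
is real. -/
theorem berryConnection_conj {n : ℕ} {k : ℝ} (hk : k ∈ Set.Ioo 0 π) :
    (starRingEnd ℂ) (berryConnection ε μ (n + 1) k) = berryConnection ε μ (n + 1) k := by
  rw [berryConnection, innerX, ← intervalIntegral_conj]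
  have := intervalIntegral.integral_comp_sub_left (a := 0) (b := 1) (fun x : ℝ => (ε x : ℂ) *
    deriv (fun k' => blochPeriodic ε μ (n + 1) k' x) k *
    (starRingEnd ℂ) (blochPeriodic ε μ (n + 1) k x)) 1
  rw [sub_self, sub_zero] at this
  rw [← this]
  congr 1; funext x
  rw [deriv_blochPeriodic_reflect h hs hk, blochPeriodic_reflect h hs hk, ← hs.ε_symm x]
  simp only [map_mul, Complex.conj_ofReal]

/-- Changing the sign of k conjugates the periodic part and adds a sign to its k-derivative; the
connection is real, so only the sign remains. -/
theorem berryConnection_neg {n : ℕ} {k : ℝ} (hk : k ∈ Set.Ioo 0 π) :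
    berryConnection ε μ (n + 1) (-k) = -berryConnection ε μ (n + 1) k := by
  rw [← berryConnection_conj h hs hk, berryConnection, berryConnection, innerX, innerX,
    ← intervalIntegral_conj, ← intervalIntegral.integral_neg]
  congr 1; funext x
  rw [deriv_blochPeriodic_neg h hs hk.1, blochPeriodic_neg h hs hk.1]
  simp only [map_mul, Complex.conj_ofReal, Complex.conj_conj]
  ring

/-- The connection is odd, so the integrals over the two halves of the Brillouin zone cancel. -/
theorem zakPhase_eq (n : ℕ) : zakPhase ε μ (n + 1) =
    (phaseJumpZero ε μ (n + 1) : ℂ) + (phaseJumpPi ε μ (n + 1) : ℂ) := by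
  have h1 : ∫ k in (-π)..0, berryConnection ε μ (n + 1) k =
      -∫ k in (0 : ℝ)..π, berryConnection ε μ (n + 1) k := by
    have := intervalIntegral.integral_comp_neg (a := 0) (b := π) (berryConnection ε μ (n + 1))
    rw [neg_zero] at this
    rw [← this, ← intervalIntegral.integral_neg]
    refine intervalIntegral.integral_congr_ae ?_
    have hne : ∀ᵐ k : ℝ, k ≠ π := by simp [ae_iff]
    filter_upwards [hne] with k hk hI
    rw [Set.uIoc_of_le Real.pi_pos.le] at hI
    exact berryConnection_neg h hs ⟨hI.1, lt_of_le_of_ne hI.2 hk⟩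
  rw [zakPhase, h1]
  ring

end Modes

end Photonic


namespace Photonic

/-! ### Dirac points and the bulk index -/

theorem abs_abs_sin_sub_abs_le {y : ℝ} (hy : |y| ≤ 1) : |(|Real.sin y| - |y|)| ≤ y ^ 2 := by
  refine (abs_abs_sub_abs_le _ _).trans ?_
  have h1 := Real.sin_bound hy
  have h2 : |Real.sin y - y| ≤ |y| ^ 5 / 100 + |y| ^ 3 / 6 := by
    have e : Real.sin y - y = (Real.sin y - (y - y ^ 3 / 6)) + (-(y ^ 3 / 6)) := by ring
    rw [e]
    refine (abs_add_le _ _).trans (add_le_add h1 (le_of_eq ?_))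
    rw [abs_neg, abs_div, abs_pow]
    norm_num
  refine h2.trans ?_
  rw [← sq_abs y]
  have h0 := abs_nonneg y
  have h3 : |y| ^ 3 ≤ |y| ^ 2 := pow_le_pow_of_le_one h0 hy (by norm_num)
  have h5 : |y| ^ 5 ≤ |y| ^ 2 := pow_le_pow_of_le_one h0 hy (by norm_num)
  linarith [sq_nonneg |y|]

theorem abs_sin_eq_abs_sin_sub {k κ : ℝ} (hκ : Real.sin κ = 0) :
    |Real.sin k| = |Real.sin (k - κ)| := by
  rw [Real.sin_sub, hκ, mul_zero, sub_zero, abs_mul]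
  have : |Real.cos κ| = 1 := by
    rw [← sq_eq_sq₀ (abs_nonneg _) zero_le_one, sq_abs, one_pow]
    have := Real.sin_sq_add_cos_sq κ
    rw [hκ] at this
    linarith
  rw [this, mul_one]

open Classical in
/-- The sign contributed to the bulk index by a band edge. -/
noncomputable def edgeSign (ε μ : ℝ → ℝ) (E : ℝ) : ℝ :=
  if hillB ε μ E = 0 ∧ hillC ε μ E ≠ 0 then -1 else 1

section Dirac

variable {ε μ : ℝ → ℝ} (h : IsPeriodicStructure ε μ) (hs : IsInversionSymmetric ε μ)
include h hs

/-- Conical dispersion near an energy at which the monodromy matrix is scalar. -/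
theorem conical {E κ : ℝ} (hb : hillB ε μ E = 0) (hc : hillC ε μ E = 0) (hκ : Real.sin κ = 0) :
    ∃ α > 0, ∀ e : ℝ → ℝ, Tendsto e (𝓝 κ) (𝓝 E) → (∀ k, hillA ε μ (e k) = Real.cos k) →
      (fun k => |e k - E| - α * |k - κ|) =O[𝓝 κ] (fun k => (k - κ) ^ 2) := by
  have hε := h.coef_ε
  have hμ := h.coef_μ
  -- By `one_sub_hillA_sq`, |sin k| = |e(k) - E| √J(e(k)). Hence the slope is 1/√J(E), and a
  -- Lipschitz bound for J makes the error quadratic.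
  set J : ℝ → ℝ := fun E' => solJ ε μ 1 0 1 0 E E' 1 * solJ ε μ 0 1 0 1 E E' 1 with hJ
  have hJ0 : 0 < J E := mul_pos (solJ_pos h (by simp) E one_pos) (solJ_pos h (by simp) E one_pos)
  have hJc : ContinuousAt J E := (continuous_solJ_right hε hμ 1 0 1 0 E 1).mul
    (continuous_solJ_right hε hμ 0 1 0 1 E 1)
  set G0 := Real.sqrt (J E) with hG0
  have hG0pos : 0 < G0 := Real.sqrt_pos.2 hJ0
  obtain ⟨L, hL, hLip⟩ : ∃ L, 0 ≤ L ∧ ∀ᶠ E' in 𝓝 E, |J E' - J E| ≤ L * |E' - E| := by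
    obtain ⟨K1, hK1, l1⟩ := solJ_lipschitz hε hμ 1 0 1 0 (|E| + 1) 1
    obtain ⟨K2, hK2, l2⟩ := solJ_lipschitz hε hμ 0 1 0 1 (|E| + 1) 1
    obtain ⟨B1, hB1, b1⟩ := solJ_bound hε hμ 1 0 1 0 (|E| + 1) 1
    obtain ⟨B2, hB2, b2⟩ := solJ_bound hε hμ 0 1 0 1 (|E| + 1) 1
    refine ⟨K1 * B2 + B1 * K2, by positivity, ?_⟩
    have : ∀ᶠ E' in 𝓝 E, |E'| < |E| + 1 :=
      continuous_abs.continuousAt.eventually_lt continuousAt_const (by simp)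
    filter_upwards [this] with E' hE'
    have hE : |E| ≤ |E| + 1 := by linarith
    have i1 := l1 E E E E' hE hE hE hE'.le 1 (by simp)
    have i2 := l2 E E E E' hE hE hE hE'.le 1 (by simp)
    have i3 := b2 E E' hE hE'.le 1 (by simp)
    have i4 := b1 E E hE hE 1 (by simp)
    rw [sub_self, abs_zero, zero_add] at i1 i2
    have e : J E' - J E = (solJ ε μ 1 0 1 0 E E' 1 - solJ ε μ 1 0 1 0 E E 1) *
        solJ ε μ 0 1 0 1 E E' 1 + solJ ε μ 1 0 1 0 E E 1 *
        (solJ ε μ 0 1 0 1 E E' 1 - solJ ε μ 0 1 0 1 E E 1) := by rw [hJ]; ring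
    rw [e]
    refine (abs_add_le _ _).trans ?_
    rw [abs_mul, abs_mul]
    have m1 := mul_le_mul i1 i3 (abs_nonneg _) (by positivity)
    have m2 := mul_le_mul i4 i2 (abs_nonneg _) hB1
    linarith
  refine ⟨1 / G0, by positivity, fun e he hA => ?_⟩
  have hbig : ∀ᶠ E' in 𝓝 E, J E / 4 < J E' := hJc.eventually_const_lt (by linarith)
  have hnear : ∀ᶠ k in 𝓝 κ, |k - κ| < 1 := by
    have : ContinuousAt (fun k => |k - κ|) κ := by fun_prop
    exact this.eventually_lt continuousAt_const (by simp)
  refine IsBigO.of_bound ((1 / G0) * (L / G0 * (4 / J E) + 1)) ?_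
  filter_upwards [he.eventually hLip, he.eventually hbig, hnear] with k h1 h2 h3
  set d := |e k - E| with hd
  set y := k - κ with hy
  have hd0 : 0 ≤ d := abs_nonneg _
  have hJk : 0 < J (e k) := lt_trans (by positivity) h2
  set G := Real.sqrt (J (e k)) with hG
  have hGpos : 0 < G := Real.sqrt_pos.2 hJk
  have hsin : |Real.sin y| = d * G := by
    have := one_sub_hillA_sq h hs hb hc (e k)
    rw [hA] at this
    rw [hy, ← abs_sin_eq_abs_sin_sub hκ, ← sq_eq_sq₀ (abs_nonneg _) (by positivity), sq_abs,
      mul_pow, hG, Real.sq_sqrt hJk.le, hd, sq_abs, ← this]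
    have := Real.sin_sq_add_cos_sq k
    linarith
  have hsq : d ^ 2 * (J E / 4) ≤ y ^ 2 := by
    have i1 : d * G ≤ |y| := by rw [← hsin]; exact Real.abs_sin_le_abs
    have i2 : (d * G) ^ 2 ≤ |y| ^ 2 := pow_le_pow_left₀ (by positivity) i1 2
    rw [mul_pow, hG, Real.sq_sqrt hJk.le, sq_abs y] at i2
    nlinarith [sq_nonneg d]
  have hdiff : |G - G0| ≤ L / G0 * d := by
    have e1 : (G - G0) * (G + G0) = J (e k) - J E := by
      have s1 := Real.mul_self_sqrt hJk.le
      have s2 := Real.mul_self_sqrt hJ0.le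
      rw [← hG] at s1
      rw [← hG0] at s2
      linear_combination s1 - s2
    have e2 : |G - G0| * (G + G0) ≤ L * d := by
      rw [← abs_of_pos (add_pos hGpos hG0pos), ← abs_mul, e1]
      exact h1
    rw [div_mul_eq_mul_div, le_div_iff₀ hG0pos]
    nlinarith [abs_nonneg (G - G0)]
  have hs3 := abs_abs_sin_sub_abs_le h3.le
  rw [hsin] at hs3
  rw [Real.norm_eq_abs, Real.norm_eq_abs, abs_of_nonneg (sq_nonneg y)]
  -- The error splits into the variation of √J and the deviation of the sine from its argument, both
  -- quadratic in `y`.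
  have e3 : d - 1 / G0 * |y| = (1 / G0) * (d * (G0 - G) + (d * G - |y|)) := by
    field_simp
    ring
  rw [e3, abs_mul, abs_of_pos (by positivity : 0 < 1 / G0), mul_assoc]
  refine mul_le_mul_of_nonneg_left ((abs_add_le _ _).trans ?_) (by positivity)
  rw [abs_mul, abs_of_nonneg hd0, abs_sub_comm]
  have i5 : d * |G - G0| ≤ L / G0 * (4 / J E) * y ^ 2 := by
    have : d * |G - G0| ≤ d * (L / G0 * d) := mul_le_mul_of_nonneg_left hdiff hd0
    refine this.trans ?_
    have e4 : d * (L / G0 * d) = L / G0 * (4 / J E) * (d ^ 2 * (J E / 4)) := by field_simp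
    rw [e4]
    exact mul_le_mul_of_nonneg_left hsq (by positivity)
  linarith

/-- With a scalar monodromy matrix every solution is a Bloch mode. -/
theorem finrank_bloch_degenerate {E κ : ℝ} (hb : hillB ε μ E = 0) (hc : hillC ε μ E = 0)
    (hA : hillA ε μ E = Real.cos κ) :
    Module.finrank ℂ (Submodule.span ℂ {ψ : ℝ → ℂ | IsBlochMode ε μ κ E ψ}) = 2 := by
  have hd := hill_det h hs E
  rw [hb, hA, zero_mul, sub_zero] at hd
  have hsin : Real.sin κ = 0 := by
    have := Real.sin_sq_add_cos_sq κ
    nlinarith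
  let w : Fin 2 → ℝ → ℂ := ![fun x => (solU ε μ 1 0 E x : ℂ), fun x => (solU ε μ 0 1 E x : ℂ)]
  have hset : Submodule.span ℂ {ψ : ℝ → ℂ | IsBlochMode ε μ κ E ψ} =
      Submodule.span ℂ (Set.range w) := by
    apply le_antisymm
    · refine Submodule.span_le.2 fun ψ hψ => ?_
      obtain ⟨A, B, hf, -, -⟩ := (isBlochMode_iff h hs).1 hψ
      have : ψ = A • w 0 + B • w 1 := by
        funext x; rw [hf]; simp [w]
      rw [this]
      exact Submodule.add_mem _ (Submodule.smul_mem _ _ (Submodule.subset_span ⟨0, rfl⟩))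
        (Submodule.smul_mem _ _ (Submodule.subset_span ⟨1, rfl⟩))
    · refine Submodule.span_mono ?_
      rintro _ ⟨i, rfl⟩
      have hz : Complex.exp (Complex.I * κ) - hillA ε μ E = 0 := by
        rw [hA, exp_sub_cos, hsin]; simp
      fin_cases i
      · exact (isBlochMode_iff h hs).2 ⟨1, 0, fun x => by simp [w], by rw [hz]; simp,
          by rw [hz, hc]; simp⟩
      · exact (isBlochMode_iff h hs).2 ⟨0, 1, fun x => by simp [w], by rw [hz, hb]; simp,
          by rw [hz]; simp⟩
  have hli : LinearIndependent ℂ w := by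
    rw [LinearIndependent.pair_iff]
    intro s t hst
    by_contra hne
    have hne' : s ≠ 0 ∨ t ≠ 0 := by
      by_contra! hcon
      exact hne hcon
    have hpos := normSq_integral_pos h E hne'
    have hz : ∀ x, s * solU ε μ 1 0 E x + t * solU ε μ 0 1 E x = 0 := fun x => congrFun hst x
    simp [hz] at hpos
  rw [hset, finrank_span_eq_card hli]
  simp

/-- The two bands lie below and above their common edge, so the absolute value in `conical` resolves
into the two branches of the cone. -/
theorem isDiracPoint_of_degenerate {n : ℕ} {κ : ℝ} (hc : hillC ε μ (hillDelta ε μ (n + 1)) = 0)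
    (hκ : Real.cos κ = (-1) ^ (n + 1)) :
    IsDiracPoint ε μ (n + 1) κ (hillDelta ε μ (n + 1)) := by
  have hb := hillB_delta h hs (n := n + 1) (by omega)
  obtain ⟨e1, e2⟩ := edges_of_zero h hs hc
  have hsin : Real.sin κ = 0 := by
    have := Real.sin_sq_add_cos_sq κ
    rw [hκ, neg_one_pow_sq] at this
    nlinarith
  have f1 : bandFn ε μ n (Real.cos κ) = hillDelta ε μ (n + 1) := by
    rw [hκ, pow_succ, mul_neg_one, bandFn_hi h hs, e1]
  have f2 : bandFn ε μ (n + 1) (Real.cos κ) = hillDelta ε μ (n + 1) := by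
    rw [hκ, bandFn_lo h hs, e2]
  have hten : ∀ m, Tendsto (fun k => bandFn ε μ m (Real.cos k)) (𝓝 κ)
      (𝓝 (bandFn ε μ m (Real.cos κ))) := fun m => by
    refine ((continuousOn_bandFn h hs m) _ (Real.abs_cos_le_one κ)).tendsto.comp ?_
    exact tendsto_nhdsWithin_iff.2 ⟨Real.continuous_cos.tendsto κ,
      Eventually.of_forall fun k => Real.abs_cos_le_one _⟩
  obtain ⟨α, hα, hcone⟩ := conical h hs hb hc hsin
  refine ⟨by omega, ?_, ?_, ⟨α, hα, ?_, ?_⟩, ?_⟩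
  · rw [bandEnergy_eq h hs, f1]
  · rw [bandEnergy_eq h hs, f2]
  · have := hcone _ (f1 ▸ hten n) fun k => hillA_bandFn h hs n (Real.abs_cos_le_one k)
    refine (this.neg_left).congr_left fun k => ?_
    have hle := (bandFn_mem h hs n (Real.abs_cos_le_one k)).2
    rw [e1] at hle
    rw [bandEnergy_eq h hs, abs_of_nonpos (sub_nonpos.2 hle)]
    ring
  · have := hcone _ (f2 ▸ hten (n + 1)) fun k =>
      hillA_bandFn h hs (n + 1) (Real.abs_cos_le_one k)
    refine this.congr_left fun k => ?_
    have hle := (bandFn_mem h hs (n + 1) (Real.abs_cos_le_one k)).1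
    rw [e2] at hle
    rw [bandEnergy_eq h hs, abs_of_nonneg (sub_nonneg.2 hle)]
    ring
  · refine finrank_bloch_degenerate h hs hb hc ?_
    rw [← f1, hillA_bandFn h hs n (Real.abs_cos_le_one _)]

theorem IsDiracPoint.degenerate {n : ℕ} {κ E : ℝ} (hD : IsDiracPoint ε μ (n + 1) κ E) :
    E = bandFn ε μ n (Real.cos κ) ∧ E = bandFn ε μ (n + 1) (Real.cos κ) ∧
    E = hillDelta ε μ (n + 1) ∧ hillC ε μ (hillDelta ε μ (n + 1)) = 0 ∧
    Real.cos κ = (-1) ^ (n + 1) := by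
  obtain ⟨-, h1, h2, -, -⟩ := hD
  rw [bandEnergy_eq h hs] at h1 h2
  obtain ⟨-, h3, -, h4⟩ := degenerate_of_bandFn_eq h hs (Real.abs_cos_le_one κ) n.lt_succ_self
    (h1.trans h2.symm)
  refine ⟨h1.symm, h2.symm, h1.symm.trans h3, h4, ?_⟩
  have h5 := hillA_bandFn h hs n (Real.abs_cos_le_one κ)
  rw [h3] at h5
  have h6 := hillA_delta h hs (n + 1)
  rw [h5] at h6
  calc Real.cos κ = ((-1) ^ (n + 1) * (-1) ^ (n + 1)) * Real.cos κ := by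
        rw [neg_one_pow_mul_self, one_mul]
    _ = _ := by rw [mul_assoc, h6, mul_one]

/-- An energy with scalar monodromy matrix is shared by two neighbouring bands; the band at hand is
the lower or the upper one, as in the two alternatives of the definition. -/
theorem hasDiracPointAt_iff {n : ℕ} {κ : ℝ} : HasDiracPointAt ε μ (n + 1) κ ↔
    hillB ε μ (bandFn ε μ n (Real.cos κ)) = 0 ∧ hillC ε μ (bandFn ε μ n (Real.cos κ)) = 0 := by
  have hk := Real.abs_cos_le_one κ
  constructor
  · rintro ⟨E, hD | hD⟩
    · obtain ⟨h1, -, h2, h3, -⟩ := hD.degenerate h hs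
      rw [← h1, h2]
      exact ⟨hillB_delta h hs (by omega), h3⟩
    · rw [Nat.add_sub_cancel] at hD
      obtain ⟨m, rfl⟩ : ∃ m, n = m + 1 := ⟨n - 1, (Nat.sub_add_cancel hD.1).symm⟩
      obtain ⟨-, h1, h2, h3, -⟩ := hD.degenerate h hs
      rw [← h1, h2]
      exact ⟨hillB_delta h hs (by omega), h3⟩
  · rintro ⟨hb, hc⟩
    have hA := hillA_bandFn h hs n hk
    obtain ⟨m, hm, h1, h2⟩ := eq_delta_of_degenerate h hs hb hc
    have E1 : bandFn ε μ m (Real.cos κ) = bandFn ε μ n (Real.cos κ) := by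
      nth_rw 1 [← hA]
      rw [h1]; exact bandFn_hillA h hs ⟨(lo_lt_hi h hs m).le, le_rfl⟩
    have hcos : Real.cos κ = (-1) ^ (m + 1) := by
      rw [← hA, h2, hillA_lo h hs]
    have hD := isDiracPoint_of_degenerate h hs (hm ▸ hc) hcos
    refine ⟨hillDelta ε μ (m + 1), ?_⟩
    rcases lt_trichotomy n m with hlt | heq | hgt
    · obtain ⟨e1, e2, -, -⟩ := degenerate_of_bandFn_eq h hs hk hlt E1.symm
      rw [hm] at e2
      have := (strictMono_hillDelta h hs).injective e2
      omega
    · left; rw [heq]; exact hD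
    · obtain ⟨e1, -, -, -⟩ := degenerate_of_bandFn_eq h hs hk hgt E1
      right; rw [e1]; exact hD

/-- The jump is minus the argument of 1 or -1. At a Dirac point C vanishes as well, and both
conventions give 1. -/
theorem exp_phaseJumpZero (n : ℕ) : Complex.exp (Complex.I * phaseJumpZero ε μ (n + 1)) =
    (edgeSign ε μ (bandFn ε μ n 1) : ℝ) := by
  have hiff := hasDiracPointAt_iff h hs (n := n) (κ := 0)
  rw [Real.cos_zero] at hiff
  rw [phaseJumpZero, edgeSign]
  by_cases hD : HasDiracPointAt ε μ (n + 1) 0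
  · have := hiff.1 hD
    rw [if_pos hD, if_neg (fun hc => hc.2 this.2)]
    simp
  · have hnd := fun hc => hD (hiff.2 hc)
    rw [if_neg hD, inner_zero_jump h hs hnd]
    by_cases hb : hillB ε μ (bandFn ε μ n 1) = 0
    · rw [if_pos hb, if_pos ⟨hb, fun hc => hnd ⟨hb, hc⟩⟩, Complex.arg_neg_one]
      push_cast
      rw [mul_neg, Complex.exp_neg, mul_comm, Complex.exp_pi_mul_I]
      norm_num
    · rw [if_neg hb, if_neg (fun hc => hb hc.1), Complex.arg_one]
      simp

theorem exp_phaseJumpPi (n : ℕ) : Complex.exp (Complex.I * phaseJumpPi ε μ (n + 1)) =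
    (edgeSign ε μ (bandFn ε μ n (-1)) : ℝ) := by
  have hiff := hasDiracPointAt_iff h hs (n := n) (κ := π)
  rw [Real.cos_pi] at hiff
  rw [phaseJumpPi, edgeSign]
  by_cases hD : HasDiracPointAt ε μ (n + 1) π
  · have := hiff.1 hD
    rw [if_pos hD, if_neg (fun hc => hc.2 this.2)]
    simp
  · have hnd := fun hc => hD (hiff.2 hc)
    rw [if_neg hD, inner_pi_jump h hs hnd]
    by_cases hb : hillB ε μ (bandFn ε μ n (-1)) = 0
    · rw [if_pos hb, if_pos ⟨hb, fun hc => hnd ⟨hb, hc⟩⟩, Complex.arg_neg_one]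
      push_cast
      rw [mul_neg, Complex.exp_neg, mul_comm, Complex.exp_pi_mul_I]
      norm_num
    · rw [if_neg hb, if_neg (fun hc => hb hc.1), Complex.arg_one]
      simp

/-- The parity of `n` decides which band edge sits at k = 0 and which at k = π; the product is
insensitive to this. -/
theorem exp_zakPhase (n : ℕ) : Complex.exp (Complex.I * zakPhase ε μ (n + 1)) =
    (edgeSign ε μ (bandLo ε μ n) * edgeSign ε μ (bandHi ε μ n) : ℝ) := by
  rw [zakPhase_eq h hs, mul_add, Complex.exp_add, exp_phaseJumpZero h hs, exp_phaseJumpPi h hs]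
  rcases neg_one_pow_eq_or ℝ n with hn | hn
  · rw [← bandFn_lo h hs, ← bandFn_hi h hs, hn]
    push_cast; ring
  · rw [← bandFn_lo h hs, ← bandFn_hi h hs, hn, neg_neg]
    push_cast; ring

omit h hs in
theorem edgeSign_of_ne {E : ℝ} (hb : hillB ε μ E ≠ 0) : edgeSign ε μ E = 1 :=
  if_neg fun hc => hb hc.1

theorem hillB_lo_ne {n : ℕ} (hlt : hillDelta ε μ n < bandLo ε μ n) :
    hillB ε μ (bandLo ε μ n) ≠ 0 := by
  intro hb
  have := hillB_sign h hs ⟨hlt, (lo_lt_hi h hs n).trans_le (hi_le_delta h hs n)⟩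
  rw [hb, mul_zero] at this
  exact lt_irrefl _ this

theorem hillB_hi_ne {n : ℕ} (hlt : bandHi ε μ n < hillDelta ε μ (n + 1)) :
    hillB ε μ (bandHi ε μ n) ≠ 0 := by
  intro hb
  have := hillB_sign h hs ⟨(delta_le_lo h hs n).trans_lt (lo_lt_hi h hs n), hlt⟩
  rw [hb, mul_zero] at this
  exact lt_irrefl _ this

-- Exactly one edge of an open gap is a zero of B, and C is not zero there; at a closed gap C
-- vanishes too and neither sign is -1.
open Classical in
theorem edgeSign_mul (n : ℕ) : edgeSign ε μ (bandHi ε μ n) * edgeSign ε μ (bandLo ε μ (n + 1)) =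
    if hillC ε μ (hillDelta ε μ (n + 1)) = 0 then 1 else -1 := by
  have hb := hillB_delta h hs (n := n + 1) (by omega)
  have hne : ((-1 : ℝ) ^ (n + 1)) ≠ 0 := by positivity
  split_ifs with hc
  · obtain ⟨e1, e2⟩ := edges_of_zero h hs hc
    rw [e1, e2, edgeSign, if_neg (fun hcon => hcon.2 hc), one_mul]
  · have hD : edgeSign ε μ (hillDelta ε μ (n + 1)) = -1 := if_pos ⟨hb, hc⟩
    rcases lt_or_gt_of_ne (mul_ne_zero hne hc) with h5 | h5
    · obtain ⟨e1, e2⟩ := edges_of_neg h hs h5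
      rw [e2, hD, edgeSign_of_ne (hillB_hi_ne h hs e1), one_mul]
    · obtain ⟨e1, e2⟩ := edges_of_pos h hs h5
      rw [e1, hD, edgeSign_of_ne (hillB_lo_ne h hs e2), mul_one]

-- Each degenerate `hillDelta` gives one Dirac point in the reduced zone, at k = 0 or k = π by
-- parity.
open Classical in
theorem numDiracPointsBelow_eq (N : ℕ) : numDiracPointsBelow ε μ (N + 1) =
    ((Finset.range N).filter fun n => hillC ε μ (hillDelta ε μ (n + 1)) = 0).card := by
  have hset : {q : ℝ × ℝ | q.1 ∈ Set.Icc 0 π ∧ ∃ m, m < N + 1 ∧ IsDiracPoint ε μ m q.1 q.2} =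
      (fun n : ℕ => (Real.arccos ((-1) ^ (n + 1)), hillDelta ε μ (n + 1))) ''
        (((Finset.range N).filter fun n => hillC ε μ (hillDelta ε μ (n + 1)) = 0 : Finset ℕ) :
          Set ℕ) := by
    ext ⟨k, E⟩
    simp only [Set.mem_ofPred_eq, Set.mem_image, Finset.coe_filter, Finset.mem_range,
      Prod.mk.injEq]
    constructor
    · rintro ⟨hk, m, hm, hD⟩
      obtain ⟨n, rfl⟩ : ∃ n, m = n + 1 := ⟨m - 1, (Nat.sub_add_cancel hD.1).symm⟩
      obtain ⟨-, -, h1, h2, h3⟩ := hD.degenerate h hs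
      refine ⟨n, ⟨by omega, h2⟩, ?_, h1.symm⟩
      rw [← h3, Real.arccos_cos hk.1 hk.2]
    · rintro ⟨n, ⟨hn, hc⟩, rfl, rfl⟩
      refine ⟨⟨Real.arccos_nonneg _, Real.arccos_le_pi _⟩, n + 1, by omega, ?_⟩
      have hab : |((-1) ^ (n + 1) : ℝ)| ≤ 1 := by rw [abs_pow]; simp
      exact isDiracPoint_of_degenerate h hs hc (Real.cos_arccos (abs_le.1 hab).1 (abs_le.1 hab).2)
  rw [numDiracPointsBelow, hset, Set.ncard_image_of_injective, Set.ncard_coe_finset]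
  intro i j hij
  have h2 : hillDelta ε μ (i + 1) = hillDelta ε μ (j + 1) := (Prod.ext_iff.1 hij).2
  have := (strictMono_hillDelta h hs).injective h2
  omega

/-- The bulk index of the gap above a band is the sign contributed by the upper edge of the band. -/
theorem bulkIndex_eq (N : ℕ) : bulkIndex ε μ (N + 1) = (edgeSign ε μ (bandHi ε μ N) : ℝ) := by
  classical
  -- Induction over the gaps: an open gap contributes -1 through its two edges, a closed one
  -- contributes -1 through its Dirac point. Hence only (-1)^N and the sign of the topmost edge
  -- survive.
  have key : (-1 : ℂ) ^ numDiracPointsBelow ε μ (N + 1) *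
      Complex.exp (Complex.I * ∑ m ∈ Finset.Icc 1 (N + 1), zakPhase ε μ m) =
      (-1) ^ N * (edgeSign ε μ (bandHi ε μ N) : ℝ) := by
    induction N with
    | zero =>
      rw [numDiracPointsBelow_eq h hs]
      have hlo : edgeSign ε μ (bandLo ε μ 0) = 1 := by
        rw [bandLo_zero h hs]; exact edgeSign_of_ne (hillB_pos h hs le_rfl).ne'
      simp only [zero_add, Finset.Icc_self, Finset.sum_singleton]
      rw [exp_zakPhase h hs 0, hlo]
      simp
    | succ N ih =>
      have hsum : ∑ m ∈ Finset.Icc 1 (N + 1 + 1), zakPhase ε μ m =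
          (∑ m ∈ Finset.Icc 1 (N + 1), zakPhase ε μ m) + zakPhase ε μ (N + 1 + 1) :=
        Finset.sum_Icc_succ_top (by omega) _
      have hnum : (-1 : ℂ) ^ numDiracPointsBelow ε μ (N + 1 + 1) =
          (-1) ^ numDiracPointsBelow ε μ (N + 1) *
            (if hillC ε μ (hillDelta ε μ (N + 1)) = 0 then -1 else 1) := by
        rw [numDiracPointsBelow_eq h hs, numDiracPointsBelow_eq h hs, Finset.range_add_one,
          Finset.filter_insert]
        split_ifs with hc
        · rw [Finset.card_insert_of_notMem (by simp), pow_succ]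
        · rw [mul_one]
      have hmul := congrArg (fun x : ℝ => (x : ℂ)) (edgeSign_mul h hs N)
      simp only [Complex.ofReal_mul] at hmul
      rw [hsum, mul_add, Complex.exp_add, exp_zakPhase h hs, hnum]
      have hcomb : (edgeSign ε μ (bandHi ε μ N) : ℂ) * edgeSign ε μ (bandLo ε μ (N + 1)) *
          (if hillC ε μ (hillDelta ε μ (N + 1)) = 0 then -1 else 1) = -1 := by
        rw [hmul]
        split_ifs <;> simp
      push_cast
      rw [pow_succ]
      linear_combination (if hillC ε μ (hillDelta ε μ (N + 1)) = 0 then (-1 : ℂ) else 1) *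
        edgeSign ε μ (bandLo ε μ (N + 1)) * edgeSign ε μ (bandHi ε μ (N + 1)) * ih +
        (-1 : ℂ) ^ N * edgeSign ε μ (bandHi ε μ (N + 1)) * hcomb
  have e : N + 1 + numDiracPointsBelow ε μ (N + 1) - 1 = N + numDiracPointsBelow ε μ (N + 1) := by
    omega
  rw [bulkIndex, e, pow_add, mul_assoc, key, ← mul_assoc, ← pow_add, ← two_mul, pow_mul]
  norm_num

end Dirac

end Photonic


namespace Photonic

/-! ### Exponentially decaying solutions -/

/-- With c = -log|l| > 0 the function |f(x)| e^{cx} is periodic, hence bounded, so `f` decays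
exponentially. -/
theorem integrableOn_sq_Ioi {f : ℝ → ℝ} (hf : Continuous f) {l : ℝ} (hl0 : l ≠ 0) (hl : |l| < 1)
    (hper : ∀ x, f (x + 1) = l * f x) : IntegrableOn (fun x => f x ^ 2) (Set.Ioi 0) := by
  have hlpos : 0 < |l| := abs_pos.2 hl0
  set c := -Real.log |l| with hc
  have hcpos : 0 < c := neg_pos.2 (Real.log_neg hlpos hl)
  have hexp : |l| * Real.exp c = 1 := by
    rw [hc, Real.exp_neg, Real.exp_log hlpos, mul_inv_cancel₀ hlpos.ne']
  have hg : Continuous fun x => |f x| * Real.exp (c * x) := by fun_prop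
  have hgper : Function.Periodic (fun x => |f x| * Real.exp (c * x)) 1 := fun x => by
    simp only [hper, abs_mul, mul_add, mul_one, Real.exp_add]
    linear_combination (|f x| * Real.exp (c * x)) * hexp
  obtain ⟨K, hK⟩ := (isCompact_Icc (a := (0 : ℝ)) (b := 1)).exists_bound_of_continuousOn
    hg.continuousOn
  have hb : ∀ x, |f x| * Real.exp (c * x) ≤ K := fun x => by
    obtain ⟨y, hy, he⟩ := hgper.exists_mem_Ico₀ one_pos x
    have := hK y ⟨hy.1, hy.2.le⟩
    rw [Real.norm_eq_abs] at this
    rw [he]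
    exact (le_abs_self _).trans this
  refine Integrable.mono' (g := fun x => K ^ 2 * Real.exp (-(2 * c) * x))
    ((exp_neg_integrableOn_Ioi 0 (by linarith)).const_mul _)
    (hf.pow 2).aestronglyMeasurable (ae_of_all _ fun x => ?_)
  have h1 := pow_le_pow_left₀ (by positivity) (hb x) 2
  rw [mul_pow, sq_abs] at h1
  have h2 : Real.exp (c * x) ^ 2 * Real.exp (-(2 * c) * x) = 1 := by
    rw [sq, ← Real.exp_add, ← Real.exp_add]
    ring_nf
    exact Real.exp_zero
  rw [Real.norm_eq_abs, abs_of_nonneg (sq_nonneg _)]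
  calc f x ^ 2 = f x ^ 2 * Real.exp (c * x) ^ 2 * Real.exp (-(2 * c) * x) := by
        rw [mul_assoc, h2, mul_one]
    _ ≤ _ := mul_le_mul_of_nonneg_right h1 (Real.exp_pos _).le

theorem integrableOn_sq_Iic {f : ℝ → ℝ} (hf : Continuous f) {l : ℝ} (hl : 1 < |l|)
    (hper : ∀ x, f (x + 1) = l * f x) : IntegrableOn (fun x => f x ^ 2) (Set.Iic 0) := by
  have hl0 : l ≠ 0 := abs_pos.1 (zero_lt_one.trans hl)
  have h1 := integrableOn_sq_Ioi (f := fun x => f (-x)) (by fun_prop) (inv_ne_zero hl0)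
    (by rw [abs_inv]; exact inv_lt_one_of_one_lt₀ hl) (fun x => by
      have := hper (-(x + 1))
      rw [show -(x + 1) + 1 = -x by ring] at this
      rw [this, inv_mul_cancel_left₀ hl0])
  have h2 := (integrableOn_Ici_iff_integrableOn_Ioi (μ := volume)).2 h1
  have h3 := h2.comp_neg
  simpa using h3

/-! ### Spectral gaps -/

section Gap

variable {ε μ : ℝ → ℝ} (h : IsPeriodicStructure ε μ) (hs : IsInversionSymmetric ε μ)
include h hs

theorem floquet {E a b l : ℝ} (h1 : hillA ε μ E * a + hillB ε μ E * b = l * a)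
    (h2 : hillC ε μ E * a + hillA ε μ E * b = l * b) (x : ℝ) :
    solU ε μ a b E (x + 1) = l * solU ε μ a b E x := by
  have hε := h.coef_ε
  have hμ := h.coef_μ
  have hS := sol_solU hε hμ a b E
  have hS1 := hS.comp_add 1
  simp only [h.μ_periodic _, h.ε_periodic _] at hS1
  have r0 := hS.repr_self hε hμ
  have r1 := (hS1.repr_self hε hμ x).1
  have e1 := r0 1
  simp only [solU_zero hε hμ, solP_zero hε hμ, smul_eq_mul, zero_add] at r0 r1 e1
  rw [hill_p₂ h hs] at e1
  rw [r1, (r0 x).1, e1.1, e1.2]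
  rw [hillA, hillB] at h1
  rw [hillC] at h2
  linear_combination solU ε μ 1 0 E x * h1 + solU ε μ 0 1 E x * h2

/-- Eigenvectors of the monodromy matrix in a spectral gap. -/
theorem hill_eigenvector {E s : ℝ} (hs1 : s ^ 2 = 1) (hA : 1 < hillA ε μ E ^ 2) : ∃ l,
    hillA ε μ E * √|hillB ε μ E| + hillB ε μ E * (s * √|hillC ε μ E|) = l * √|hillB ε μ E| ∧
    hillC ε μ E * √|hillB ε μ E| + hillA ε μ E * (s * √|hillC ε μ E|) =
      l * (s * √|hillC ε μ E|) ∧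
    (0 < s * (hillA ε μ E * hillB ε μ E) → 1 < |l|) ∧
    (s * (hillA ε μ E * hillB ε μ E) < 0 → l ≠ 0 ∧ |l| < 1) := by
  have hd := hill_det h hs E
  set A := hillA ε μ E
  set B := hillB ε μ E
  set C := hillC ε μ E
  have hBC : 0 < B * C := by linarith
  -- In a gap BC = A² - 1 > 0, so B and C have a common sign β. The eigenvalues are A ± √(BC), with
  -- product 1; the larger modulus belongs to the sign of A.
  obtain ⟨β, hβ, hB, hC⟩ : ∃ β : ℝ, β ^ 2 = 1 ∧ B = β * |B| ∧ C = β * |C| := by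
    rcases mul_pos_iff.1 hBC with ⟨h1, h2⟩ | ⟨h1, h2⟩
    · exact ⟨1, by norm_num, by rw [abs_of_pos h1, one_mul], by rw [abs_of_pos h2, one_mul]⟩
    · exact ⟨-1, by norm_num, by rw [abs_of_neg h1]; ring, by rw [abs_of_neg h2]; ring⟩
  have hB0 : 0 < |B| := abs_pos.2 (left_ne_zero_of_mul hBC.ne')
  have hC0 : 0 < |C| := abs_pos.2 (right_ne_zero_of_mul hBC.ne')
  have hg2 := Real.sq_sqrt hB0.le
  have hk2 := Real.sq_sqrt hC0.le
  have hg := Real.sqrt_pos.2 hB0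
  have hk := Real.sqrt_pos.2 hC0
  set g := √|B|
  set k := √|C|
  rw [← hg2] at hB
  rw [← hk2] at hC
  have hgk : 0 < g * k := mul_pos hg hk
  have hdet : A ^ 2 - (g * k) ^ 2 = 1 := by
    rw [hB, hC] at hd
    linear_combination hd + (g * k) ^ 2 * hβ
  have big : ∀ y : ℝ, y ^ 2 = 1 → 0 < A * y → 1 < |A + y * (g * k)| := by
    intro y hy hAy
    rw [← one_lt_sq_iff_one_lt_abs]
    have : 0 < A * y * (g * k) := mul_pos hAy hgk
    have e : (A + y * (g * k)) ^ 2 = A ^ 2 + 2 * (A * y * (g * k)) + (g * k) ^ 2 := by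
      linear_combination (g * k) ^ 2 * hy
    rw [e]
    nlinarith [sq_nonneg (g * k)]
  refine ⟨A + β * s * (g * k), ?_, ?_, fun hp => ?_, fun hn => ?_⟩
  · rw [hB]; ring
  · rw [hC]; linear_combination (-β * k ^ 2 * g) * hs1
  · refine big _ (by rw [mul_pow, hβ, hs1, one_mul]) ?_
    rw [hB] at hp
    have : 0 < (A * (β * s)) * g ^ 2 := by linarith
    exact pos_of_mul_pos_left this (by positivity)
  · have h1 := big (-(β * s)) (by rw [neg_sq, mul_pow, hβ, hs1, one_mul]) (by
      rw [hB] at hn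
      have : 0 < (A * -(β * s)) * g ^ 2 := by linarith
      exact pos_of_mul_pos_left this (by positivity))
    have h2 : (A + β * s * (g * k)) * (A + -(β * s) * (g * k)) = 1 := by
      linear_combination hdet - (g * k) ^ 2 * s ^ 2 * hβ - (g * k) ^ 2 * hs1
    refine ⟨left_ne_zero_of_mul_eq_one h2, ?_⟩
    have h3 : |A + β * s * (g * k)| * |A + -(β * s) * (g * k)| = 1 := by
      rw [← abs_mul, h2, abs_one]
    by_contra! hc
    nlinarith

/-- The type σ is 1 if the zero of B is the lower edge of the gap and -1 if it is the upper edge.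
The gap lies on one side of that zero, where the signs of A and B are known, so σ also gives the
sign of AB. -/
theorem gap_spec {N : ℕ} (hgap : bandHi ε μ N < bandLo ε μ (N + 1)) : ∃ σ : ℝ,
    (σ = 1 ∧ hillB ε μ (bandHi ε μ N) = 0 ∧ hillC ε μ (bandHi ε μ N) ≠ 0 ∧
        hillC ε μ (bandLo ε μ (N + 1)) = 0 ∧ hillB ε μ (bandLo ε μ (N + 1)) ≠ 0 ∨
      σ = -1 ∧ hillC ε μ (bandHi ε μ N) = 0 ∧ hillB ε μ (bandHi ε μ N) ≠ 0 ∧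
        hillB ε μ (bandLo ε μ (N + 1)) = 0 ∧ hillC ε μ (bandLo ε μ (N + 1)) ≠ 0) ∧
    bulkIndex ε μ (N + 1) = ((-σ : ℝ) : ℂ) ∧
    ∀ E ∈ Set.Ioo (bandHi ε μ N) (bandLo ε μ (N + 1)),
      1 < hillA ε μ E ^ 2 ∧ 0 < σ * (hillA ε μ E * hillB ε μ E) := by
  have hne : ((-1 : ℝ) ^ (N + 1)) ≠ 0 := by positivity
  have hb := hillB_delta h hs (n := N + 1) (by omega)
  have hedge : ∀ E, hillA ε μ E ^ 2 = 1 → hillB ε μ E ≠ 0 → hillC ε μ E = 0 := by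
    intro E hE hB
    have := hill_det h hs E
    rw [hE] at this
    exact (mul_eq_zero.1 (by linarith)).resolve_left hB
  have hAhi : hillA ε μ (bandHi ε μ N) ^ 2 = 1 := by
    rw [hillA_hi h hs, neg_sq, neg_one_pow_sq]
  have hAlo : hillA ε μ (bandLo ε μ (N + 1)) ^ 2 = 1 := by
    rw [hillA_lo h hs, neg_one_pow_sq]
  have hc : hillC ε μ (hillDelta ε μ (N + 1)) ≠ 0 := by
    intro hc
    obtain ⟨e1, e2⟩ := edges_of_zero h hs hc
    rw [e1, e2] at hgap
    exact lt_irrefl _ hgap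
  rcases lt_or_gt_of_ne (mul_ne_zero hne hc) with h5 | h5
  · obtain ⟨e1, e2⟩ := edges_of_neg h hs h5
    have hB := hillB_hi_ne h hs e1
    refine ⟨-1, Or.inr ⟨rfl, hedge _ hAhi hB, hB, ?_, ?_⟩, ?_, fun E hE => ?_⟩
    · rw [e2, hb]
    · rwa [e2]
    · rw [bulkIndex_eq h hs, edgeSign_of_ne hB]; norm_num
    · rw [e2] at hE
      have i1 := (band_spec h hs N).2.2.2.2.2.2.2 E hE
      have i2 := hillB_sign h hs (n := N) ⟨(delta_le_lo h hs N).trans_lt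
        ((lo_lt_hi h hs N).trans hE.1), hE.2⟩
      have i3 := neg_one_pow_sq N
      constructor
      · have : ((-1) ^ N * hillA ε μ E) ^ 2 = hillA ε μ E ^ 2 := by rw [mul_pow, i3, one_mul]
        rw [← this]; nlinarith
      · have : -1 * (hillA ε μ E * hillB ε μ E) =
            -((-1) ^ N * hillA ε μ E) * ((-1) ^ N * hillB ε μ E) := by
          linear_combination hillA ε μ E * hillB ε μ E * i3
        rw [this]
        exact mul_pos (by linarith) i2
  · obtain ⟨e1, e2⟩ := edges_of_pos h hs h5
    have hB := hillB_lo_ne h hs e2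
    refine ⟨1, Or.inl ⟨rfl, ?_, ?_, hedge _ hAlo hB, hB⟩, ?_, fun E hE => ?_⟩
    · rw [e1, hb]
    · rwa [e1]
    · rw [bulkIndex_eq h hs, edgeSign, e1, if_pos ⟨hb, hc⟩]
    · rw [e1] at hE
      have i1 := (band_spec h hs (N + 1)).2.2.2.2.2.2.1 E hE
      have i2 := hillB_sign h hs (n := N + 1) ⟨hE.1, hE.2.trans ((lo_lt_hi h hs _).trans_le
        (hi_le_delta h hs _))⟩
      have i3 := neg_one_pow_sq (N + 1)
      constructor
      · have : ((-1) ^ (N + 1) * hillA ε μ E) ^ 2 = hillA ε μ E ^ 2 := by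
          rw [mul_pow, i3, one_mul]
        rw [← this]; nlinarith
      · have : 1 * (hillA ε μ E * hillB ε μ E) =
            ((-1) ^ (N + 1) * hillA ε μ E) * ((-1) ^ (N + 1) * hillB ε μ E) := by
          linear_combination -(hillA ε μ E * hillB ε μ E) * i3
        rw [this]
        exact mul_pos (by linarith) i2

theorem bandHi_pos (N : ℕ) : 0 < bandHi ε μ N := by
  have h1 := (strictMono_hillDelta h hs).monotone (Nat.zero_le N)
  rw [hillDelta_zero] at h1
  exact h1.trans_lt ((delta_le_lo h hs N).trans_lt (lo_lt_hi h hs N))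

end Gap

end Photonic


namespace Photonic

/-! ### The structure with a defect -/

theorem coef_withDefect {f₁ fd f₂ : ℝ → ℝ} {d₁ d₂ : ℝ} (h₁ : Coef f₁) (h₂ : Coef f₂)
    (hd : PiecewiseContinuousOn fd d₁ d₂) (hlt : d₁ < d₂) : Coef (withDefect f₁ fd f₂ d₁ d₂) := by
  obtain ⟨C, hC⟩ := hd.bounded
  obtain ⟨S, hS⟩ := hd.1
  have k₁ := h₁.comp_add (-d₁)
  have k₂ := h₂.comp_add (-d₂)
  simp only [← sub_eq_add_neg] at k₁ k₂
  obtain ⟨C₁, hC₁⟩ := k₁.bdd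
  obtain ⟨C₂, hC₂⟩ := k₂.bdd
  obtain ⟨S₁, hS₁, c₁⟩ := k₁.cont
  obtain ⟨S₂, hS₂, c₂⟩ := k₂.cont
  refine ⟨⟨max C (max C₁ C₂), fun x => ?_⟩, S₁ ∪ S₂ ∪ S ∪ {d₁, d₂},
    ((hS₁.union hS₂).union S.countable_toSet).union ((Set.toFinite _).countable), fun x hx => ?_⟩
  · rw [withDefect]
    split_ifs with i1 i2
    · exact (hC₁ x).trans ((le_max_left _ _).trans (le_max_right _ _))
    · exact (hC x ⟨not_lt.1 i1, i2⟩).trans (le_max_left _ _)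
    · exact (hC₂ x).trans ((le_max_right _ _).trans (le_max_right _ _))
  · simp only [Set.mem_union, not_or, Set.mem_insert_iff, Set.mem_singleton_iff] at hx
    obtain ⟨⟨⟨x1, x2⟩, x3⟩, x4, x5⟩ := hx
    rcases lt_or_gt_of_ne x4 with i1 | i1
    · refine (c₁ x x1).congr ?_
      filter_upwards [Iio_mem_nhds i1] with t ht
      rw [withDefect, if_pos (Set.mem_Iio.1 ht)]
    rcases lt_or_gt_of_ne x5 with i2 | i2
    · refine (hS x ⟨i1, i2⟩ x3).congr ?_
      filter_upwards [Ioo_mem_nhds i1 i2] with t ht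
      rw [withDefect, if_neg (not_lt.2 ht.1.le), if_pos ht.2.le]
    · refine (c₂ x x2).congr ?_
      filter_upwards [Ioi_mem_nhds i2] with t ht
      rw [withDefect, if_neg (not_lt.2 (hlt.trans (Set.mem_Ioi.1 ht)).le), if_neg (not_le.2 ht)]

/-- Boundedness keeps the essential supremum finite, so that `toReal` does not collapse to its
default value. -/
theorem ae_le_supNorm {f : ℝ → ℝ} {a b : ℝ} (hf : PiecewiseContinuousOn f a b) :
    ∀ᵐ x, x ∈ Set.Ioo a b → f x ≤ supNorm f a b := by
  obtain ⟨C, hC⟩ := hf.bounded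
  have hfin : eLpNorm f ∞ (volume.restrict (Set.Ioo a b)) < ∞ := by
    rw [eLpNorm_exponent_top]
    refine eLpNormEssSup_lt_top_of_ae_bound (C := C) ?_
    rw [ae_restrict_iff' measurableSet_Ioo]
    exact ae_of_all _ fun x hx => hC x (Set.Ioo_subset_Icc_self hx)
  have h1 := ae_le_eLpNormEssSup (f := f) (μ := volume.restrict (Set.Ioo a b))
  rw [ae_restrict_iff' measurableSet_Ioo] at h1
  filter_upwards [h1] with x hx hxI
  have h2 := hx hxI
  rw [← eLpNorm_exponent_top] at h2
  have h3 := ENNReal.toReal_mono hfin.ne h2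
  rw [toReal_enorm] at h3
  exact (le_abs_self _).trans h3

/-- The two weights in the integrand add up to one, so it is at most `M` almost everywhere. -/
theorem Sol.prufer_le {m e u p : ℝ → ℝ} (h : Sol m e u p) (hm : Coef m) (he : Coef e)
    (hne : ∀ x, 0 < u x ^ 2 + p x ^ 2) {x y M : ℝ} (hxy : x ≤ y)
    (hmM : ∀ᵐ t, t ∈ Set.Ioo x y → m t ≤ M) (heM : ∀ᵐ t, t ∈ Set.Ioo x y → e t ≤ M) :
    pruferAngle m e u p x y ≤ M * (y - x) := by
  have h1 : pruferAngle m e u p x y ≤ ∫ _ in x..y, M := by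
    refine intervalIntegral.integral_mono_ae_restrict hxy (h.intervalIntegrable_prufer hm he hne x y)
      intervalIntegrable_const ?_
    rw [EventuallyLE, ← restrict_Ioo_eq_restrict_Icc, ae_restrict_iff' measurableSet_Ioo]
    filter_upwards [hmM, heM] with t h2 h3 ht
    have hn := hne t
    have e1 : p t ^ 2 / (u t ^ 2 + p t ^ 2) + u t ^ 2 / (u t ^ 2 + p t ^ 2) = 1 := by
      field_simp
      ring
    calc _ ≤ M * (p t ^ 2 / (u t ^ 2 + p t ^ 2)) + M * (u t ^ 2 / (u t ^ 2 + p t ^ 2)) :=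
          add_le_add (mul_le_mul_of_nonneg_right (h2 ht) (by positivity))
            (mul_le_mul_of_nonneg_right (h3 ht) (by positivity))
      _ = M := by rw [← mul_add, e1, mul_one]
  rw [intervalIntegral.integral_const, smul_eq_mul] at h1
  linarith

/-! ### Matching decaying solutions across the defect -/

section Interface

variable {ε₁ μ₁ ε₂ μ₂ ε μ : ℝ → ℝ} {D : ℝ}

/-- Decaying solutions on both half lines that match across the defect give a square integrable
solution. -/
theorem integrable_sq_of_match (h₁ : IsPeriodicStructure ε₁ μ₁)
    (hs₁ : IsInversionSymmetric ε₁ μ₁) (h₂ : IsPeriodicStructure ε₂ μ₂)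
    (hs₂ : IsInversionSymmetric ε₂ μ₂) (hε : Coef ε) (hμ : Coef μ) (hD : 0 ≤ D)
    (hε₁ : ∀ x < 0, ε x = ε₁ x) (hμ₁ : ∀ x < 0, μ x = μ₁ x)
    (hε₂ : ∀ x > 0, ε (x + D) = ε₂ x) (hμ₂ : ∀ x > 0, μ (x + D) = μ₂ x)
    {E a b l₁ l₂ : ℝ} (hl₁ : 1 < |l₁|) (hl₂ : |l₂| < 1) (hl₂0 : l₂ ≠ 0)
    (e₁ : hillA ε₁ μ₁ E * a + hillB ε₁ μ₁ E * b = l₁ * a)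
    (e₁' : hillC ε₁ μ₁ E * a + hillA ε₁ μ₁ E * b = l₁ * b)
    (e₂ : hillA ε₂ μ₂ E * solU ε μ a b E D + hillB ε₂ μ₂ E * solP ε μ a b E D =
      l₂ * solU ε μ a b E D)
    (e₂' : hillC ε₂ μ₂ E * solU ε μ a b E D + hillA ε₂ μ₂ E * solP ε μ a b E D =
      l₂ * solP ε μ a b E D) :
    Integrable fun x => solU ε μ a b E x ^ 2 := by
  have hS := sol_solU hε hμ a b E
  have cu := hS.continuous_u
  have i1 : IntegrableOn (fun x => solU ε μ a b E x ^ 2) (Set.Iic 0) := by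
    have hS1 := sol_solU h₁.coef_ε h₁.coef_μ a b E
    refine (integrableOn_sq_Iic hS1.continuous_u hl₁ (floquet h₁ hs₁ e₁ e₁')).congr_fun ?_
      measurableSet_Iic
    intro x hx
    have hx0 : x ≤ 0 := hx
    have r := (hS.repr h₁.coef_ε h₁.coef_μ hμ (hε.const_mul E) (x := x) (E := E)
      (fun t ht => hμ₁ t (ht.2.trans_le (max_eq_left hx0).le))
      (fun t ht => by rw [hε₁ t (ht.2.trans_le (max_eq_left hx0).le)])).1
    have r' := (hS1.repr_self h₁.coef_ε h₁.coef_μ x).1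
    rw [solU_zero h₁.coef_ε h₁.coef_μ, solP_zero h₁.coef_ε h₁.coef_μ] at r'
    rw [solU_zero hε hμ, solP_zero hε hμ, ← r'] at r
    simp only [r]
  have i2 : IntegrableOn (fun x => solU ε μ a b E x ^ 2) (Set.Ioi D) := by
    set a' := solU ε μ a b E D with ha'
    set b' := solP ε μ a b E D with hb'
    have hS2 := sol_solU h₂.coef_ε h₂.coef_μ a' b' E
    have hi : IntegrableOn (fun x => solU ε μ a b E (x + D) ^ 2) (Set.Ioi 0) := by
      refine (integrableOn_sq_Ioi hS2.continuous_u hl₂0 hl₂ (floquet h₂ hs₂ e₂ e₂')).congr_fun ?_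
        measurableSet_Ioi
      intro x hx
      have hx0 : 0 ≤ x := le_of_lt hx
      have r := ((hS.comp_add D).repr h₂.coef_ε h₂.coef_μ (hμ.comp_add D)
        ((hε.const_mul E).comp_add D) (x := x) (E := E)
        (fun t ht => hμ₂ t ((min_eq_left hx0).ge.trans_lt ht.1))
        (fun t ht => by rw [hε₂ t ((min_eq_left hx0).ge.trans_lt ht.1)])).1
      have r' := (hS2.repr_self h₂.coef_ε h₂.coef_μ x).1
      rw [solU_zero h₂.coef_ε h₂.coef_μ, solP_zero h₂.coef_ε h₂.coef_μ] at r'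
      rw [zero_add, ← ha', ← hb', ← r'] at r
      simp only [r]
    have := (measurePreserving_add_right volume D).integrableOn_comp_preimage
      (measurableEmbedding_addRight D) (f := fun x => solU ε μ a b E x ^ 2) (s := Set.Ioi D)
    rw [← this]
    simpa [Function.comp_def] using hi
  have i3 : IntegrableOn (fun x => solU ε μ a b E x ^ 2) (Set.Ioc 0 D) :=
    ((cu.pow 2).intervalIntegrable 0 D).1
  have := (i1.union i3).union i2
  rwa [Set.Iic_union_Ioc_eq_Iic hD, Set.Iic_union_Ioi, integrableOn_univ] at this

/-- Two gaps of opposite type that are matched through a defect with small phase shift contain the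
energy of a bound state. -/
theorem exists_bound_state (h₁ : IsPeriodicStructure ε₁ μ₁)
    (hs₁ : IsInversionSymmetric ε₁ μ₁) (h₂ : IsPeriodicStructure ε₂ μ₂)
    (hs₂ : IsInversionSymmetric ε₂ μ₂) (hε : Coef ε) (hμ : Coef μ) (hD : 0 < D)
    (hε₁ : ∀ x < 0, ε x = ε₁ x) (hμ₁ : ∀ x < 0, μ x = μ₁ x)
    (hε₂ : ∀ x > 0, ε (x + D) = ε₂ x) (hμ₂ : ∀ x > 0, μ (x + D) = μ₂ x)
    (hεp : ∀ x ∈ Set.Ioo 0 D, 0 < ε x) (hμp : ∀ x ∈ Set.Ioo 0 D, 0 < μ x) {M K : ℝ}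
    (hμM : ∀ᵐ x, x ∈ Set.Ioo 0 D → μ x ≤ M) (hεK : ∀ᵐ x, x ∈ Set.Ioo 0 D → ε x ≤ K)
    {E₀ E₁ σ : ℝ} (hE₀ : 0 < E₀) (hE : E₀ < E₁)
    (hsmall : ∀ E ∈ Set.Ioo E₀ E₁, max M (E * K) * D < π / 2) (hσ : σ ^ 2 = 1)
    (hgap₁ : ∀ E ∈ Set.Ioo E₀ E₁, 1 < hillA ε₁ μ₁ E ^ 2 ∧
      0 < σ * (hillA ε₁ μ₁ E * hillB ε₁ μ₁ E))
    (hgap₂ : ∀ E ∈ Set.Ioo E₀ E₁, 1 < hillA ε₂ μ₂ E ^ 2 ∧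
      0 < -σ * (hillA ε₂ μ₂ E * hillB ε₂ μ₂ E))
    (hlow : √|hillB ε₁ μ₁ E₀| * √|hillB ε₂ μ₂ E₀| + √|hillC ε₁ μ₁ E₀| * √|hillC ε₂ μ₂ E₀| = 0)
    (hlow' : σ * (√|hillB ε₁ μ₁ E₀| * √|hillC ε₂ μ₂ E₀| -
      √|hillC ε₁ μ₁ E₀| * √|hillB ε₂ μ₂ E₀|) < 0)
    (hupp : 0 < σ * (√|hillB ε₁ μ₁ E₁| * √|hillC ε₂ μ₂ E₁| -
      √|hillC ε₁ μ₁ E₁| * √|hillB ε₂ μ₂ E₁|)) :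
    ∃ E ∈ Set.Ioo E₀ E₁, ∃ a b : ℝ, (a ≠ 0 ∨ b ≠ 0) ∧
      Integrable fun x => solU ε μ a b E x ^ 2 := by
  set g₁ : ℝ → ℝ := fun E => √|hillB ε₁ μ₁ E| with hg₁
  set g₂ : ℝ → ℝ := fun E => √|hillB ε₂ μ₂ E| with hg₂
  set k₁ : ℝ → ℝ := fun E => √|hillC ε₁ μ₁ E| with hk₁
  set k₂ : ℝ → ℝ := fun E => √|hillC ε₂ μ₂ E| with hk₂
  have cg₁ : Continuous g₁ := (continuous_hillB h₁).abs.sqrt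
  have cg₂ : Continuous g₂ := (continuous_hillB h₂).abs.sqrt
  have ck₁ : Continuous k₁ := (continuous_hillC h₁).abs.sqrt
  have ck₂ : Continuous k₂ := (continuous_hillC h₂).abs.sqrt
  -- The Wronskian at `D` of the left eigenvector (g₁, σk₁), carried across the defect, with the
  -- right eigenvector (g₂, σk₂).
  set W : ℝ → ℝ := fun E =>
    (solU ε μ 1 0 E D * g₁ E + solU ε μ 0 1 E D * (σ * k₁ E)) * (σ * k₂ E) -
      (solP ε μ 1 0 E D * g₁ E + solP ε μ 0 1 E D * (σ * k₁ E)) * g₂ E with hW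
  have cW : Continuous W := by
    have c1 := continuous_solU_energy hε hμ 1 0 D
    have c2 := continuous_solU_energy hε hμ 0 1 D
    have c3 := continuous_solP_energy hε hμ 1 0 D
    have c4 := continuous_solP_energy hε hμ 0 1 D
    fun_prop
  have rep : ∀ E a b, solU ε μ a b E D = solU ε μ 1 0 E D * a + solU ε μ 0 1 E D * b ∧
      solP ε μ a b E D = solP ε μ 1 0 E D * a + solP ε μ 0 1 E D * b := fun E a b => by
    have := (sol_solU hε hμ a b E).repr_self hε hμ D
    simpa only [solU_zero hε hμ, solP_zero hε hμ, smul_eq_mul] using this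
  -- Up to a factor `r` the defect acts on the left vector as a rotation by its Prüfer increment δ;
  -- the smallness condition keeps δ below π/2, so that cos δ > 0.
  have key : ∀ E, 0 < E → max M (E * K) * D < π / 2 → (g₁ E ≠ 0 ∨ σ * k₁ E ≠ 0) →
      ∃ r s c : ℝ, 0 < r ∧ 0 ≤ s ∧ 0 < c ∧
        W E = r * (c * (σ * (g₁ E * k₂ E - k₁ E * g₂ E)) + s * (g₁ E * g₂ E + k₁ E * k₂ E)) := by
    intro E hE0 hEs hne
    have hS := sol_solU hε hμ (g₁ E) (σ * k₁ E) E
    have hsq := sol_sq_pos hε hμ hne E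
    have he := hε.const_mul E
    obtain ⟨r, hr, q1, q2⟩ := hS.prufer_aux hμ he hsq 0 D
    have p1 := hS.prufer_pos hμ he hsq hD hμp (fun t ht => mul_pos hE0 (hεp t ht))
    have p2 := hS.prufer_le hμ he hsq (M := max M (E * K)) hD.le
      (by filter_upwards [hμM] with t ht hI using (ht hI).trans (le_max_left _ _))
      (by filter_upwards [hεK] with t ht hI using
        (mul_le_mul_of_nonneg_left (ht hI) hE0.le).trans (le_max_right _ _))
    rw [sub_zero] at p2
    set δ := pruferAngle μ (fun t => E * ε t) (solU ε μ (g₁ E) (σ * k₁ E) E)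
      (solP ε μ (g₁ E) (σ * k₁ E) E) 0 D
    rw [solU_zero hε hμ] at q1
    rw [solP_zero hε hμ] at q2
    have hsc := Real.sin_sq_add_cos_sq δ
    refine ⟨r, Real.sin δ, Real.cos δ, hr, Real.sin_nonneg_of_nonneg_of_le_pi p1.le
      (by linarith [Real.pi_pos]), Real.cos_pos_of_mem_Ioo ⟨by linarith [Real.pi_pos],
      by linarith⟩, ?_⟩
    have w : W E = solU ε μ (g₁ E) (σ * k₁ E) E D * (σ * k₂ E) -
        solP ε μ (g₁ E) (σ * k₁ E) E D * g₂ E := by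
      rw [(rep E _ _).1, (rep E _ _).2]
    set U := solU ε μ (g₁ E) (σ * k₁ E) E D
    set Q := solP ε μ (g₁ E) (σ * k₁ E) E D
    have eU : U = r * (Real.cos δ * g₁ E + Real.sin δ * (σ * k₁ E)) := by
      linear_combination Real.cos δ * q1 + Real.sin δ * q2 - U * hsc
    have eQ : Q = r * (Real.cos δ * (σ * k₁ E) - Real.sin δ * g₁ E) := by
      linear_combination Real.cos δ * q2 - Real.sin δ * q1 - Q * hsc
    rw [w, eU, eQ]
    linear_combination r * Real.sin δ * k₁ E * k₂ E * hσ
  have hW0 : W E₀ < 0 := by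
    have hne : g₁ E₀ ≠ 0 ∨ σ * k₁ E₀ ≠ 0 := by
      by_contra! hc
      have hσ0 : σ ≠ 0 := by rintro rfl; norm_num at hσ
      have h0 := (mul_eq_zero.1 hc.2).resolve_left hσ0
      have : σ * (g₁ E₀ * k₂ E₀ - k₁ E₀ * g₂ E₀) < 0 := hlow'
      rw [hc.1, h0] at this
      simp at this
    -- Smallness is assumed only inside the gap. It extends to the lower edge because the bound
    -- increases with the energy, for which `K ≥ 0` is needed.
    have hsm : max M (E₀ * K) * D < π / 2 := by
      obtain ⟨E, hEm⟩ := exists_between hE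
      refine lt_of_le_of_lt ?_ (hsmall E hEm)
      have hK : 0 ≤ K := by
        by_contra! hK
        have : ∀ᵐ x, x ∉ Set.Ioo 0 D := by
          filter_upwards [hεK] with x hx hI
          linarith [hx hI, hεp x hI]
        have h0 : volume (Set.Ioo 0 D) = 0 := by
          rw [measure_eq_zero_iff_ae_notMem]; exact this
        rw [Real.volume_Ioo] at h0
        simp at h0
        linarith
      gcongr
      exact hEm.1.le
    obtain ⟨r, s, c, hr, hs, hc, hw⟩ := key E₀ hE₀ hsm hne
    have e1 : g₁ E₀ * g₂ E₀ + k₁ E₀ * k₂ E₀ = 0 := hlow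
    rw [hw, e1, mul_zero, add_zero]
    exact mul_neg_of_pos_of_neg hr (mul_neg_of_pos_of_neg hc hlow')
  -- At the upper edge itself strict smallness may fail, so the sign is taken at a slightly smaller
  -- energy, where the sine term is still nonnegative.
  obtain ⟨E', hE', hW1⟩ : ∃ E' ∈ Set.Ioo E₀ E₁, 0 < W E' := by
    have cd : Continuous fun E => σ * (g₁ E * k₂ E - k₁ E * g₂ E) := by fun_prop
    have hev : ∀ᶠ E in 𝓝[<] E₁, 0 < σ * (g₁ E * k₂ E - k₁ E * g₂ E) :=
      nhdsWithin_le_nhds (cd.continuousAt.eventually (lt_mem_nhds hupp))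
    obtain ⟨E', h3, h4⟩ := (hev.and (Ioo_mem_nhdsLT hE)).exists
    refine ⟨E', h4, ?_⟩
    have hne : g₁ E' ≠ 0 ∨ σ * k₁ E' ≠ 0 := by
      left
      refine (Real.sqrt_pos.2 (abs_pos.2 ?_)).ne'
      intro hB
      have := (hgap₁ E' h4).2
      rw [hB] at this
      simp at this
    obtain ⟨r, s, c, hr, hs, hc, hw⟩ := key E' (hE₀.trans h4.1) (hsmall E' h4) hne
    rw [hw]
    have e1 : 0 ≤ g₁ E' * g₂ E' + k₁ E' * k₂ E' :=
      add_nonneg (mul_nonneg (Real.sqrt_nonneg _) (Real.sqrt_nonneg _))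
        (mul_nonneg (Real.sqrt_nonneg _) (Real.sqrt_nonneg _))
    exact mul_pos hr (add_pos_of_pos_of_nonneg (mul_pos hc h3) (mul_nonneg hs e1))
  obtain ⟨E, hEm, hWE⟩ := intermediate_value_Ioo hE'.1.le cW.continuousOn ⟨hW0, hW1⟩
  have hEI : E ∈ Set.Ioo E₀ E₁ := ⟨hEm.1, hEm.2.trans hE'.2⟩
  have gap₁ := hgap₁ E hEI
  have gap₂ := hgap₂ E hEI
  obtain ⟨l₁, f1, f2, f3, -⟩ := hill_eigenvector h₁ hs₁ hσ gap₁.1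
  obtain ⟨l₂, f4, f5, -, f6⟩ := hill_eigenvector h₂ hs₂ hσ gap₂.1
  obtain ⟨hl0, hl2⟩ := f6 (by linarith [gap₂.2])
  have hgne : ∀ {s : ℝ} {ε μ : ℝ → ℝ}, 0 < s * (hillA ε μ E * hillB ε μ E) →
      √|hillB ε μ E| ≠ 0 := by
    intro s ε μ hp
    refine (Real.sqrt_pos.2 (abs_pos.2 ?_)).ne'
    intro hB
    rw [hB] at hp
    simp at hp
  have hg1 := hgne gap₁.2
  have hg2 := hgne gap₂.2
  refine ⟨E, hEI, √|hillB ε₁ μ₁ E|, σ * √|hillC ε₁ μ₁ E|, Or.inl hg1, ?_⟩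
  have w : solU ε μ (g₁ E) (σ * k₁ E) E D * (σ * k₂ E) =
      solP ε μ (g₁ E) (σ * k₁ E) E D * g₂ E := by
    rw [(rep E _ _).1, (rep E _ _).2]
    exact sub_eq_zero.1 hWE
  -- As W = 0, the vector at `D` is proportional to the right eigenvector; multiplied by g₂ ≠ 0, its
  -- eigenvalue equations follow from those of (g₂, σk₂).
  refine integrable_sq_of_match h₁ hs₁ h₂ hs₂ hε hμ hD.le hε₁ hμ₁ hε₂ hμ₂ (f3 gap₁.2) hl2 hl0
    f1 f2 ?_ ?_
  · refine mul_right_cancel₀ hg2 ?_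
    linear_combination solU ε μ (g₁ E) (σ * k₁ E) E D * f4 - hillB ε₂ μ₂ E * w
  · refine mul_right_cancel₀ hg2 ?_
    linear_combination solU ε μ (g₁ E) (σ * k₁ E) E D * f5 + (l₂ - hillA ε₂ μ₂ E) * w

end Interface

end Photonic


namespace Photonic

/-- A square integrable solution for the translated defect structure gives an interface mode. -/
theorem IsInterfaceMode.of_integrable {ε μ : ℝ → ℝ} (hε : Coef ε) (hμ : Coef μ) (d : ℝ)
    {E a b : ℝ} (hab : a ≠ 0 ∨ b ≠ 0) (hpos : ∃ x > 0, ∀ t ∈ Set.Ioo 0 x, 0 < μ (t + d))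
    (hint : Integrable fun x => solU (fun x => ε (x + d)) (fun x => μ (x + d)) a b E x ^ 2) :
    ∃ ψ : ℝ → ℂ, IsInterfaceMode ε μ E ψ := by
  have hε' := hε.comp_add d
  have hμ' := hμ.comp_add d
  have hS := sol_solU hε' hμ' a b E
  set u := solU (fun x => ε (x + d)) (fun x => μ (x + d)) a b E with hu
  set p := solP (fun x => ε (x + d)) (fun x => μ (x + d)) a b E with hp
  have he' := hε'.const_mul E
  have hT := (hS.map hμ' he' Complex.ofRealCLM).comp_add (-d)
  simp only [neg_add_cancel_right, Complex.ofRealCLM_apply] at hT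
  refine ⟨fun x => (u (x + -d) : ℂ), fun h0 => ?_, ?_, _, (isSolution_iff hε hμ).2 hT⟩
  · have hu0 : ∀ x, u x = 0 := fun x => by
      have := congrFun h0 (x + d)
      simpa using this
    have ha : a = 0 := by rw [← solU_zero hε' hμ' a b E]; exact hu0 0
    have hb : b ≠ 0 := hab.resolve_left fun h => h ha
    have hpb : ∀ x, p x = b := fun x => by
      have := hS.eq_p 0 x
      rw [hp, solP_zero hε' hμ'] at this
      simp only [← hp, hu0, smul_zero, intervalIntegral.integral_zero, neg_zero] at this
      linarith
    -- A zero solution with nonzero constant flux is excluded because `μ` has positive integral near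
    -- the origin.
    obtain ⟨x, hx, hpx⟩ := hpos
    have h1 := hS.eq_u 0 x
    simp only [hu0, hpb, smul_eq_mul, sub_zero] at h1
    rw [intervalIntegral.integral_mul_const] at h1
    have h2 : 0 < ∫ t in (0 : ℝ)..x, μ (t + d) :=
      intervalIntegral.intervalIntegral_pos_of_pos_on (hμ'.intervalIntegrable 0 x) hpx hx
    exact (mul_ne_zero h2.ne' hb) h1.symm
  · have h1 : MemLp u 2 volume :=
      (memLp_two_iff_integrable_sq hS.continuous_u.aestronglyMeasurable).2 hint
    have h2 : MemLp (fun x => u (x + -d)) 2 volume :=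
      h1.comp_measurePreserving (measurePreserving_add_right volume (-d))
    exact h2.ofReal

end Photonic

theorem mainTheorem7 (ε₁ μ₁ ε₂ μ₂ εd μd : ℝ → ℝ) (d₁ d₂ : ℝ) (m₁ m₂ : ℕ)
    (h₁ : Photonic.IsPeriodicStructure ε₁ μ₁) (hs₁ : Photonic.IsInversionSymmetric ε₁ μ₁)
    (h₂ : Photonic.IsPeriodicStructure ε₂ μ₂) (hs₂ : Photonic.IsInversionSymmetric ε₂ μ₂)
    (hm₁ : 1 ≤ m₁) (hm₂ : 1 ≤ m₂)
    (hgap : Photonic.bandUpper ε₁ μ₁ m₁ < Photonic.bandLower ε₁ μ₁ (m₁ + 1))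
    (hlower : Photonic.bandUpper ε₁ μ₁ m₁ = Photonic.bandUpper ε₂ μ₂ m₂)
    (hupper : Photonic.bandLower ε₁ μ₁ (m₁ + 1) = Photonic.bandLower ε₂ μ₂ (m₂ + 1))
    (hindex : Photonic.bulkIndex ε₁ μ₁ m₁ ≠ Photonic.bulkIndex ε₂ μ₂ m₂)
    (hd₁ : d₁ < 0) (hd₂ : 0 < d₂)
    (hεd_pos : ∀ x ∈ Set.Ioo d₁ d₂, 0 < εd x) (hμd_pos : ∀ x ∈ Set.Ioo d₁ d₂, 0 < μd x)
    (hεd : Photonic.PiecewiseContinuousOn εd d₁ d₂)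
    (hμd : Photonic.PiecewiseContinuousOn μd d₁ d₂)
    (hsmall : ∀ E ∈ Set.Ioo (Photonic.bandUpper ε₁ μ₁ m₁) (Photonic.bandLower ε₁ μ₁ (m₁ + 1)),
      max (Photonic.supNorm μd d₁ d₂) (E * Photonic.supNorm εd d₁ d₂) * (d₂ - d₁) < π / 2) :
    ∃ E ∈ Set.Ioo (Photonic.bandUpper ε₁ μ₁ m₁) (Photonic.bandLower ε₁ μ₁ (m₁ + 1)),
      ∃ ψ : ℝ → ℂ, Photonic.IsInterfaceMode
        (Photonic.withDefect ε₁ εd ε₂ d₁ d₂) (Photonic.withDefect μ₁ μd μ₂ d₁ d₂) E ψ := by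
  obtain ⟨N₁, rfl⟩ : ∃ n, m₁ = n + 1 := ⟨m₁ - 1, (Nat.sub_add_cancel hm₁).symm⟩
  obtain ⟨N₂, rfl⟩ : ∃ n, m₂ = n + 1 := ⟨m₂ - 1, (Nat.sub_add_cancel hm₂).symm⟩
  rw [Photonic.bandUpper_eq h₁ hs₁, Photonic.bandLower_eq h₁ hs₁] at *
  rw [Photonic.bandUpper_eq h₂ hs₂] at hlower
  rw [Photonic.bandLower_eq h₂ hs₂] at hupper
  have hlt : d₁ < d₂ := hd₁.trans hd₂
  obtain ⟨σ, hσ, i₁, gap₁⟩ := Photonic.gap_spec h₁ hs₁ hgap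
  obtain ⟨τ, hτ, i₂, gap₂⟩ := Photonic.gap_spec h₂ hs₂ (N := N₂) (hlower ▸ hupper ▸ hgap)
  rw [← hlower, ← hupper] at hτ gap₂
  have hne : σ ≠ τ := by
    rintro rfl
    exact hindex (i₁.trans i₂.symm)
  have cε := Photonic.coef_withDefect h₁.coef_ε h₂.coef_ε hεd hlt
  have cμ := Photonic.coef_withDefect h₁.coef_μ h₂.coef_μ hμd hlt
  have left : ∀ f₁ fd f₂ : ℝ → ℝ, ∀ x < 0, Photonic.withDefect f₁ fd f₂ d₁ d₂ (x + d₁) = f₁ x := by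
    intro f₁ fd f₂ x hx
    rw [Photonic.withDefect, if_pos (by linarith), add_sub_cancel_right]
  have mid : ∀ f₁ fd f₂ : ℝ → ℝ, ∀ x ∈ Set.Ioo 0 (d₂ - d₁),
      Photonic.withDefect f₁ fd f₂ d₁ d₂ (x + d₁) = fd (x + d₁) := by
    intro f₁ fd f₂ x hx
    rw [Photonic.withDefect, if_neg (by linarith [hx.1]), if_pos (by linarith [hx.2])]
  have right : ∀ f₁ fd f₂ : ℝ → ℝ, ∀ x > 0,
      Photonic.withDefect f₁ fd f₂ d₁ d₂ (x + (d₂ - d₁) + d₁) = f₂ x := by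
    intro f₁ fd f₂ x hx
    rw [Photonic.withDefect, if_neg (by linarith), if_neg (by linarith)]
    congr 1; ring
  have sub : ∀ x ∈ Set.Ioo 0 (d₂ - d₁), x + d₁ ∈ Set.Ioo d₁ d₂ := fun x hx =>
    ⟨by linarith [hx.1], by linarith [hx.2]⟩
  have pos : ∀ f₁ fd f₂ : ℝ → ℝ, (∀ x ∈ Set.Ioo d₁ d₂, 0 < fd x) → ∀ x ∈ Set.Ioo 0 (d₂ - d₁),
      0 < Photonic.withDefect f₁ fd f₂ d₁ d₂ (x + d₁) := fun f₁ fd f₂ hf x hx => by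
    rw [mid _ _ _ x hx]; exact hf _ (sub x hx)
  have bound : ∀ f₁ fd f₂ : ℝ → ℝ, Photonic.PiecewiseContinuousOn fd d₁ d₂ →
      ∀ᵐ x, x ∈ Set.Ioo 0 (d₂ - d₁) →
        Photonic.withDefect f₁ fd f₂ d₁ d₂ (x + d₁) ≤ Photonic.supNorm fd d₁ d₂ := by
    intro f₁ fd f₂ hf
    have := (measurePreserving_add_right volume d₁).quasiMeasurePreserving.ae
      (Photonic.ae_le_supNorm hf)
    filter_upwards [this] with x hx hI
    rw [mid _ _ _ x hI]
    exact hx (sub x hI)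
  have hE₀ := Photonic.bandHi_pos h₁ hs₁ N₁
  have hsq : σ ^ 2 = 1 := by rcases hσ with h | h <;> rw [h.1] <;> norm_num
  -- Different indices mean different types, and the types are ±1.
  have hneg : τ = -σ := by
    rcases hσ with h | h <;> rcases hτ with h' | h'
    · exact absurd (h.1.trans h'.1.symm) hne
    · rw [h.1, h'.1]
    · rw [h.1, h'.1, neg_neg]
    · exact absurd (h.1.trans h'.1.symm) hne
  have sqrt_pos : ∀ {x : ℝ}, x ≠ 0 → 0 < √|x| := fun hx => Real.sqrt_pos.2 (abs_pos.2 hx)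
  -- Translation by `d₁` moves the defect to the interval from 0 to d₂ - d₁. At the lower edge one
  -- structure has B = 0 and the other C = 0, and at the upper edge the roles are exchanged; these
  -- zeros settle the three conditions at the edges.
  obtain ⟨E, hE, a, b, hab, hint⟩ := Photonic.exists_bound_state h₁ hs₁ h₂ hs₂ (cε.comp_add d₁)
    (cμ.comp_add d₁) (sub_pos.2 hlt) (left _ _ _) (left _ _ _) (right _ _ _) (right _ _ _)
    (pos _ _ _ hεd_pos) (pos _ _ _ hμd_pos) (bound _ _ _ hμd) (bound _ _ _ hεd) hE₀ hgap hsmall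
    hsq gap₁ (hneg ▸ gap₂)
    (by
      rcases hσ with ⟨h, h1, -⟩ | ⟨h, h1, -⟩ <;> rcases hτ with ⟨h', h2, -⟩ | ⟨h', h2, -⟩
      · exact absurd (h.trans h'.symm) hne
      · simp [h1, h2]
      · simp [h1, h2]
      · exact absurd (h.trans h'.symm) hne)
    (by
      rcases hσ with ⟨h, h1, h3, -⟩ | ⟨h, h1, h3, -⟩ <;>
        rcases hτ with ⟨h', h2, h4, -⟩ | ⟨h', h2, h4, -⟩
      · exact absurd (h.trans h'.symm) hne
      · simpa [h, h1, h2] using mul_pos (sqrt_pos h3) (sqrt_pos h4)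
      · simpa [h, h1, h2] using mul_pos (sqrt_pos h3) (sqrt_pos h4)
      · exact absurd (h.trans h'.symm) hne)
    (by
      rcases hσ with ⟨h, -, -, h1, h3⟩ | ⟨h, -, -, h1, h3⟩ <;>
        rcases hτ with ⟨h', -, -, h2, h4⟩ | ⟨h', -, -, h2, h4⟩
      · exact absurd (h.trans h'.symm) hne
      · simpa [h, h1, h2] using mul_pos (sqrt_pos h3) (sqrt_pos h4)
      · simpa [h, h1, h2] using mul_pos (sqrt_pos h3) (sqrt_pos h4)
      · exact absurd (h.trans h'.symm) hne)
  exact ⟨E, hE, Photonic.IsInterfaceMode.of_integrable cε cμ d₁ hab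
    ⟨d₂ - d₁, sub_pos.2 hlt, pos _ _ _ hμd_pos⟩ hint⟩
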